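/- Let $k$ be a field. A weak Hopf algebra $H$ over $k$ is a $k$-algebra and $k$-coalgebra $(H,\Delta,\varepsilon)$ with a linear map $S:H\to H$ such that for all $x,y,z\in H$: $\Delta(xy)=\Delta(x)\Delta(y)$; $\Delta^2(1)=(\Delta(1)\otimes 1)(1\otimes\Delta(1))=(1\otimes\Delta(1))(\Delta(1)\otimes 1)$; $\varepsilon(xyz)=\varepsilon(xy_{(1)})\varepsilon(y_{(2)}z)=\varepsilon(xy_{(2)})\varepsilon(y_{(1)}z)$; $x_{(1)}S(x_{(2)})=\varepsilon_t(x)$, $S(x_{(1)})x_{(2)}=\varepsilon_s(x)$, $S(x_{(1)})x_{(2)}S(x_{(3)})=S(x)$, where $\varepsilon_t(x)=\varepsilon(1_{(1)}x)1_{(2)}$ and $\varepsilon_s(x)=1_{(1)}\varepsilon(x1_{(2)})$. Put $H_t=\varepsilon_t(H)$, $H_s=\varepsilon_s(H)$. Assume that $H$ is finite-dimensional and regular, i.e. $S^2$ is the identity on $H_tH_s$. Let $R=R^1\otimes R^2\in\Delta^{op}(1)(H\otimes H)\Delta(1)$ be an R-matrix: $R\Delta(h)=\Delta^{op}(h)R$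 for all $h\in H$, $(\mathrm{id}\otimes\Delta)R=R_{13}R_{12}$, $(\Delta\otimes\mathrm{id})R=R_{13}R_{23}$, and there is $\bar R\in\Delta(1)(H\otimes H)\Delta^{op}(1)$ with $R\bar R=\Delta^{op}(1)$, $\bar RR=\Delta(1)$. Let $\mathcal C$ be the monoidal category of finite-dimensional left $H$-modules with $M\otimes_tN=\Delta(1)(M\otimes_kN)$, on which $h$ acts as $\Delta(h)$, with unit object $H_t$ ($h\cdot z=\varepsilon_t(hz)$) and unit isomorphisms $l(z\otimes x)=zx$, $r(x\otimes z)=S(z)x$. Let $B=C_H(H_s)$ be the centralizer of $H_s$ in $H$, with the adjoint action $h\cdot_{ad}b=h_{(1)}bS(h_{(2)})$, comultiplication $\Delta_B(b)=b_{(1)}S(R^2)\otimes R^1\cdot_{ad}b_{(2)}$ and counit $\varepsilon_B(b)=\varepsilon_t(b)$. Let $B\text{-}\mathrm{Comod}_{\mathcal C}$ be the category of left $B$-comodules in $\mathcal C$, with coaction written $\rho_R(m)=m^{\langle-1\rangle}\otimes m^{\langle0\rangle}\in B\otimes_tM$. Let ${}_H^H\mathcal{YD}$ be the category of finite-dimensional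 left $H$-modules $M$ with a coassociative and counital left $H$-coaction $\rho(m)=m_{\langle-1\rangle}\otimes m_{\langle0\rangle}\in H\otimes_tM$ satisfying $h_{(1)}m_{\langle-1\rangle}\otimes h_{(2)}m_{\langle0\rangle}=(h_{(1)}m)_{\langle-1\rangle}h_{(2)}\otimes(h_{(1)}m)_{\langle0\rangle}$ for all $h\in H$, $m\in M$; its morphisms are the $H$-linear $H$-colinear maps. Then $B$ is a well-defined coalgebra in $\mathcal C$; the assignments $$\mathcal F:B\text{-}\mathrm{Comod}_{\mathcal C}\to{}_H^H\mathcal{YD},\quad(M,\rho_R)\mapsto(M,\rho),\quad\rho(m)=m^{\langle-1\rangle}R^2\otimes R^1m^{\langle0\rangle},$$ $$\mathcal G:{}_H^H\mathcal{YD}\to B\text{-}\mathrm{Comod}_{\mathcal C},\quad(M,\rho)\mapsto(M,\rho_R),\quad\rho_R(m)=m_{\langle-1\rangle}S(R^2)\otimes R^1m_{\langle0\rangle},$$ which leave the underlying modules and linear maps unchanged, are well-defined functors; and $\mathcal F$ is an equivalence of categories with quasi-inverse $\mathcal G$. -/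

import Mathlib

open scoped TensorProduct
open CategoryTheory

universe u v w w'

namespace WHA

noncomputable section

/-! ## Weak Hopf algebras -/

section WeakHopf

variable (k : Type u) (H : Type v) [Field k] [Ring H] [Algebra k H]

/-- The comultiplication `Δ : H → H ⊗ H`. -/
abbrev Δ [Coalgebra k H] : H →ₗ[k] H ⊗[k] H := Coalgebra.comul

/-- The opposite comultiplication `h ↦ h₍₂₎ ⊗ h₍₁₎`. -/
def Δop [Coalgebra k H] : H →ₗ[k] H ⊗[k] H := (TensorProduct.comm k H H).toLinearMap ∘ₗ Δ k H

/-- The counit `ε : H → k`. -/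
abbrev ε [Coalgebra k H] : H →ₗ[k] k := Coalgebra.counit

/-- The target counital map `ε_t(x) = ε(1₍₁₎ x) 1₍₂₎`. -/
def epsT [Coalgebra k H] : H →ₗ[k] H where
  toFun x := TensorProduct.lid k H ((ε k H ∘ₗ LinearMap.mulRight k x).rTensor H (Δ k H 1))
  map_add' x y := by
    have h : LinearMap.mulRight k (x + y) = LinearMap.mulRight k x + LinearMap.mulRight k y := by
      ext; simp [mul_add]
    rw [h, LinearMap.comp_add, LinearMap.rTensor_add, LinearMap.add_apply, map_add]
  map_smul' c x := by
    have h : LinearMap.mulRight k (c • x) = c • LinearMap.mulRight k x := by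
      ext; simp
    rw [h, LinearMap.comp_smul, LinearMap.rTensor_smul, LinearMap.smul_apply, map_smul]; rfl

/-- The source counital map `ε_s(x) = 1₍₁₎ ε(x 1₍₂₎)`. -/
def epsS [Coalgebra k H] : H →ₗ[k] H where
  toFun x := TensorProduct.rid k H ((ε k H ∘ₗ LinearMap.mulLeft k x).lTensor H (Δ k H 1))
  map_add' x y := by
    have h : LinearMap.mulLeft k (x + y) = LinearMap.mulLeft k x + LinearMap.mulLeft k y := by
      ext; simp [add_mul]
    rw [h, LinearMap.comp_add, LinearMap.lTensor_add, LinearMap.add_apply, map_add]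
  map_smul' c x := by
    have h : LinearMap.mulLeft k (c • x) = c • LinearMap.mulLeft k x := by
      ext; simp
    rw [h, LinearMap.comp_smul, LinearMap.lTensor_smul, LinearMap.smul_apply, map_smul]; rfl

/-- A weak Hopf algebra over the field `k`: a `k`-algebra which is also a `k`-coalgebra, with an
antipode, subject to the axioms of Böhm, Nill and Szlachányi. -/
class WeakHopfAlgebra extends Coalgebra k H where
  /-- The antipode. -/
  antipode : H →ₗ[k] H
  /-- `Δ(xy) = Δ(x)Δ(y)`. -/
  comul_mul : ∀ x y : H, Δ k H (x * y) = Δ k H x * Δ k H y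
  /-- `Δ²(1) = (Δ(1) ⊗ 1)(1 ⊗ Δ(1))`. -/
  comul_one_left : (Δ k H).lTensor H (Δ k H 1) =
    TensorProduct.assoc k H H H (Δ k H 1 ⊗ₜ[k] 1) * ((1 : H) ⊗ₜ[k] Δ k H 1)
  /-- `Δ²(1) = (1 ⊗ Δ(1))(Δ(1) ⊗ 1)`. -/
  comul_one_right : (Δ k H).lTensor H (Δ k H 1) =
    ((1 : H) ⊗ₜ[k] Δ k H 1) * TensorProduct.assoc k H H H (Δ k H 1 ⊗ₜ[k] 1)
  /-- `ε(xyz) = ε(x y₍₁₎) ε(y₍₂₎ z)`. -/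
  counit_mul_left : ∀ x y z : H, ε k H (x * y * z) =
    LinearMap.mul' k k (TensorProduct.map (ε k H ∘ₗ LinearMap.mulLeft k x)
      (ε k H ∘ₗ LinearMap.mulRight k z) (Δ k H y))
  /-- `ε(xyz) = ε(x y₍₂₎) ε(y₍₁₎ z)`. -/
  counit_mul_right : ∀ x y z : H, ε k H (x * y * z) =
    LinearMap.mul' k k (TensorProduct.map (ε k H ∘ₗ LinearMap.mulLeft k x)
      (ε k H ∘ₗ LinearMap.mulRight k z) (Δop k H y))
  /-- `x₍₁₎ S(x₍₂₎) = ε_t(x)`. -/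
  mul_antipode : ∀ x : H, LinearMap.mul' k H (antipode.lTensor H (Δ k H x)) = epsT k H x
  /-- `S(x₍₁₎) x₍₂₎ = ε_s(x)`. -/
  antipode_mul : ∀ x : H, LinearMap.mul' k H (antipode.rTensor H (Δ k H x)) = epsS k H x
  /-- `S(x₍₁₎) x₍₂₎ S(x₍₃₎) = S(x)`. -/
  antipode_mul_antipode : ∀ x : H,
    LinearMap.mul' k H (TensorProduct.map antipode
      (LinearMap.mul' k H ∘ₗ antipode.lTensor H ∘ₗ Δ k H) (Δ k H x)) = antipode x

variable [WeakHopfAlgebra k H]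

/-- The antipode `S : H → H`. -/
abbrev S : H →ₗ[k] H := WeakHopfAlgebra.antipode

/-- `H` is regular: `S²` is the identity on `H_t H_s`. -/
def IsRegular : Prop :=
  ∀ x y : H, S k H (S k H (epsT k H x * epsS k H y)) = epsT k H x * epsS k H y

variable {k H} in
/-- `R` is an R-matrix of `H`, that is, `(H, R)` is a quasi-triangular weak Hopf algebra. -/
structure IsRMatrix (R : H ⊗[k] H) : Prop where
  mem : ∃ x : H ⊗[k] H, R = Δop k H 1 * x * Δ k H 1
  mul_comul : ∀ h : H, R * Δ k H h = Δop k H h * R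
  /-- `(id ⊗ Δ)(R) = R₁₃ R₁₂`. -/
  id_comul : (Δ k H).lTensor H R =
    (TensorProduct.mk k H H 1).lTensor H R * TensorProduct.assoc k H H H (R ⊗ₜ[k] 1)
  /-- `(Δ ⊗ id)(R) = R₁₃ R₂₃`. -/
  comul_id : TensorProduct.assoc k H H H ((Δ k H).rTensor H R) =
    (TensorProduct.mk k H H 1).lTensor H R * ((1 : H) ⊗ₜ[k] R)
  exists_inv : ∃ R' : H ⊗[k] H, (∃ x : H ⊗[k] H, R' = Δ k H 1 * x * Δop k H 1) ∧
    R * R' = Δop k H 1 ∧ R' * R = Δ k H 1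

end WeakHopf

/-! ## The category `C` of finite-dimensional left `H`-modules -/

section Modules

variable (k : Type u) (H : Type v) [Field k] [Ring H] [Algebra k H]

/-- The action of `H ⊗ H` on `M ⊗ N`, `(g ⊗ h) • (m ⊗ n) = gm ⊗ hn`. -/
def act₂ (M : Type w) (N : Type w') [AddCommGroup M] [Module k M] [Module H M]
    [IsScalarTower k H M] [AddCommGroup N] [Module k N] [Module H N] [IsScalarTower k H N] :
    H ⊗[k] H →ₐ[k] Module.End k (M ⊗[k] N) :=
  (Module.endTensorEndAlgHom (R := k) (S := k) (A := k)).comp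
    (Algebra.TensorProduct.map (Algebra.lsmul k k M) (Algebra.lsmul k k N))

/-- The underlying space `M ⊗_t N = Δ(1)(M ⊗ N)` of the tensor product in `C`, a subspace of
`M ⊗ N`. The element `h` of `H` acts on it as `Δ(h)`. -/
def tensorT [WeakHopfAlgebra k H] (M : Type w) (N : Type w') [AddCommGroup M] [Module k M]
    [Module H M] [IsScalarTower k H M] [AddCommGroup N] [Module k N] [Module H N]
    [IsScalarTower k H N] : Submodule k (M ⊗[k] N) :=
  LinearMap.range (act₂ k H M N (Δ k H 1))

/-- A finite-dimensional left `H`-module, that is, an object of `C`. -/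
structure HMod where
  carrier : Type w
  [addCommGroup : AddCommGroup carrier]
  [module : Module k carrier]
  [hmodule : Module H carrier]
  [isScalarTower : IsScalarTower k H carrier]
  [finite : Module.Finite k carrier]

instance : CoeSort (HMod.{u, v, w} k H) (Type w) := ⟨HMod.carrier⟩

attribute [instance] HMod.addCommGroup HMod.module HMod.hmodule HMod.isScalarTower HMod.finite

end Modules

/-! ## Coalgebras in `C` and their comodules -/

section Coalgebras

variable {k : Type u} {H : Type v} [Field k] [Ring H] [Algebra k H] [WeakHopfAlgebra k H]

/-- `(D, δ, e)` is a coalgebra in `C`: `δ : D → D ⊗_t D` and `e : D → H_t` are morphisms of `C`,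
where `H` acts on the unit object `H_t` by `h · z = ε_t(hz)`, and they are coassociative and
counital with respect to the unit isomorphisms `l(z ⊗ x) = zx` and `r(x ⊗ z) = S(z)x` of `C`. -/
structure IsCoalgebra (D : HMod.{u, v, w} k H) (δ : D →ₗ[k] D ⊗[k] D) (e : D →ₗ[k] H) :
    Prop where
  comul_mem : ∀ d : D, δ d ∈ tensorT k H D D
  comul_smul : ∀ (h : H) (d : D), δ (h • d) = act₂ k H D D (Δ k H h) (δ d)
  counit_mem : ∀ d : D, e d ∈ LinearMap.range (epsT k H)
  counit_smul : ∀ (h : H) (d : D), e (h • d) = epsT k H (h * e d)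
  coassoc : ∀ d : D, TensorProduct.assoc k D D D (δ.rTensor D (δ d)) = δ.lTensor D (δ d)
  counit_left : ∀ d : D,
    TensorProduct.lift (Algebra.lsmul k k D).toLinearMap (e.rTensor D (δ d)) = d
  counit_right : ∀ d : D,
    TensorProduct.lift ((Algebra.lsmul k k D).toLinearMap ∘ₗ S k H).flip (e.lTensor D (δ d)) = d

variable (k H) in
/-- A coalgebra in `C`. -/
structure CoalgebraIn where
  obj : HMod.{u, v, w} k H
  comul : obj →ₗ[k] obj ⊗[k] obj
  counit : obj →ₗ[k] H
  isCoalgebra : IsCoalgebra obj comul counit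

/-- `ρ` is a left `D`-coaction on `M` in `C`: a morphism `ρ : M → D ⊗_t M` of `C` which is
coassociative and counital. -/
structure IsComodule (D : CoalgebraIn.{u, v, w} k H) (M : HMod.{u, v, w'} k H)
    (ρ : M →ₗ[k] D.obj ⊗[k] M) : Prop where
  coact_mem : ∀ m : M, ρ m ∈ tensorT k H D.obj M
  coact_smul : ∀ (h : H) (m : M), ρ (h • m) = act₂ k H D.obj M (Δ k H h) (ρ m)
  coassoc : ∀ m : M,
    TensorProduct.assoc k D.obj D.obj M (D.comul.rTensor M (ρ m)) = ρ.lTensor D.obj (ρ m)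
  counit : ∀ m : M,
    TensorProduct.lift (Algebra.lsmul k k M).toLinearMap (D.counit.rTensor M (ρ m)) = m

/-- A left `D`-comodule in `C`. -/
structure Comodule (D : CoalgebraIn.{u, v, w} k H) where
  obj : HMod.{u, v, w'} k H
  coact : obj →ₗ[k] D.obj ⊗[k] obj
  isComodule : IsComodule D obj coact

/-- A morphism of left `D`-comodules in `C`: an `H`-linear and `D`-colinear map. -/
@[ext]
structure Comodule.Hom {D : CoalgebraIn.{u, v, w} k H} (M N : Comodule.{u, v, w, w'} D) where
  toLinearMap : M.obj →ₗ[H] N.obj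
  colinear : ∀ m : M.obj, N.coact (toLinearMap m) =
    (toLinearMap.restrictScalars k).lTensor D.obj (M.coact m)

/-- The category `D-Comod_C`. -/
instance (D : CoalgebraIn.{u, v, w} k H) : Category (Comodule.{u, v, w, w'} D) where
  Hom := Comodule.Hom
  id M := ⟨LinearMap.id, fun m => by
    have h : (LinearMap.id : M.obj →ₗ[H] M.obj).restrictScalars k = LinearMap.id := rfl
    rw [h, LinearMap.lTensor_id]; rfl⟩
  comp {M N P} f g := ⟨g.toLinearMap ∘ₗ f.toLinearMap, fun m => by
    have h : (g.toLinearMap ∘ₗ f.toLinearMap).restrictScalars k =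
      g.toLinearMap.restrictScalars k ∘ₗ f.toLinearMap.restrictScalars k := rfl
    rw [h, LinearMap.lTensor_comp, LinearMap.comp_apply, LinearMap.comp_apply, g.colinear,
      f.colinear]⟩

end Coalgebras

/-! ## Yetter-Drinfeld modules -/

section YetterDrinfeld

variable {k : Type u} {H : Type v} [Field k] [Ring H] [Algebra k H]

/-- For a linear map `ρ : M → H ⊗ M` and `m` in `M`, the linear map
`g ⊗ h ↦ (gm)₍₋₁₎ h ⊗ (gm)₍₀₎`. -/
def ydMap {M : HMod.{u, v, w} k H} (ρ : M →ₗ[k] H ⊗[k] M) (m : M) :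
    H ⊗[k] H →ₗ[k] H ⊗[k] M :=
  TensorProduct.lift ((LinearMap.rTensorHom M ∘ₗ (LinearMap.mul k H).flip).flip ∘ₗ ρ ∘ₗ
    (Algebra.lsmul k k M).toLinearMap.flip m)

theorem ydMap_tmul {M : HMod.{u, v, w} k H} (ρ : M →ₗ[k] H ⊗[k] M) (m : M) (g h : H) :
    ydMap ρ m (g ⊗ₜ h) = (LinearMap.mulRight k h).rTensor M (ρ (g • m)) := rfl

variable [WeakHopfAlgebra k H]

/-- `ρ` makes the left `H`-module `M` a left-left Yetter-Drinfeld module: it is a coassociative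
and counital coaction of the coalgebra `H`, it takes values in `H ⊗_t M`, and
`h₍₁₎ m₍₋₁₎ ⊗ h₍₂₎ m₍₀₎ = (h₍₁₎ m)₍₋₁₎ h₍₂₎ ⊗ (h₍₁₎ m)₍₀₎`. -/
structure IsYetterDrinfeld (M : HMod.{u, v, w} k H) (ρ : M →ₗ[k] H ⊗[k] M) : Prop where
  coassoc : ∀ m : M, TensorProduct.assoc k H H M ((Δ k H).rTensor M (ρ m)) = ρ.lTensor H (ρ m)
  counit : ∀ m : M, TensorProduct.lid k M ((ε k H).rTensor M (ρ m)) = m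
  coact_mem : ∀ m : M, ρ m ∈ tensorT k H H M
  compat : ∀ (h : H) (m : M), act₂ k H H M (Δ k H h) (ρ m) = ydMap ρ m (Δ k H h)

variable (k H) in
/-- A (finite-dimensional) left-left Yetter-Drinfeld module over `H`. -/
structure YetterDrinfeld where
  obj : HMod.{u, v, w} k H
  coact : obj →ₗ[k] H ⊗[k] obj
  isYetterDrinfeld : IsYetterDrinfeld obj coact

/-- A morphism of Yetter-Drinfeld modules: an `H`-linear and `H`-colinear map. -/
@[ext]
structure YetterDrinfeld.Hom (M N : YetterDrinfeld.{u, v, w} k H) where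
  toLinearMap : M.obj →ₗ[H] N.obj
  colinear : ∀ m : M.obj, N.coact (toLinearMap m) =
    (toLinearMap.restrictScalars k).lTensor H (M.coact m)

/-- The category of left-left Yetter-Drinfeld modules over `H`. -/
instance : Category (YetterDrinfeld.{u, v, w} k H) where
  Hom := YetterDrinfeld.Hom
  id M := ⟨LinearMap.id, fun m => by
    have h : (LinearMap.id : M.obj →ₗ[H] M.obj).restrictScalars k = LinearMap.id := rfl
    rw [h, LinearMap.lTensor_id]; rfl⟩
  comp {M N P} f g := ⟨g.toLinearMap ∘ₗ f.toLinearMap, fun m => by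
    have h : (g.toLinearMap ∘ₗ f.toLinearMap).restrictScalars k =
      g.toLinearMap.restrictScalars k ∘ₗ f.toLinearMap.restrictScalars k := rfl
    rw [h, LinearMap.lTensor_comp, LinearMap.comp_apply, LinearMap.comp_apply, g.colinear,
      f.colinear]⟩

end YetterDrinfeld

/-! ## Twisting a coaction by an element of `H ⊗ H` -/

section Twist

variable {k : Type u} {H : Type v} [Field k] [Ring H] [Algebra k H]

/-- For an action `a` of `H` on `M` and `T = T¹ ⊗ T²` in `H ⊗ H`, the linear map
`x ⊗ m ↦ x T² ⊗ T¹ m` on `H ⊗ M`. -/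
def twist {M : Type w} [AddCommGroup M] [Module k M] (a : H →ₗ[k] Module.End k M) :
    H ⊗[k] H →ₗ[k] Module.End k (H ⊗[k] M) :=
  TensorProduct.lift
    ((TensorProduct.mapBilinear (RingHom.id k) H M H M).flip.compl₁₂ a (LinearMap.mul k H).flip)

theorem twist_tmul {M : Type w} [AddCommGroup M] [Module k M] (a : H →ₗ[k] Module.End k M)
    (g h x : H) (m : M) : twist a (g ⊗ₜ h) (x ⊗ₜ m) = (x * h) ⊗ₜ a g m := rfl

theorem lTensor_twist (T : H ⊗[k] H) {M N : HMod.{u, v, w} k H} (f : M →ₗ[H] N)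
    (x : H ⊗[k] M) :
    (f.restrictScalars k).lTensor H (twist (Algebra.lsmul k k M).toLinearMap T x) =
      twist (Algebra.lsmul k k N).toLinearMap T ((f.restrictScalars k).lTensor H x) := by
  induction T with
  | zero => simp
  | add T U hT hU => simp only [map_add, LinearMap.add_apply, hT, hU]
  | tmul g h =>
    induction x with
    | zero => simp
    | add x y hx hy => simp only [map_add, hx, hy]
    | tmul x m =>
      simp only [twist_tmul, LinearMap.lTensor_tmul]
      congr 1
      exact f.map_smul g m

/-- A linear map with values in the range of an injective map `i`, viewed as a map to the source
of `i`. -/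
def liftThrough {V W M : Type*} [AddCommGroup V] [Module k V] [AddCommGroup W] [Module k W]
    [AddCommGroup M] [Module k M] (i : V →ₗ[k] W) (hi : Function.Injective i) (f : M →ₗ[k] W)
    (hf : ∀ m, f m ∈ LinearMap.range i) : M →ₗ[k] V :=
  (LinearEquiv.ofInjective i hi).symm.toLinearMap ∘ₗ f.codRestrict (LinearMap.range i) hf

theorem apply_liftThrough {V W M : Type*} [AddCommGroup V] [Module k V] [AddCommGroup W]
    [Module k W] [AddCommGroup M] [Module k M] (i : V →ₗ[k] W) (hi : Function.Injective i)
    (f : M →ₗ[k] W) (hf : ∀ m, f m ∈ LinearMap.range i) (m : M) :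
    i (liftThrough i hi f hf m) = f m := by
  have := LinearEquiv.ofInjective_apply (f := i) (h := hi) (liftThrough i hi f hf m)
  rw [← this]
  simp [liftThrough]

end Twist

/-! ## The coalgebra `B = C_H(H_s)` in `C` -/

section BraidedGroup

variable (k : Type u) (H : Type v) [Field k] [Ring H] [Algebra k H] [WeakHopfAlgebra k H]

/-- The left adjoint action `h · x = h₍₁₎ x S(h₍₂₎)`. -/
def ad : H →ₗ[k] Module.End k H :=
  TensorProduct.lift ((LinearMap.mul k (Module.End k H)).compl₁₂ (LinearMap.mul k H)
    ((LinearMap.mul k H).flip ∘ₗ S k H)) ∘ₗ Δ k H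

/-- The centralizer `B = C_H(H_s)` of `H_s = ε_s(H)` in `H`. -/
def B : Submodule k H :=
  Subalgebra.toSubmodule (Subalgebra.centralizer k (LinearMap.range (epsS k H) : Set H))

/-- The inclusion of `B` in `H`. -/
abbrev ιB : B k H →ₗ[k] H := (B k H).subtype

/-- The adjoint action of `H` on itself restricts to a left `H`-module structure on `B`. -/
structure AdActsOnB : Prop where
  mem : ∀ (h : H), ∀ b ∈ B k H, ad k H h b ∈ B k H
  one : ∀ b ∈ B k H, ad k H 1 b = b
  mul : ∀ (g h : H), ∀ b ∈ B k H, ad k H (g * h) b = ad k H g (ad k H h b)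

variable {k H}

/-- The left `H`-module structure on `B` given by the adjoint action. -/
abbrev AdActsOnB.module (hA : AdActsOnB k H) : Module H (B k H) where
  smul h b := ⟨ad k H h b, hA.mem h b b.2⟩
  one_smul b := Subtype.ext (hA.one b b.2)
  mul_smul g h b := Subtype.ext (hA.mul g h b b.2)
  smul_zero h := Subtype.ext (map_zero (ad k H h))
  smul_add h b c := Subtype.ext (map_add (ad k H h) (b : H) (c : H))
  add_smul g h b := Subtype.ext (by
    change ad k H (g + h) (b : H) = ad k H g (b : H) + ad k H h (b : H)
    rw [map_add, LinearMap.add_apply])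
  zero_smul b := Subtype.ext (by
    change ad k H 0 (b : H) = 0
    rw [map_zero, LinearMap.zero_apply])

/-- `B` with the adjoint action, as an object of `C`. -/
def objB [Module.Finite k H] (hA : AdActsOnB k H) : HMod.{u, v, v} k H :=
  letI := hA.module
  { carrier := B k H
    isScalarTower := ⟨fun c h b => Subtype.ext (by
      change ad k H (c • h) (b : H) = c • ad k H h (b : H)
      rw [map_smul, LinearMap.smul_apply])⟩
    finite := inferInstance }

theorem map_ιB_injective :
    Function.Injective (TensorProduct.map (ιB k H) (ιB k H)) := by
  rw [← LinearMap.lTensor_comp_rTensor]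
  exact (Module.Flat.lTensor_preserves_injective_linearMap _ (Submodule.injective_subtype _)).comp
    (Module.Flat.rTensor_preserves_injective_linearMap _ (Submodule.injective_subtype _))

theorem rTensor_ιB_injective (M : Type w) [AddCommGroup M] [Module k M] :
    Function.Injective ((ιB k H).rTensor M) :=
  Module.Flat.rTensor_preserves_injective_linearMap _ (Submodule.injective_subtype _)

/-- The linear map `h ↦ h₍₁₎ S(R²) ⊗ R¹ · h₍₂₎`, with the adjoint action in the second factor. -/
def comulR (R : H ⊗[k] H) : H →ₗ[k] H ⊗[k] H :=
  twist (ad k H) ((S k H).lTensor H R) ∘ₗ Δ k H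

variable [Module.Finite k H]

/-- The comultiplication `b ↦ b₍₁₎ S(R²) ⊗ R¹ · b₍₂₎` of `B`. -/
def comulB (R : H ⊗[k] H) (hA : AdActsOnB k H)
    (hR : ∀ b : B k H, comulR R b ∈ LinearMap.range (TensorProduct.map (ιB k H) (ιB k H))) :
    objB hA →ₗ[k] objB hA ⊗[k] objB hA :=
  liftThrough (TensorProduct.map (ιB k H) (ιB k H)) map_ιB_injective (comulR R ∘ₗ ιB k H) hR

/-- The counit `b ↦ ε_t(b)` of `B`. -/
def counitB (hA : AdActsOnB k H) : objB hA →ₗ[k] H := epsT k H ∘ₗ ιB k H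

/-- `B = C_H(H_s)`, with the adjoint action, the comultiplication `b ↦ b₍₁₎ S(R²) ⊗ R¹ · b₍₂₎` and
the counit `ε_t`, is a well defined coalgebra in `C`. -/
structure BIsCoalgebra (R : H ⊗[k] H) : Prop where
  adActs : AdActsOnB k H
  comul_mem : ∀ b : B k H,
    comulR R b ∈ LinearMap.range (TensorProduct.map (ιB k H) (ιB k H))
  isCoalgebra : IsCoalgebra (objB adActs) (comulB R adActs comul_mem) (counitB adActs)

/-- The coalgebra `B` in `C`. -/
def coalgB {R : H ⊗[k] H} (hB : BIsCoalgebra R) : CoalgebraIn.{u, v, v} k H where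
  obj := objB hB.adActs
  comul := comulB R hB.adActs hB.comul_mem
  counit := counitB hB.adActs
  isCoalgebra := hB.isCoalgebra

end BraidedGroup

/-! ## The functors `F` and `G` -/

section Functors

variable {k : Type u} {H : Type v} [Field k] [Ring H] [Algebra k H] [WeakHopfAlgebra k H]
  [Module.Finite k H] {R : H ⊗[k] H}

/-- For a left `B`-comodule `M` in `C`, the map `m ↦ m⁽⁻¹⁾ R² ⊗ R¹ m⁽⁰⁾` from `M` to `H ⊗ M`. -/
def coactF (hB : BIsCoalgebra R) (M : Comodule.{u, v, v, w} (coalgB hB)) :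
    M.obj →ₗ[k] H ⊗[k] M.obj :=
  twist (Algebra.lsmul k k M.obj).toLinearMap R ∘ₗ (ιB k H).rTensor M.obj ∘ₗ M.coact

/-- The functor `F : B-Comod_C → YD`, `(M, ρ_R) ↦ (M, ρ)` with `ρ(m) = m⁽⁻¹⁾ R² ⊗ R¹ m⁽⁰⁾`, which
is the identity on underlying maps. -/
def functorF (hB : BIsCoalgebra R)
    (hF : ∀ M : Comodule.{u, v, v, w} (coalgB hB), IsYetterDrinfeld M.obj (coactF hB M)) :
    Comodule.{u, v, v, w} (coalgB hB) ⥤ YetterDrinfeld.{u, v, w} k H where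
  obj M := ⟨M.obj, coactF hB M, hF M⟩
  map {M N} f := ⟨f.toLinearMap, fun m => by
    change twist _ R ((ιB k H).rTensor N.obj (N.coact (f.toLinearMap m))) =
      (f.toLinearMap.restrictScalars k).lTensor H
        (twist _ R ((ιB k H).rTensor M.obj (M.coact m)))
    rw [lTensor_twist, f.colinear]
    congr 1
    exact LinearMap.congr_fun ((LinearMap.rTensor_comp_lTensor _ _ _).trans
      (LinearMap.lTensor_comp_rTensor _ _ _).symm) (M.coact m)⟩

/-- For a Yetter-Drinfeld module `M`, the map `m ↦ m₍₋₁₎ S(R²) ⊗ R¹ m₍₀₎` from `M` to `H ⊗ M`. -/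
def coactG (R : H ⊗[k] H) (M : YetterDrinfeld.{u, v, w} k H) : M.obj →ₗ[k] H ⊗[k] M.obj :=
  twist (Algebra.lsmul k k M.obj).toLinearMap ((S k H).lTensor H R) ∘ₗ M.coact

/-- The map `m ↦ m₍₋₁₎ S(R²) ⊗ R¹ m₍₀₎`, viewed as a map from `M` to `B ⊗ M`. -/
def coactGB (hB : BIsCoalgebra R) (M : YetterDrinfeld.{u, v, w} k H)
    (hM : ∀ m : M.obj, coactG R M m ∈ LinearMap.range ((ιB k H).rTensor M.obj)) :
    M.obj →ₗ[k] (coalgB hB).obj ⊗[k] M.obj :=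
  liftThrough (V := B k H ⊗[k] M.obj) (W := H ⊗[k] M.obj) ((ιB k H).rTensor M.obj)
    (rTensor_ιB_injective M.obj) (coactG R M) hM

theorem rTensor_coactGB (hB : BIsCoalgebra R) (M : YetterDrinfeld.{u, v, w} k H)
    (hM : ∀ m : M.obj, coactG R M m ∈ LinearMap.range ((ιB k H).rTensor M.obj)) (m : M.obj) :
    (ιB k H).rTensor M.obj (coactGB hB M hM m) = coactG R M m :=
  apply_liftThrough (V := B k H ⊗[k] M.obj) (W := H ⊗[k] M.obj) ((ιB k H).rTensor M.obj)
    (rTensor_ιB_injective M.obj) (coactG R M) hM m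

/-- The map `m ↦ m₍₋₁₎ S(R²) ⊗ R¹ m₍₀₎` takes values in `B ⊗ M` and is a left `B`-coaction
in `C`. -/
structure CoactGWellDefined (hB : BIsCoalgebra R) (M : YetterDrinfeld.{u, v, w} k H) : Prop where
  mem : ∀ m : M.obj, coactG R M m ∈ LinearMap.range ((ιB k H).rTensor M.obj)
  isComodule : IsComodule (coalgB hB) M.obj (coactGB hB M mem)

/-- The functor `G : YD → B-Comod_C`, `(M, ρ) ↦ (M, ρ_R)` with
`ρ_R(m) = m₍₋₁₎ S(R²) ⊗ R¹ m₍₀₎`, which is the identity on underlying maps. -/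
def functorG (hB : BIsCoalgebra R)
    (hG : ∀ M : YetterDrinfeld.{u, v, w} k H, CoactGWellDefined hB M) :
    YetterDrinfeld.{u, v, w} k H ⥤ Comodule.{u, v, v, w} (coalgB hB) where
  obj M := ⟨M.obj, coactGB hB M (hG M).mem, (hG M).isComodule⟩
  map {M N} f := ⟨f.toLinearMap, fun m => by
    apply rTensor_ιB_injective (k := k) (H := H) N.obj
    refine (rTensor_coactGB hB N (hG N).mem (f.toLinearMap m)).trans ?_
    have h : (ιB k H).rTensor N.obj ((f.toLinearMap.restrictScalars k).lTensor (B k H)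
        (coactGB hB M (hG M).mem m)) =
        (f.toLinearMap.restrictScalars k).lTensor H (coactG R M m) := by
      rw [← rTensor_coactGB hB M (hG M).mem m]
      exact LinearMap.congr_fun ((LinearMap.rTensor_comp_lTensor _ _ _).trans
        (LinearMap.lTensor_comp_rTensor _ _ _).symm) (coactGB hB M (hG M).mem m)
    refine Eq.trans ?_ h.symm
    change twist _ _ (N.coact (f.toLinearMap m)) =
      (f.toLinearMap.restrictScalars k).lTensor H (twist _ _ (M.coact m))
    rw [lTensor_twist, f.colinear]⟩

end Functors

end

end WHA

/-!
Write `Δ(1) = 1₍₁₎ ⊗ 1₍₂₎`, which lies in `H_s ⊗ H_t`. For an object `M` of `C`, an element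
`T = T¹ ⊗ T²` of `H ⊗ H` gives two operators on `H ⊗ M`, `braid T : x ⊗ m ↦ x S(T²) ⊗ T¹ m` and
`unbraid T : x ⊗ m ↦ x T² ⊗ T¹ m`. The functor `G` applies `braid R` to a coaction, and `F` applies
`unbraid R`. Of the two, `braid` is multiplicative in `T`, that is, an action of `H ⊗ H`.

*The functors are mutually inverse.* The hexagon identity for `(id ⊗ Δ)R` computes the two
composites: they are `unbraid (S(1₍₂₎) ⊗ 1₍₁₎)` and `unbraid (S(1₍₁₎) ⊗ 1₍₂₎)`
(`IsRMatrix.sum_tmul_antipode_mul`, `IsRMatrix.sum_tmul_mul_antipode`). The first fixes every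
Yetter-Drinfeld coaction because `m₍₋₁₎ ⊗ y m₍₀₎ = m₍₋₁₎ y ⊗ m₍₀₎` for `y` in `H_s`. In the
regular case `S(1₍₁₎) ⊗ 1₍₂₎` is symmetric, so the second is `braid (Δop(1))`,
which is the action of `Δ(1)` on `B ⊗ M` and fixes every coaction of `B` in `C`.

*`G` is well defined.* Yetter-Drinfeld coactions satisfy `ρ(hm) = h₍₁₎ m₍₋₁₎ S(h₍₃₎) ⊗ h₍₂₎ m₍₀₎`
(`IsYetterDrinfeld.coact_smul`). Since `R Δ(h) = Δop(h) R`, applying `braid R` interchanges `h₍₂₎`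
and `h₍₃₎` in this formula, which makes it `H`-linearity with respect to the adjoint action on `B`.
The values lie in `B ⊗ M` because `R` intertwines left multiplication by `H_s` with right
multiplication by `H_s`. Coassociativity is an identity in `H ⊗ H ⊗ H ⊗ H` that follows from the
two hexagon identities (`IsRMatrix.sum_coassoc`).

*`B` is a coalgebra.* The comultiplication of `H` restricts to a map `B → H ⊗ B` which, with the
adjoint action, makes `B` a Yetter-Drinfeld module (`IsRegular.isYetterDrinfeld_objB`). The
comultiplication of `B` is what `G` makes of it, so that coassociativity, `H`-linearity and left
counitality are special cases of the results on `G`; only right counitality needs an argument of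
its own (`counit_right_comulR`).

*`F` is well defined.* The compatibility condition reduces to
`S(h₍₁₎) R² h₍₃₎ ⊗ R¹ h₍₂₎ = R² ⊗ h R¹` (`IsRMatrix.lift_lTensor_comul`). Coassociativity follows
from the two hexagon identities, because `unbraid R` recovers the comultiplication of `H` from that
of `B` (`IsRMatrix.unbraid_coassoc`).
-/

namespace WHA

/-! ### Consequences of the weak bialgebra axioms -/

section Basics

/-- Every tensor is a finite sum of pure tensors. Stating identities for such presentations is how
Sweedler notation is rendered below. -/
theorem exists_sum_tmul {k : Type*} {V W : Type*} [CommRing k] [AddCommGroup V] [Module k V]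
    [AddCommGroup W] [Module k W] (t : V ⊗[k] W) :
    ∃ (n : ℕ) (a : Fin n → V) (b : Fin n → W), t = ∑ i, a i ⊗ₜ[k] b i := by
  induction t with
  | zero => exact ⟨0, Fin.elim0, Fin.elim0, by simp⟩
  | tmul v w => exact ⟨1, fun _ => v, fun _ => w, by simp⟩
  | add s t hs ht =>
    obtain ⟨n, a, b, rfl⟩ := hs
    obtain ⟨m, c, d, rfl⟩ := ht
    exact ⟨n + m, Fin.append a c, Fin.append b d, by simp [Fin.sum_univ_add]⟩

variable {k : Type u} {H : Type v} [Field k] [Ring H] [Algebra k H] [WeakHopfAlgebra k H]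

theorem comul_mul (x y : H) : Δ k H (x * y) = Δ k H x * Δ k H y :=
  WeakHopfAlgebra.comul_mul x y

theorem comul_mul_one (x : H) : Δ k H x * Δ k H 1 = Δ k H x := by
  rw [← comul_mul, mul_one]

theorem comul_one_mul (x : H) : Δ k H 1 * Δ k H x = Δ k H x := by
  rw [← comul_mul, one_mul]

variable {n : ℕ} {a b : Fin n → H}

theorem epsT_eq_sum (h : Δ k H 1 = ∑ i, a i ⊗ₜ[k] b i) (x : H) :
    epsT k H x = ∑ i, ε k H (a i * x) • b i := by
  change TensorProduct.lid k H ((ε k H ∘ₗ LinearMap.mulRight k x).rTensor H (Δ k H 1)) = _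
  simp [h]

theorem epsS_eq_sum (h : Δ k H 1 = ∑ i, a i ⊗ₜ[k] b i) (x : H) :
    epsS k H x = ∑ i, ε k H (x * b i) • a i := by
  change TensorProduct.rid k H ((ε k H ∘ₗ LinearMap.mulLeft k x).lTensor H (Δ k H 1)) = _
  simp [h]

theorem sum_tmul_comul_left (h : Δ k H 1 = ∑ i, a i ⊗ₜ[k] b i) :
    ∑ i, a i ⊗ₜ[k] Δ k H (b i) = ∑ i, a i ⊗ₜ[k] ((b i ⊗ₜ[k] (1 : H)) * Δ k H 1) := by
  have := WeakHopfAlgebra.comul_one_left (k := k) (H := H)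
  rw [h] at this
  rw [TensorProduct.tmul_sum, TensorProduct.sum_tmul, map_sum, map_sum,
    Finset.sum_mul_sum] at this
  simpa [TensorProduct.tmul_sum, Finset.mul_sum, h] using this

theorem sum_tmul_comul_right (h : Δ k H 1 = ∑ i, a i ⊗ₜ[k] b i) :
    ∑ i, a i ⊗ₜ[k] Δ k H (b i) = ∑ i, a i ⊗ₜ[k] (Δ k H 1 * (b i ⊗ₜ[k] (1 : H))) := by
  have := WeakHopfAlgebra.comul_one_right (k := k) (H := H)
  rw [h, TensorProduct.tmul_sum, TensorProduct.sum_tmul, map_sum, map_sum,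
    Finset.sum_mul_sum, Finset.sum_comm] at this
  simpa [TensorProduct.tmul_sum, Finset.sum_mul, h] using this

theorem sum_comul_tmul_eq (h : Δ k H 1 = ∑ i, a i ⊗ₜ[k] b i) :
    TensorProduct.assoc k H H H (∑ i, Δ k H (a i) ⊗ₜ[k] b i) = ∑ i, a i ⊗ₜ[k] Δ k H (b i) := by
  have := Coalgebra.coassoc_apply (R := k) (1 : H)
  change TensorProduct.assoc k H H H ((Δ k H).rTensor H (Δ k H 1)) =
    (Δ k H).lTensor H (Δ k H 1) at this
  rw [h] at this
  simpa using this

theorem sum_comul_tmul_left (h : Δ k H 1 = ∑ i, a i ⊗ₜ[k] b i) :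
    ∑ i, Δ k H (a i) ⊗ₜ[k] b i = ∑ i, (((1 : H) ⊗ₜ[k] a i) * Δ k H 1) ⊗ₜ[k] b i := by
  apply (TensorProduct.assoc k H H H).injective
  rw [sum_comul_tmul_eq h, sum_tmul_comul_right h]
  simp only [h, Finset.sum_mul, Finset.mul_sum, Algebra.TensorProduct.tmul_mul_tmul,
    TensorProduct.sum_tmul, TensorProduct.tmul_sum, map_sum, TensorProduct.assoc_tmul, one_mul,
    mul_one]
  exact Finset.sum_comm

theorem sum_comul_tmul_right (h : Δ k H 1 = ∑ i, a i ⊗ₜ[k] b i) :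
    ∑ i, Δ k H (a i) ⊗ₜ[k] b i = ∑ i, (Δ k H 1 * ((1 : H) ⊗ₜ[k] a i)) ⊗ₜ[k] b i := by
  apply (TensorProduct.assoc k H H H).injective
  rw [sum_comul_tmul_eq h, sum_tmul_comul_left h]
  simp only [h, Finset.sum_mul, Finset.mul_sum, Algebra.TensorProduct.tmul_mul_tmul,
    TensorProduct.sum_tmul, TensorProduct.tmul_sum, map_sum, TensorProduct.assoc_tmul, one_mul,
    mul_one]
  exact Finset.sum_comm

theorem lid_counit_comul (x : H) :
    TensorProduct.lid k H ((ε k H).rTensor H (Δ k H x)) = x := by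
  rw [Coalgebra.rTensor_counit_comul]; simp

theorem rid_counit_comul (x : H) :
    TensorProduct.rid k H ((ε k H).lTensor H (Δ k H x)) = x := by
  rw [Coalgebra.lTensor_counit_comul]; simp

/-- `1₍₁₎ ⊗ ε_t(1₍₂₎) = Δ(1)`; together with the next lemma, `Δ(1)` lies in `H_s ⊗ H_t`. -/
theorem lTensor_epsT_comul_one : (epsT k H).lTensor H (Δ k H 1) = Δ k H 1 := by
  obtain ⟨n, a, b, h⟩ := exists_sum_tmul (Δ k H 1)
  have h1 := congrArg (((TensorProduct.lid k H).toLinearMap ∘ₗ (ε k H).rTensor H).lTensor H)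
    (sum_tmul_comul_right h)
  simp only [map_sum, LinearMap.lTensor_tmul, LinearMap.comp_apply, LinearEquiv.coe_coe,
    lid_counit_comul] at h1
  rw [← h] at h1
  conv_rhs => rw [h1]
  conv_lhs => rw [h]
  simp [epsT_eq_sum h, h, Finset.sum_mul]

theorem rTensor_epsS_comul_one : (epsS k H).rTensor H (Δ k H 1) = Δ k H 1 := by
  obtain ⟨n, a, b, h⟩ := exists_sum_tmul (Δ k H 1)
  have h1 := congrArg (((TensorProduct.rid k H).toLinearMap ∘ₗ (ε k H).lTensor H).rTensor H)
    (sum_comul_tmul_left h)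
  simp only [map_sum, LinearMap.rTensor_tmul, LinearMap.comp_apply, LinearEquiv.coe_coe,
    rid_counit_comul] at h1
  rw [← h] at h1
  conv_rhs => rw [h1]
  conv_lhs => rw [h]
  simp [epsS_eq_sum h, h, Finset.mul_sum]

/-- Apply `ε(· x)` to the first leg of the axiom for `Δ²(1)`. -/
theorem comul_epsT_left (x : H) : Δ k H (epsT k H x) = (epsT k H x ⊗ₜ[k] 1) * Δ k H 1 := by
  obtain ⟨n, a, b, h⟩ := exists_sum_tmul (Δ k H 1)
  have h1 := congrArg (TensorProduct.lid k _ ∘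
    (ε k H ∘ₗ LinearMap.mulRight k x).rTensor (H ⊗[k] H)) (sum_tmul_comul_left h)
  simp only [Function.comp, map_sum, LinearMap.rTensor_tmul, TensorProduct.lid_tmul] at h1
  rw [epsT_eq_sum h, map_sum, TensorProduct.sum_tmul, Finset.sum_mul]
  simpa [← TensorProduct.smul_tmul', smul_mul_assoc] using h1

theorem comul_epsT_right (x : H) : Δ k H (epsT k H x) = Δ k H 1 * (epsT k H x ⊗ₜ[k] 1) := by
  obtain ⟨n, a, b, h⟩ := exists_sum_tmul (Δ k H 1)
  have h1 := congrArg (TensorProduct.lid k _ ∘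
    (ε k H ∘ₗ LinearMap.mulRight k x).rTensor (H ⊗[k] H)) (sum_tmul_comul_right h)
  simp only [Function.comp, map_sum, LinearMap.rTensor_tmul, TensorProduct.lid_tmul] at h1
  rw [epsT_eq_sum h, map_sum, TensorProduct.sum_tmul, Finset.mul_sum]
  simpa [← TensorProduct.smul_tmul', mul_smul_comm] using h1

theorem comul_epsS_left (x : H) : Δ k H (epsS k H x) = (1 ⊗ₜ[k] epsS k H x) * Δ k H 1 := by
  obtain ⟨n, a, b, h⟩ := exists_sum_tmul (Δ k H 1)
  have h1 := congrArg (TensorProduct.rid k _ ∘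
    (ε k H ∘ₗ LinearMap.mulLeft k x).lTensor (H ⊗[k] H)) (sum_comul_tmul_left h)
  simp only [Function.comp, map_sum, LinearMap.lTensor_tmul, TensorProduct.rid_tmul] at h1
  rw [epsS_eq_sum h, map_sum, TensorProduct.tmul_sum, Finset.sum_mul]
  simpa [smul_mul_assoc] using h1

theorem comul_epsS_right (x : H) : Δ k H (epsS k H x) = Δ k H 1 * (1 ⊗ₜ[k] epsS k H x) := by
  obtain ⟨n, a, b, h⟩ := exists_sum_tmul (Δ k H 1)
  have h1 := congrArg (TensorProduct.rid k _ ∘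
    (ε k H ∘ₗ LinearMap.mulLeft k x).lTensor (H ⊗[k] H)) (sum_comul_tmul_right h)
  simp only [Function.comp, map_sum, LinearMap.lTensor_tmul, TensorProduct.rid_tmul] at h1
  rw [epsS_eq_sum h, map_sum, TensorProduct.tmul_sum, Finset.mul_sum]
  simpa [mul_smul_comm] using h1

/-- `H_t` and `H_s` commute, since the two expressions for `Δ²(1)` in the axioms agree. -/
theorem epsT_mul_epsS (x y : H) : epsT k H x * epsS k H y = epsS k H y * epsT k H x := by
  obtain ⟨n, a, b, h⟩ := exists_sum_tmul (Δ k H 1)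
  have h1 := (sum_tmul_comul_left h).symm.trans (sum_tmul_comul_right h)
  have h2 := congrArg (TensorProduct.rid k _ ∘ (ε k H ∘ₗ LinearMap.mulLeft k y).lTensor H ∘
    TensorProduct.lid k _ ∘ (ε k H ∘ₗ LinearMap.mulRight k x).rTensor (H ⊗[k] H)) h1
  simp only [Function.comp, map_sum, LinearMap.rTensor_tmul, TensorProduct.lid_tmul] at h2
  simp only [h, Finset.mul_sum, Finset.sum_mul, map_sum, map_smul,
    Algebra.TensorProduct.tmul_mul_tmul, one_mul, mul_one, LinearMap.lTensor_tmul,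
    TensorProduct.rid_tmul, Finset.smul_sum] at h2
  rw [epsT_eq_sum h, epsS_eq_sum h, Finset.sum_mul_sum, Finset.sum_mul_sum]
  simp only [smul_mul_assoc, mul_smul_comm]
  conv_rhs => rw [Finset.sum_comm]
  refine (Finset.sum_congr rfl fun i _ => Finset.sum_congr rfl fun j _ => smul_comm _ _ _).trans h2

theorem counit_mul_epsT (x y : H) : ε k H (x * epsT k H y) = ε k H (x * y) := by
  obtain ⟨n, a, b, h⟩ := exists_sum_tmul (Δ k H 1)
  have := WeakHopfAlgebra.counit_mul_right (k := k) x 1 y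
  rw [mul_one] at this
  rw [this, epsT_eq_sum h, Δop]
  simp [h, Finset.mul_sum, mul_comm]

theorem counit_epsS_mul (x y : H) : ε k H (epsS k H x * y) = ε k H (x * y) := by
  obtain ⟨n, a, b, h⟩ := exists_sum_tmul (Δ k H 1)
  have := WeakHopfAlgebra.counit_mul_right (k := k) x 1 y
  rw [mul_one] at this
  rw [this, epsS_eq_sum h, Δop]
  simp [h, Finset.sum_mul]

theorem counit_mul_eq_sum (h : Δ k H 1 = ∑ i, a i ⊗ₜ[k] b i) (x y : H) :
    ε k H (x * y) = ∑ i, ε k H (x * a i) * ε k H (b i * y) := by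
  have := WeakHopfAlgebra.counit_mul_left (k := k) x 1 y
  rw [mul_one] at this
  rw [this]
  simp [h]

theorem epsT_mul_epsT (x y : H) : epsT k H (x * epsT k H y) = epsT k H (x * y) := by
  obtain ⟨n, a, b, h⟩ := exists_sum_tmul (Δ k H 1)
  simp only [epsT_eq_sum h (x * _), ← mul_assoc, counit_mul_epsT]

theorem epsS_epsS_mul (x y : H) : epsS k H (epsS k H x * y) = epsS k H (x * y) := by
  obtain ⟨n, a, b, h⟩ := exists_sum_tmul (Δ k H 1)
  simp only [epsS_eq_sum h (_ * y), mul_assoc, counit_epsS_mul]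

theorem epsT_one : epsT k H 1 = 1 := by
  obtain ⟨n, a, b, h⟩ := exists_sum_tmul (Δ k H 1)
  have := lid_counit_comul (k := k) (1 : H)
  rw [h] at this
  simpa [epsT_eq_sum h] using this

theorem epsS_one : epsS k H 1 = 1 := by
  obtain ⟨n, a, b, h⟩ := exists_sum_tmul (Δ k H 1)
  have := rid_counit_comul (k := k) (1 : H)
  rw [h] at this
  simpa [epsS_eq_sum h] using this

/-- `x₍₁₎ ⊗ ε_t(x₍₂₎) = 1₍₁₎ x ⊗ 1₍₂₎`. -/
theorem lTensor_epsT_comul (x : H) :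
    (epsT k H).lTensor H (Δ k H x) = Δ k H 1 * (x ⊗ₜ[k] 1) := by
  obtain ⟨n, a, b, h⟩ := exists_sum_tmul (Δ k H 1)
  obtain ⟨m, p, q, hx⟩ := exists_sum_tmul (Δ k H x)
  have h1 := congrArg (((TensorProduct.rid k H).toLinearMap ∘ₗ (ε k H).lTensor H ∘ₗ
    LinearMap.mulRight k (Δ k H x)).rTensor H) (sum_comul_tmul_left h)
  simp only [map_sum, LinearMap.rTensor_tmul, LinearMap.comp_apply, LinearMap.mulRight_apply,
    ← comul_mul, LinearEquiv.coe_coe, rid_counit_comul, mul_assoc, one_mul] at h1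
  conv_rhs => rw [h, Finset.sum_mul]
  simp only [Algebra.TensorProduct.tmul_mul_tmul, mul_one]
  rw [h1, hx]
  simp only [map_sum, LinearMap.lTensor_tmul, epsT_eq_sum h, Finset.mul_sum,
    Algebra.TensorProduct.tmul_mul_tmul, TensorProduct.tmul_sum, TensorProduct.sum_tmul, one_mul,
    TensorProduct.rid_tmul, TensorProduct.tmul_smul, TensorProduct.smul_tmul']
  exact Finset.sum_comm

/-- `ε_s(x₍₁₎) ⊗ x₍₂₎ = 1₍₁₎ ⊗ x 1₍₂₎`. -/
theorem rTensor_epsS_comul (x : H) :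
    (epsS k H).rTensor H (Δ k H x) = (1 ⊗ₜ[k] x) * Δ k H 1 := by
  obtain ⟨n, a, b, h⟩ := exists_sum_tmul (Δ k H 1)
  obtain ⟨m, p, q, hx⟩ := exists_sum_tmul (Δ k H x)
  have h1 := congrArg (((TensorProduct.lid k H).toLinearMap ∘ₗ (ε k H).rTensor H ∘ₗ
    LinearMap.mulLeft k (Δ k H x)).lTensor H) (sum_tmul_comul_right h)
  simp only [map_sum, LinearMap.lTensor_tmul, LinearMap.comp_apply, LinearMap.mulLeft_apply,
    ← comul_mul, LinearEquiv.coe_coe, lid_counit_comul, ← mul_assoc, mul_one] at h1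
  conv_rhs => rw [h, Finset.mul_sum]
  simp only [Algebra.TensorProduct.tmul_mul_tmul, one_mul]
  rw [h1, hx]
  simp only [map_sum, LinearMap.rTensor_tmul, epsS_eq_sum h, Finset.sum_mul,
    Algebra.TensorProduct.tmul_mul_tmul, TensorProduct.tmul_sum, TensorProduct.sum_tmul, mul_one,
    TensorProduct.lid_tmul, TensorProduct.tmul_smul, TensorProduct.smul_tmul']
  exact Finset.sum_comm

theorem epsS_eq_sum_epsS (h : Δ k H 1 = ∑ i, a i ⊗ₜ[k] b i) (x : H) :
    epsS k H x = ∑ i, ε k H (x * a i) • epsS k H (b i) := by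
  have h1 j : ε k H (x * b j) = _ := counit_mul_eq_sum h x (b j)
  conv_lhs => rw [epsS_eq_sum h]
  simp only [epsS_eq_sum h (b _), h1, Finset.sum_smul, Finset.smul_sum, smul_smul]
  exact Finset.sum_comm

theorem epsT_eq_sum_epsT (h : Δ k H 1 = ∑ i, a i ⊗ₜ[k] b i) (x : H) :
    epsT k H x = ∑ i, ε k H (b i * x) • epsT k H (a i) := by
  have h1 j : ε k H (a j * x) = _ := counit_mul_eq_sum h (a j) x
  conv_lhs => rw [epsT_eq_sum h]
  simp only [epsT_eq_sum h (a _), h1, Finset.sum_smul, Finset.smul_sum, smul_smul]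
  rw [Finset.sum_comm]
  simp only [mul_comm]

/-- `x₍₁₎ ⊗ ε_s(x₍₂₎) = x 1₍₁₎ ⊗ ε_s(1₍₂₎)`. -/
theorem lTensor_epsS_comul (x : H) :
    (epsS k H).lTensor H (Δ k H x) = (x ⊗ₜ[k] 1) * (epsS k H).lTensor H (Δ k H 1) := by
  obtain ⟨n, a, b, h⟩ := exists_sum_tmul (Δ k H 1)
  obtain ⟨m, p, q, hx⟩ := exists_sum_tmul (Δ k H x)
  have h1 := congrArg (TensorProduct.map ((TensorProduct.rid k H).toLinearMap ∘ₗ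
    (ε k H).lTensor H ∘ₗ LinearMap.mulLeft k (Δ k H x)) (epsS k H)) (sum_comul_tmul_right h)
  simp only [map_sum, TensorProduct.map_tmul, LinearMap.comp_apply, LinearMap.mulLeft_apply,
    ← comul_mul, LinearEquiv.coe_coe, rid_counit_comul, ← mul_assoc, mul_one] at h1
  conv_rhs => rw [h, map_sum, Finset.mul_sum]
  simp only [Algebra.TensorProduct.tmul_mul_tmul, one_mul, LinearMap.lTensor_tmul]
  rw [h1, hx]
  simp only [map_sum, LinearMap.lTensor_tmul, Finset.sum_mul,
    Algebra.TensorProduct.tmul_mul_tmul, TensorProduct.sum_tmul, mul_one, TensorProduct.rid_tmul]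
  rw [Finset.sum_comm]
  refine Finset.sum_congr rfl fun i _ => ?_
  rw [epsS_eq_sum_epsS h]
  simp [TensorProduct.tmul_sum, TensorProduct.smul_tmul]

/-- `ε_t(x₍₁₎) ⊗ x₍₂₎ = ε_t(1₍₁₎) ⊗ 1₍₂₎ x`. -/
theorem rTensor_epsT_comul (x : H) :
    (epsT k H).rTensor H (Δ k H x) = (epsT k H).rTensor H (Δ k H 1) * (1 ⊗ₜ[k] x) := by
  obtain ⟨n, a, b, h⟩ := exists_sum_tmul (Δ k H 1)
  obtain ⟨m, p, q, hx⟩ := exists_sum_tmul (Δ k H x)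
  have h1 := congrArg (TensorProduct.map (epsT k H) ((TensorProduct.lid k H).toLinearMap ∘ₗ
    (ε k H).rTensor H ∘ₗ LinearMap.mulRight k (Δ k H x))) (sum_tmul_comul_left h)
  simp only [map_sum, TensorProduct.map_tmul, LinearMap.comp_apply, LinearMap.mulRight_apply,
    ← comul_mul, LinearEquiv.coe_coe, lid_counit_comul, mul_assoc, one_mul] at h1
  conv_rhs => rw [h, map_sum, Finset.sum_mul]
  simp only [Algebra.TensorProduct.tmul_mul_tmul, mul_one, LinearMap.rTensor_tmul]
  rw [h1, hx]
  simp only [map_sum, LinearMap.rTensor_tmul, Finset.mul_sum,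
    Algebra.TensorProduct.tmul_mul_tmul, TensorProduct.tmul_sum, one_mul, TensorProduct.lid_tmul]
  rw [Finset.sum_comm]
  refine Finset.sum_congr rfl fun i _ => ?_
  rw [epsT_eq_sum_epsT h]
  simp [TensorProduct.sum_tmul, TensorProduct.smul_tmul]

end Basics

/-! ### The antipode -/

section Antipode

open WithConv

variable {k : Type u} {H : Type v} [Field k] [Ring H] [Algebra k H] [WeakHopfAlgebra k H]

/-- Uniqueness of generalized inverses in a semigroup. In convolution algebras this replaces the
uniqueness of inverses used for ordinary Hopf algebras. -/
theorem eq_of_generalized_inverse {A : Type*} [Semigroup A] {X D Y : A} (h1 : X * (D * X) = X)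
    (h2 : Y * D = X * D) (h3 : D * Y = D * X) (h4 : Y * (D * Y) = Y) : X = Y := by
  rw [← h1, ← mul_assoc, ← h2, mul_assoc, ← h3, h4]

theorem conv_id_antipode :
    toConv (LinearMap.id : H →ₗ[k] H) * toConv (S k H) = toConv (epsT k H) := by
  ext x
  exact WeakHopfAlgebra.mul_antipode x

theorem conv_antipode_id :
    toConv (S k H) * toConv (LinearMap.id : H →ₗ[k] H) = toConv (epsS k H) := by
  ext x
  exact WeakHopfAlgebra.antipode_mul x

theorem conv_antipode_epsT : toConv (S k H) * toConv (epsT k H) = toConv (S k H) := by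
  rw [← conv_id_antipode]
  ext x
  exact WeakHopfAlgebra.antipode_mul_antipode x

theorem conv_epsS_antipode : toConv (epsS k H) * toConv (S k H) = toConv (S k H) := by
  rw [← conv_antipode_id, mul_assoc, conv_id_antipode, conv_antipode_epsT]

theorem sum_antipode_mul {n : ℕ} {p q : Fin n → H} {x : H} (h : Δ k H x = ∑ i, p i ⊗ₜ[k] q i) :
    ∑ i, S k H (p i) * q i = epsS k H x := by
  have := WeakHopfAlgebra.antipode_mul (k := k) x
  rw [h] at this
  simpa using this

theorem sum_mul_antipode {n : ℕ} {p q : Fin n → H} {x : H} (h : Δ k H x = ∑ i, p i ⊗ₜ[k] q i) :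
    ∑ i, p i * S k H (q i) = epsT k H x := by
  have := WeakHopfAlgebra.mul_antipode (k := k) x
  rw [h] at this
  simpa using this

theorem sum_epsS_mul_antipode {n : ℕ} {p q : Fin n → H} {x : H}
    (h : Δ k H x = ∑ i, p i ⊗ₜ[k] q i) : ∑ i, epsS k H (p i) * S k H (q i) = S k H x := by
  have := congrArg (fun f => f.ofConv x) (conv_epsS_antipode (k := k) (H := H))
  simpa [LinearMap.convMul_def, h] using this

theorem sum_antipode_mul_epsT {n : ℕ} {p q : Fin n → H} {x : H}
    (h : Δ k H x = ∑ i, p i ⊗ₜ[k] q i) : ∑ i, S k H (p i) * epsT k H (q i) = S k H x := by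
  have := congrArg (fun f => f.ofConv x) (conv_antipode_epsT (k := k) (H := H))
  simpa [LinearMap.convMul_def, h] using this

theorem antipode_one : S k H 1 = 1 := by
  obtain ⟨n, a, b, h⟩ := exists_sum_tmul (Δ k H 1)
  have h1 := congrArg (LinearMap.mul' k H ∘ₗ (S k H).rTensor H)
    (lTensor_epsT_comul_one (k := k) (H := H))
  rw [h] at h1
  simpa [sum_antipode_mul_epsT h, sum_antipode_mul h, epsS_one] using h1

theorem sum_antipode_mul_mul {n : ℕ} {p q : Fin n → H} {x u : H}
    (h : Δ k H x = ∑ i, p i ⊗ₜ[k] q i) (hu : u ∈ LinearMap.range (epsS k H)) :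
    ∑ i, S k H (p i) * (u * q i) = epsS k H (u * x) := by
  obtain ⟨w, rfl⟩ := hu
  have : Δ k H (epsS k H w * x) = ∑ i, p i ⊗ₜ[k] (epsS k H w * q i) := by
    rw [comul_mul, comul_epsS_left, mul_assoc, comul_one_mul, h, Finset.mul_sum]
    simp
  rw [sum_antipode_mul this]

theorem sum_mul_mul_antipode {n : ℕ} {p q : Fin n → H} {x z : H}
    (h : Δ k H x = ∑ i, p i ⊗ₜ[k] q i) (hz : z ∈ LinearMap.range (epsT k H)) :
    ∑ i, p i * z * S k H (q i) = epsT k H (x * z) := by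
  obtain ⟨w, rfl⟩ := hz
  have : Δ k H (x * epsT k H w) = ∑ i, (p i * epsT k H w) ⊗ₜ[k] q i := by
    rw [comul_mul, comul_epsT_right, ← mul_assoc, comul_mul_one, h, Finset.sum_mul]
    simp
  rw [sum_mul_antipode this]

/-- `ε_s(u x₍₁₎) S(x₍₂₎) = S(x) u` for `u` in `H_s`. -/
theorem sum_epsS_mul_mul_antipode {n : ℕ} {p q : Fin n → H} {x u : H}
    (h : Δ k H x = ∑ i, p i ⊗ₜ[k] q i) (hu : u ∈ LinearMap.range (epsS k H)) :
    ∑ i, epsS k H (u * p i) * S k H (q i) = S k H x * u := by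
  have h1 : toConv (epsS k H ∘ₗ LinearMap.mulLeft k u) =
      toConv (S k H) * toConv (LinearMap.mulLeft k u) := by
    ext y
    obtain ⟨m, r, s, hy⟩ := exists_sum_tmul (Δ k H y)
    simp [hy, ← sum_antipode_mul_mul hy hu]
  have h2 : toConv (LinearMap.mulLeft k u) * toConv (S k H) =
      toConv (LinearMap.mulRight k u ∘ₗ epsT k H) := by
    ext y
    obtain ⟨m, r, s, hy⟩ := exists_sum_tmul (Δ k H y)
    obtain ⟨w, rfl⟩ := hu
    have := epsT_mul_epsS (k := k) y w
    rw [← sum_mul_antipode hy, Finset.sum_mul, Finset.mul_sum] at this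
    simpa [hy, ← sum_mul_antipode hy, mul_assoc] using this.symm
  have h3 : toConv (epsS k H ∘ₗ LinearMap.mulLeft k u) * toConv (S k H) =
      toConv (LinearMap.mulRight k u ∘ₗ S k H) := by
    rw [h1, mul_assoc, h2]
    ext y
    obtain ⟨m, r, s, hy⟩ := exists_sum_tmul (Δ k H y)
    simp [hy, ← sum_antipode_mul_epsT hy, mul_assoc]
  have := congrArg (fun f => f.ofConv x) h3
  simpa [LinearMap.convMul_def, h] using this

/-- The antipode is antimultiplicative: `S ∘ mul` and `x ⊗ y ↦ S(y) S(x)` are both generalized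
inverses of `mul` in the convolution algebra of maps `H ⊗ H → H`. -/
theorem antipode_mul (x y : H) : S k H (x * y) = S k H y * S k H x := by
  have key : toConv (S k H ∘ₗ LinearMap.mul' k H) =
      toConv (LinearMap.mul' k H ∘ₗ TensorProduct.map (S k H) (S k H) ∘ₗ
        (TensorProduct.comm k H H).toLinearMap) := by
    have e1 : toConv (S k H ∘ₗ LinearMap.mul' k H) * toConv (LinearMap.mul' k H) =
        toConv (epsS k H ∘ₗ LinearMap.mul' k H) := by
      ext x y
      obtain ⟨m, r, s, hx⟩ := exists_sum_tmul (Δ k H x)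
      obtain ⟨n, p, q, hy⟩ := exists_sum_tmul (Δ k H y)
      have h := WeakHopfAlgebra.antipode_mul (k := k) (x * y)
      rw [comul_mul, hx, hy, Finset.sum_mul_sum, Finset.sum_comm] at h
      simpa [hx, hy, TensorProduct.sum_tmul, TensorProduct.tmul_sum] using h
    have e2 : toConv (LinearMap.mul' k H) * toConv (S k H ∘ₗ LinearMap.mul' k H) =
        toConv (epsT k H ∘ₗ LinearMap.mul' k H) := by
      ext x y
      obtain ⟨m, r, s, hx⟩ := exists_sum_tmul (Δ k H x)
      obtain ⟨n, p, q, hy⟩ := exists_sum_tmul (Δ k H y)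
      have h := WeakHopfAlgebra.mul_antipode (k := k) (x * y)
      rw [comul_mul, hx, hy, Finset.sum_mul_sum, Finset.sum_comm] at h
      simpa [hx, hy, TensorProduct.sum_tmul, TensorProduct.tmul_sum] using h
    have e3 : toConv (LinearMap.mul' k H ∘ₗ TensorProduct.map (S k H) (S k H) ∘ₗ
        (TensorProduct.comm k H H).toLinearMap) * toConv (LinearMap.mul' k H) =
        toConv (epsS k H ∘ₗ LinearMap.mul' k H) := by
      ext x y
      obtain ⟨m, r, s, hx⟩ := exists_sum_tmul (Δ k H x)
      obtain ⟨n, p, q, hy⟩ := exists_sum_tmul (Δ k H y)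
      have h := sum_antipode_mul_mul hy ⟨x, rfl⟩
      rw [epsS_epsS_mul, ← sum_antipode_mul hx] at h
      simpa [hx, hy, TensorProduct.sum_tmul, TensorProduct.tmul_sum, Finset.sum_mul,
        Finset.mul_sum, mul_assoc] using h
    have e4 : toConv (LinearMap.mul' k H) * toConv (LinearMap.mul' k H ∘ₗ
        TensorProduct.map (S k H) (S k H) ∘ₗ (TensorProduct.comm k H H).toLinearMap) =
        toConv (epsT k H ∘ₗ LinearMap.mul' k H) := by
      ext x y
      obtain ⟨m, r, s, hx⟩ := exists_sum_tmul (Δ k H x)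
      obtain ⟨n, p, q, hy⟩ := exists_sum_tmul (Δ k H y)
      have h := sum_mul_mul_antipode hx ⟨y, rfl⟩
      rw [epsT_mul_epsT, ← sum_mul_antipode hy] at h
      simp only [Finset.sum_mul, Finset.mul_sum] at h
      rw [Finset.sum_comm] at h
      simpa [hx, hy, TensorProduct.sum_tmul, TensorProduct.tmul_sum, mul_assoc] using h
    refine eq_of_generalized_inverse (D := toConv (LinearMap.mul' k H)) ?_ (e3.trans e1.symm)
      (e4.trans e2.symm) ?_
    · rw [e2]
      ext x y
      obtain ⟨m, r, s, hx⟩ := exists_sum_tmul (Δ k H x)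
      obtain ⟨n, p, q, hy⟩ := exists_sum_tmul (Δ k H y)
      have hxy : Δ k H (x * y) = Δ k H x * Δ k H y := comul_mul x y
      have h := congrArg (fun f => f.ofConv (x * y)) (conv_antipode_epsT (k := k) (H := H))
      simp only [LinearMap.convMul_def, LinearMap.comp_apply] at h
      rw [hxy, hx, hy, Finset.sum_mul_sum, Finset.sum_comm] at h
      simpa [hx, hy, TensorProduct.sum_tmul, TensorProduct.tmul_sum] using h
    · rw [← mul_assoc, e3]
      ext x y
      obtain ⟨m, r, s, hx⟩ := exists_sum_tmul (Δ k H x)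
      obtain ⟨n, p, q, hy⟩ := exists_sum_tmul (Δ k H y)
      have h i := sum_epsS_mul_mul_antipode hy ⟨r i, rfl⟩
      simp only [epsS_epsS_mul] at h
      have h' : ∑ i, (∑ j, epsS k H (r i * p j) * S k H (q j)) * S k H (s i) =
          S k H y * S k H x := by
        simp only [h, mul_assoc, ← Finset.mul_sum, sum_epsS_mul_antipode hx]
      simp only [Finset.sum_mul] at h'
      rw [Finset.sum_comm] at h'
      simpa [hx, hy, TensorProduct.sum_tmul, TensorProduct.tmul_sum, mul_assoc] using h'
  simpa using congrArg (fun f => f.ofConv (x ⊗ₜ[k] y)) key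

end Antipode

section Antipode

open WithConv

variable {k : Type u} {H : Type v} [Field k] [Ring H] [Algebra k H] [WeakHopfAlgebra k H]

theorem antipode_epsS (x : H) : S k H (epsS k H x) = epsT k H (epsS k H x) := by
  obtain ⟨n, a, b, h⟩ := exists_sum_tmul (Δ k H 1)
  have : Δ k H (epsS k H x) = ∑ i, a i ⊗ₜ[k] (epsS k H x * b i) := by
    simp [comul_epsS_left, h, Finset.mul_sum]
  rw [← sum_mul_antipode this]
  simp only [antipode_mul, ← mul_assoc, ← Finset.sum_mul]
  rw [sum_mul_antipode h, epsT_one, one_mul]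

theorem antipode_epsT (x : H) : S k H (epsT k H x) = epsS k H (epsT k H x) := by
  obtain ⟨n, a, b, h⟩ := exists_sum_tmul (Δ k H 1)
  have : Δ k H (epsT k H x) = ∑ i, (a i * epsT k H x) ⊗ₜ[k] b i := by
    simp [comul_epsT_right, h, Finset.sum_mul]
  rw [← sum_antipode_mul this]
  simp only [antipode_mul, mul_assoc, ← Finset.mul_sum]
  rw [sum_antipode_mul h, epsS_one, mul_one]

theorem epsS_mul_epsS (x w : H) : epsS k H (x * epsS k H w) = epsS k H x * epsS k H w := by
  obtain ⟨n, p, q, h⟩ := exists_sum_tmul (Δ k H x)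
  have : Δ k H (x * epsS k H w) = ∑ i, p i ⊗ₜ[k] (q i * epsS k H w) := by
    rw [comul_mul, comul_epsS_right, ← mul_assoc, comul_mul_one, h, Finset.sum_mul]
    simp
  rw [← sum_antipode_mul this]
  simp only [← mul_assoc, ← Finset.sum_mul]
  rw [sum_antipode_mul h]

theorem epsT_epsT_mul (x w : H) : epsT k H (epsT k H w * x) = epsT k H w * epsT k H x := by
  obtain ⟨n, p, q, h⟩ := exists_sum_tmul (Δ k H x)
  have : Δ k H (epsT k H w * x) = ∑ i, (epsT k H w * p i) ⊗ₜ[k] q i := by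
    rw [comul_mul, comul_epsT_left, mul_assoc, comul_one_mul, h, Finset.mul_sum]
    simp
  rw [← sum_mul_antipode this]
  simp only [mul_assoc, ← Finset.mul_sum]
  rw [sum_mul_antipode h]

theorem map_epsS_epsT_comul_one :
    TensorProduct.map (epsS k H) (epsT k H) (Δ k H 1) = Δ k H 1 := by
  rw [← LinearMap.rTensor_comp_lTensor, LinearMap.comp_apply, lTensor_epsT_comul_one,
    rTensor_epsS_comul_one]

/-- The map `x ⊗ y ↦ S(y) ⊗ S(x)`. -/
def flipAntipode (k : Type u) (H : Type v) [Field k] [Ring H] [Algebra k H]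
    [WeakHopfAlgebra k H] : H ⊗[k] H →ₗ[k] H ⊗[k] H :=
  TensorProduct.map (S k H) (S k H) ∘ₗ (TensorProduct.comm k H H).toLinearMap

@[simp]
theorem flipAntipode_tmul (x y : H) :
    flipAntipode k H (x ⊗ₜ[k] y) = S k H y ⊗ₜ[k] S k H x := rfl

theorem flipAntipode_mul (s t : H ⊗[k] H) :
    flipAntipode k H (s * t) = flipAntipode k H t * flipAntipode k H s := by
  induction s with
  | zero => simp
  | add s s' hs hs' => simp only [map_add, add_mul, mul_add, hs, hs']
  | tmul a b =>
    induction t with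
    | zero => simp
    | add t t' ht ht' => simp only [map_add, add_mul, mul_add, ht, ht']
    | tmul c d => simp [antipode_mul]

/-- `S(1₍₂₎) ⊗ S(1₍₁₎) = Δ(1)`. -/
theorem flipAntipode_comul_one : flipAntipode k H (Δ k H 1) = Δ k H 1 := by
  obtain ⟨n, a, b, h⟩ := exists_sum_tmul (Δ k H 1)
  have h1 : flipAntipode k H (Δ k H 1) = ∑ i, epsS k H (b i) ⊗ₜ[k] epsT k H (a i) := by
    have h2 := congrArg (flipAntipode k H) (map_epsS_epsT_comul_one (k := k) (H := H))
    have h3 := congrArg (TensorProduct.map (epsS k H) (epsT k H) ∘ₗ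
      (TensorProduct.comm k H H).toLinearMap) (map_epsS_epsT_comul_one (k := k) (H := H))
    rw [← h2]
    conv_lhs => rw [h]
    conv_lhs at h3 => rw [h]
    conv_rhs at h3 => rw [h]
    simpa [antipode_epsS, antipode_epsT] using h3
  rw [h1]
  have h4 j : epsT k H (a j) = _ := epsT_eq_sum h (a j)
  have h5 j : epsS k H (b j) = _ := epsS_eq_sum h (b j)
  simp only [h4, h5, TensorProduct.sum_tmul, TensorProduct.tmul_sum,
    TensorProduct.smul_tmul_smul]
  rw [Finset.sum_comm, Finset.sum_congr rfl fun i _ => Finset.sum_comm]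
  have h6 i j : ∑ l, (ε k H (b l * b i) * ε k H (a j * a l)) • a i ⊗ₜ[k] b j =
      a i ⊗ₜ[k] (ε k H (a j * b i) • b j) := by
    rw [counit_mul_eq_sum h (a j), Finset.sum_smul, TensorProduct.tmul_sum]
    simp [TensorProduct.tmul_smul, mul_comm]
  rw [Finset.sum_comm]
  simp only [h6]
  have h7 := lTensor_epsT_comul_one (k := k) (H := H)
  conv_lhs at h7 => rw [h]
  rw [← h7]
  simp [epsT_eq_sum h, TensorProduct.tmul_sum]

/-- The antipode is anticomultiplicative: `Δ ∘ S` and `x ↦ S(x₍₂₎) ⊗ S(x₍₁₎)` are both generalized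
inverses of `Δ` in the convolution algebra of maps `H → H ⊗ H`. -/
theorem comul_antipode (x : H) : Δ k H (S k H x) = flipAntipode k H (Δ k H x) := by
  let l₁ : H →ₗ[k] H ⊗[k] H := (TensorProduct.mk k H H).flip 1
  let l₂ : H →ₗ[k] H ⊗[k] H := TensorProduct.mk k H H 1
  have hl₁ (f g : H →ₗ[k] H) : toConv (l₁ ∘ₗ f) * toConv (l₁ ∘ₗ g) =
      toConv (l₁ ∘ₗ (toConv f * toConv g).ofConv) := by
    ext y
    obtain ⟨m, r, s, hy⟩ := exists_sum_tmul (Δ k H y)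
    simp [hy, l₁]
  have hl₂ (f g : H →ₗ[k] H) : toConv (l₂ ∘ₗ f) * toConv (l₂ ∘ₗ g) =
      toConv (l₂ ∘ₗ (toConv f * toConv g).ofConv) := by
    ext y
    obtain ⟨m, r, s, hy⟩ := exists_sum_tmul (Δ k H y)
    simp [hy, l₂]
  have eD : toConv (Δ k H) = toConv (l₁ ∘ₗ LinearMap.id) * toConv (l₂ ∘ₗ LinearMap.id) := by
    ext y
    obtain ⟨m, r, s, hy⟩ := exists_sum_tmul (Δ k H y)
    simp [hy, l₁, l₂]
  have eY : toConv (flipAntipode k H ∘ₗ Δ k H) =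
      toConv (l₂ ∘ₗ S k H) * toConv (l₁ ∘ₗ S k H) := by
    ext y
    obtain ⟨m, r, s, hy⟩ := exists_sum_tmul (Δ k H y)
    simp [hy, l₁, l₂]
  have e1 : toConv (Δ k H ∘ₗ S k H) * toConv (Δ k H) = toConv (Δ k H ∘ₗ epsS k H) := by
    ext y
    obtain ⟨m, r, s, hy⟩ := exists_sum_tmul (Δ k H y)
    simp [hy, ← sum_antipode_mul hy, comul_mul]
  have e2 : toConv (Δ k H) * toConv (Δ k H ∘ₗ S k H) = toConv (Δ k H ∘ₗ epsT k H) := by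
    ext y
    obtain ⟨m, r, s, hy⟩ := exists_sum_tmul (Δ k H y)
    simp [hy, ← sum_mul_antipode hy, comul_mul]
  have e3 : toConv (flipAntipode k H ∘ₗ Δ k H) * toConv (Δ k H) =
      toConv (Δ k H ∘ₗ epsS k H) := by
    have h1 : toConv (l₁ ∘ₗ epsS k H) * toConv (l₂ ∘ₗ LinearMap.id) =
        toConv (LinearMap.mulRight k (Δ k H 1) ∘ₗ l₂) := by
      ext y
      obtain ⟨m, r, s, hy⟩ := exists_sum_tmul (Δ k H y)
      have := rTensor_epsS_comul (k := k) y
      rw [hy] at this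
      simpa [hy, l₁, l₂] using this
    rw [eY, eD, mul_assoc, ← mul_assoc (toConv (l₁ ∘ₗ S k H)), hl₁, conv_antipode_id,
      ofConv_toConv, h1]
    ext y
    obtain ⟨m, r, s, hy⟩ := exists_sum_tmul (Δ k H y)
    have := comul_epsS_left (k := k) y
    rw [← sum_antipode_mul hy, TensorProduct.tmul_sum, Finset.sum_mul, map_sum] at this
    simpa [hy, l₂, ← sum_antipode_mul hy, ← mul_assoc] using this.symm
  have e4 : toConv (Δ k H) * toConv (flipAntipode k H ∘ₗ Δ k H) =
      toConv (Δ k H ∘ₗ epsT k H) := by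
    have h1 : toConv (l₁ ∘ₗ LinearMap.id) * toConv (l₂ ∘ₗ epsT k H) =
        toConv (LinearMap.mulLeft k (Δ k H 1) ∘ₗ l₁) := by
      ext y
      obtain ⟨m, r, s, hy⟩ := exists_sum_tmul (Δ k H y)
      have := lTensor_epsT_comul (k := k) y
      rw [hy] at this
      simpa [hy, l₁, l₂] using this
    rw [eY, eD, mul_assoc, ← mul_assoc (toConv (l₂ ∘ₗ LinearMap.id)), hl₂, conv_id_antipode,
      ofConv_toConv, ← mul_assoc, h1]
    ext y
    obtain ⟨m, r, s, hy⟩ := exists_sum_tmul (Δ k H y)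
    have := comul_epsT_right (k := k) y
    rw [← sum_mul_antipode hy, TensorProduct.sum_tmul, Finset.mul_sum, map_sum] at this
    simpa [hy, l₁, ← sum_mul_antipode hy, mul_assoc] using this.symm
  have key : toConv (Δ k H ∘ₗ S k H) = toConv (flipAntipode k H ∘ₗ Δ k H) := by
    refine eq_of_generalized_inverse (D := toConv (Δ k H)) ?_ (e3.trans e1.symm)
      (e4.trans e2.symm) ?_
    · rw [e2]
      ext y
      obtain ⟨m, r, s, hy⟩ := exists_sum_tmul (Δ k H y)
      have := congrArg (Δ k H) (sum_antipode_mul_epsT hy)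
      simpa [hy, comul_mul] using this
    · rw [← mul_assoc, e3]
      have h1 : toConv (Δ k H ∘ₗ epsS k H) * toConv (flipAntipode k H ∘ₗ Δ k H) =
          toConv (LinearMap.mulLeft k (Δ k H 1) ∘ₗ
            (toConv (l₂ ∘ₗ epsS k H) * toConv (flipAntipode k H ∘ₗ Δ k H)).ofConv) := by
        ext y
        obtain ⟨m, r, s, hy⟩ := exists_sum_tmul (Δ k H y)
        simp [hy, l₂, comul_epsS_right, mul_assoc]
      rw [h1, eY, ← mul_assoc, hl₂, conv_epsS_antipode, ofConv_toConv, ← eY]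
      ext y
      have := flipAntipode_mul (k := k) (Δ k H y) (Δ k H 1)
      rw [comul_mul_one, flipAntipode_comul_one] at this
      simpa using this.symm
  simpa using congrArg (fun f => f.ofConv x) key

theorem epsT_antipode (x : H) : epsT k H (S k H x) = S k H (epsS k H x) := by
  obtain ⟨m, r, s, hx⟩ := exists_sum_tmul (Δ k H x)
  have h : Δ k H (S k H x) = ∑ i, S k H (s i) ⊗ₜ[k] S k H (r i) := by
    simp [comul_antipode, hx]
  rw [← sum_mul_antipode h, ← sum_antipode_mul hx]
  simp [antipode_mul]

theorem antipode_mem_range_epsT {y : H} (hy : y ∈ LinearMap.range (epsS k H)) :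
    S k H y ∈ LinearMap.range (epsT k H) := by
  obtain ⟨x, rfl⟩ := hy
  exact ⟨_, (antipode_epsS x).symm⟩

theorem antipode_mem_range_epsS {z : H} (hz : z ∈ LinearMap.range (epsT k H)) :
    S k H z ∈ LinearMap.range (epsS k H) := by
  obtain ⟨x, rfl⟩ := hz
  exact ⟨_, (antipode_epsT x).symm⟩

end Antipode

/-! ### Regular weak Hopf algebras -/

section Regular

variable {k : Type u} {H : Type v} [Field k] [Ring H] [Algebra k H] [WeakHopfAlgebra k H]

theorem IsRegular.antipode_antipode_epsT (hreg : IsRegular k H) (x : H) :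
    S k H (S k H (epsT k H x)) = epsT k H x := by
  simpa [epsS_one] using hreg x 1

theorem IsRegular.antipode_antipode_epsS (hreg : IsRegular k H) (x : H) :
    S k H (S k H (epsS k H x)) = epsS k H x := by
  simpa [epsT_one] using hreg 1 x

theorem IsRegular.antipode_antipode_of_mem_epsT (hreg : IsRegular k H) {z : H}
    (hz : z ∈ LinearMap.range (epsT k H)) : S k H (S k H z) = z := by
  obtain ⟨x, rfl⟩ := hz
  exact hreg.antipode_antipode_epsT x

theorem IsRegular.antipode_antipode_of_mem_epsS (hreg : IsRegular k H) {y : H}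
    (hy : y ∈ LinearMap.range (epsS k H)) : S k H (S k H y) = y := by
  obtain ⟨x, rfl⟩ := hy
  exact hreg.antipode_antipode_epsS x

/-- The legs of a presentation of `Δ(1)` can be chosen in `H_s` and `H_t`. -/
theorem exists_comul_one_eq_sum : ∃ (n : ℕ) (a b : Fin n → H),
    Δ k H 1 = ∑ i, a i ⊗ₜ[k] b i ∧ (∀ i, a i ∈ LinearMap.range (epsS k H)) ∧
      ∀ i, b i ∈ LinearMap.range (epsT k H) := by
  obtain ⟨n, a, b, h⟩ := exists_sum_tmul (Δ k H 1)
  refine ⟨n, fun i => epsS k H (a i), fun i => epsT k H (b i), ?_, fun i => ⟨_, rfl⟩,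
    fun i => ⟨_, rfl⟩⟩
  rw [← map_epsS_epsT_comul_one, h]
  simp

/-- `y 1₍₁₎ ⊗ 1₍₂₎ = 1₍₁₎ ⊗ S(y) 1₍₂₎` for `y` in `H_s`: apply `id ⊗ S` to
`y 1₍₁₎ ⊗ ε_s(1₍₂₎) = y₍₁₎ ⊗ ε_s(y₍₂₎) = 1₍₁₎ ⊗ ε_s(1₍₂₎) y`. -/
theorem IsRegular.tmul_one_mul_comul_one (hreg : IsRegular k H) {y : H}
    (hy : y ∈ LinearMap.range (epsS k H)) :
    (y ⊗ₜ[k] (1 : H)) * Δ k H 1 = ((1 : H) ⊗ₜ[k] S k H y) * Δ k H 1 := by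
  obtain ⟨x, rfl⟩ := hy
  obtain ⟨n, a, b, h, ha, hb⟩ := exists_comul_one_eq_sum (k := k) (H := H)
  have h1 := congrArg ((S k H).lTensor H) (lTensor_epsS_comul (k := k) (epsS k H x))
  have hb' i : S k H (epsS k H (b i)) = b i := by
    obtain ⟨w, hw⟩ := hb i
    rw [← hw, ← antipode_epsT, hreg.antipode_antipode_epsT]
  rw [comul_epsS_right, h] at h1
  simp only [Finset.sum_mul, Finset.mul_sum, map_sum, LinearMap.lTensor_tmul,
    Algebra.TensorProduct.tmul_mul_tmul, one_mul, mul_one, epsS_mul_epsS, antipode_mul, hb'] at h1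
  simpa [h, Finset.mul_sum] using h1.symm

theorem IsRegular.comul_one_mul_one_tmul (hreg : IsRegular k H) {z : H}
    (hz : z ∈ LinearMap.range (epsT k H)) :
    Δ k H 1 * ((1 : H) ⊗ₜ[k] z) = Δ k H 1 * (S k H z ⊗ₜ[k] (1 : H)) := by
  obtain ⟨x, rfl⟩ := hz
  obtain ⟨n, a, b, h, ha, hb⟩ := exists_comul_one_eq_sum (k := k) (H := H)
  have h1 := congrArg ((S k H).rTensor H) (rTensor_epsT_comul (k := k) (epsT k H x))
  have ha' i : S k H (epsT k H (a i)) = a i := by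
    obtain ⟨w, hw⟩ := ha i
    rw [← hw, ← antipode_epsS, hreg.antipode_antipode_epsS]
  rw [comul_epsT_left, h] at h1
  simp only [Finset.sum_mul, Finset.mul_sum, map_sum, LinearMap.rTensor_tmul,
    Algebra.TensorProduct.tmul_mul_tmul, one_mul, mul_one, epsT_epsT_mul, antipode_mul, ha'] at h1
  simpa [h, Finset.sum_mul] using h1.symm

theorem IsRegular.comul_one_mul_tmul_one (hreg : IsRegular k H) {y : H}
    (hy : y ∈ LinearMap.range (epsS k H)) :
    Δ k H 1 * (y ⊗ₜ[k] (1 : H)) = Δ k H 1 * ((1 : H) ⊗ₜ[k] S k H y) := by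
  rw [hreg.comul_one_mul_one_tmul (antipode_mem_range_epsT hy),
    hreg.antipode_antipode_of_mem_epsS hy]

variable {n : ℕ} {a b : Fin n → H}

theorem sum_mul_antipode_one (h : Δ k H 1 = ∑ i, a i ⊗ₜ[k] b i) :
    ∑ i, a i * S k H (b i) = 1 := by rw [sum_mul_antipode h, epsT_one]

theorem sum_antipode_mul_one (h : Δ k H 1 = ∑ i, a i ⊗ₜ[k] b i) :
    ∑ i, S k H (a i) * b i = 1 := by rw [sum_antipode_mul h, epsS_one]

theorem IsRegular.sum_antipode_mul_flip (hreg : IsRegular k H)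
    (h : Δ k H 1 = ∑ i, a i ⊗ₜ[k] b i) (ha : ∀ i, a i ∈ LinearMap.range (epsS k H)) :
    ∑ i, S k H (b i) * a i = 1 := by
  rw [← antipode_one (k := k), ← sum_antipode_mul_one h, map_sum]
  exact Finset.sum_congr rfl fun i _ => by
    rw [antipode_mul, hreg.antipode_antipode_of_mem_epsS (ha i)]

theorem IsRegular.sum_mul_antipode_flip (hreg : IsRegular k H)
    (h : Δ k H 1 = ∑ i, a i ⊗ₜ[k] b i) (hb : ∀ i, b i ∈ LinearMap.range (epsT k H)) :
    ∑ i, b i * S k H (a i) = 1 := by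
  rw [← antipode_one (k := k), ← sum_mul_antipode_one h, map_sum]
  exact Finset.sum_congr rfl fun i _ => by
    rw [antipode_mul, hreg.antipode_antipode_of_mem_epsT (hb i)]

theorem IsRegular.sum_epsT_mul (hreg : IsRegular k H) (h : Δ k H 1 = ∑ i, a i ⊗ₜ[k] b i)
    (ha : ∀ i, a i ∈ LinearMap.range (epsS k H)) (hb : ∀ i, b i ∈ LinearMap.range (epsT k H)) :
    ∑ i, epsT k H (a i * b i) = 1 := by
  rw [← hreg.sum_mul_antipode_flip h hb]
  refine Finset.sum_congr rfl fun i _ => ?_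
  obtain ⟨y, hy⟩ := ha i
  obtain ⟨z, hz⟩ := hb i
  rw [← hy, ← hz, ← epsT_mul_epsS, epsT_epsT_mul, antipode_epsS]

/-- In the regular case `S(1₍₁₎) ⊗ 1₍₂₎` is a symmetric tensor. -/
theorem IsRegular.sum_antipode_tmul_comm (hreg : IsRegular k H)
    (h : Δ k H 1 = ∑ i, a i ⊗ₜ[k] b i) (hb : ∀ i, b i ∈ LinearMap.range (epsT k H)) :
    ∑ i, S k H (a i) ⊗ₜ[k] b i = ∑ i, b i ⊗ₜ[k] S k H (a i) := by
  have h1 := congrArg ((S k H).rTensor H) (flipAntipode_comul_one (k := k) (H := H))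
  rw [h] at h1
  simpa [fun i => hreg.antipode_antipode_of_mem_epsT (hb i)] using h1.symm

end Regular

/-! ### R-matrices -/

section RMatrix

variable {k : Type u} {H : Type v} [Field k] [Ring H] [Algebra k H]

theorem comm_mul (s t : H ⊗[k] H) : TensorProduct.comm k H H (s * t) =
    TensorProduct.comm k H H s * TensorProduct.comm k H H t :=
  map_mul (Algebra.TensorProduct.comm k H H) s t

variable [WeakHopfAlgebra k H]

theorem comulOp_mul (x y : H) : Δop k H (x * y) = Δop k H x * Δop k H y := by
  change TensorProduct.comm k H H (Δ k H (x * y)) = _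
  rw [comul_mul, comm_mul]; rfl

theorem comulOp_eq_sum {n : ℕ} {p q : Fin n → H} {x : H} (h : Δ k H x = ∑ i, p i ⊗ₜ[k] q i) :
    Δop k H x = ∑ i, q i ⊗ₜ[k] p i := by
  simp [Δop, h]

theorem comulOp_epsS (x : H) :
    Δop k H (epsS k H x) = (epsS k H x ⊗ₜ[k] (1 : H)) * Δop k H 1 := by
  change TensorProduct.comm k H H (Δ k H (epsS k H x)) = _
  rw [comul_epsS_left, comm_mul]; rfl

theorem comulOp_epsT (x : H) :
    Δop k H (epsT k H x) = ((1 : H) ⊗ₜ[k] epsT k H x) * Δop k H 1 := by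
  change TensorProduct.comm k H H (Δ k H (epsT k H x)) = _
  rw [comul_epsT_left, comm_mul]; rfl

theorem IsRegular.one_tmul_mul_comulOp_one (hreg : IsRegular k H) {y : H}
    (hy : y ∈ LinearMap.range (epsS k H)) :
    ((1 : H) ⊗ₜ[k] y) * Δop k H 1 = (S k H y ⊗ₜ[k] (1 : H)) * Δop k H 1 := by
  have := congrArg (TensorProduct.comm k H H) (hreg.tmul_one_mul_comul_one hy)
  rwa [comm_mul, comm_mul] at this

theorem rid_lTensor_counit_mul (t : H ⊗[k] H) (q : H) :
    TensorProduct.rid k H ((ε k H).lTensor H (t * (q ⊗ₜ[k] (1 : H)))) =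
      TensorProduct.rid k H ((ε k H).lTensor H t) * q := by
  induction t with
  | zero => simp
  | add s t hs ht => simp only [add_mul, map_add, hs, ht]
  | tmul x y => simp

theorem rid_lTensor_counit_mul' (t : H ⊗[k] H) (q : H) :
    TensorProduct.rid k H ((ε k H).lTensor H ((q ⊗ₜ[k] (1 : H)) * t)) =
      q * TensorProduct.rid k H ((ε k H).lTensor H t) := by
  induction t with
  | zero => simp
  | add s t hs ht => simp only [mul_add, map_add, hs, ht]
  | tmul x y => simp

theorem lid_rTensor_counit_mul (t : H ⊗[k] H) (q : H) :
    TensorProduct.lid k H ((ε k H).rTensor H (((1 : H) ⊗ₜ[k] q) * t)) =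
      q * TensorProduct.lid k H ((ε k H).rTensor H t) := by
  induction t with
  | zero => simp
  | add s t hs ht => simp only [mul_add, map_add, hs, ht]
  | tmul x y => simp

theorem lid_rTensor_counit_mul' (t : H ⊗[k] H) (q : H) :
    TensorProduct.lid k H ((ε k H).rTensor H (t * ((1 : H) ⊗ₜ[k] q))) =
      TensorProduct.lid k H ((ε k H).rTensor H t) * q := by
  induction t with
  | zero => simp
  | add s t hs ht => simp only [add_mul, map_add, hs, ht]
  | tmul x y => simp

theorem lid_counit_comulOp_one :
    TensorProduct.lid k H ((ε k H).rTensor H (Δop k H 1)) = 1 := by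
  obtain ⟨n, a, b, h⟩ := exists_sum_tmul (Δ k H 1)
  rw [comulOp_eq_sum h]
  have := rid_counit_comul (k := k) (1 : H)
  rw [h] at this
  simpa using this

namespace IsRMatrix

variable {R : H ⊗[k] H} (hR : IsRMatrix R)
include hR

theorem comulOp_one_mul : Δop k H 1 * R = R := by
  obtain ⟨x, hx⟩ := hR.mem
  rw [hx, ← mul_assoc, ← mul_assoc, ← comulOp_mul, mul_one]

theorem mul_comul_one : R * Δ k H 1 = R := by
  obtain ⟨x, hx⟩ := hR.mem
  rw [hx, mul_assoc, ← comul_mul, mul_one]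

variable {n : ℕ} {c d : Fin n → H}

/-- The hexagon identity `(id ⊗ Δ)(R) = R₁₃ R₁₂`, for a presentation of `R`. -/
theorem sum_tmul_comul (h : R = ∑ i, c i ⊗ₜ[k] d i) :
    ∑ i, c i ⊗ₜ[k] Δ k H (d i) = ∑ i, ∑ j, (c i * c j) ⊗ₜ[k] (d j ⊗ₜ[k] d i) := by
  have := hR.id_comul
  rw [h] at this
  simp only [map_sum, LinearMap.lTensor_tmul, TensorProduct.mk_apply, TensorProduct.sum_tmul,
    TensorProduct.assoc_tmul, Finset.sum_mul_sum, Algebra.TensorProduct.tmul_mul_tmul, one_mul,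
    mul_one] at this
  exact this

/-- The hexagon identity `(Δ ⊗ id)(R) = R₁₃ R₂₃`, for a presentation of `R`. -/
theorem sum_comul_tmul (h : R = ∑ i, c i ⊗ₜ[k] d i) :
    ∑ i, Δ k H (c i) ⊗ₜ[k] d i = ∑ i, ∑ j, (c i ⊗ₜ[k] c j) ⊗ₜ[k] (d i * d j) := by
  have := hR.comul_id
  apply (TensorProduct.assoc k H H H).injective
  rw [h] at this
  simp only [map_sum, LinearMap.lTensor_tmul, TensorProduct.mk_apply, TensorProduct.tmul_sum,
    LinearMap.rTensor_tmul,
    TensorProduct.assoc_tmul, Finset.sum_mul_sum, Algebra.TensorProduct.tmul_mul_tmul, one_mul,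
    mul_one] at this ⊢
  exact this

/-- `R¹ ε(R²) = 1`: by the hexagon identity, right multiplication of `R` by `R¹ ε(R²) ⊗ 1` is
trivial, and `R` can be cancelled against its quasi-inverse. -/
theorem lTensor_counit : TensorProduct.rid k H ((ε k H).lTensor H R) = 1 := by
  obtain ⟨n, c, d, h⟩ := exists_sum_tmul R
  set q := TensorProduct.rid k H ((ε k H).lTensor H R) with hq
  have h1 : R = R * (q ⊗ₜ[k] (1 : H)) := by
    have h2 := congrArg (((TensorProduct.lid k H).toLinearMap ∘ₗ (ε k H).rTensor H).lTensor H)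
      (hR.sum_tmul_comul h)
    simp only [map_sum, LinearMap.lTensor_tmul, LinearMap.comp_apply, LinearEquiv.coe_coe,
      lid_counit_comul] at h2
    rw [← h] at h2
    rw [hq]
    conv_lhs => rw [h2]
    rw [h]
    simp [TensorProduct.sum_tmul, Finset.sum_mul_sum, TensorProduct.smul_tmul']
  obtain ⟨R', -, -, h3⟩ := hR.exists_inv
  have h4 : Δ k H 1 = Δ k H 1 * (q ⊗ₜ[k] (1 : H)) := by
    rw [← h3, mul_assoc, ← h1]
  have h5 := rid_counit_comul (k := k) (1 : H)
  rw [h4, rid_lTensor_counit_mul, rid_counit_comul, one_mul] at h5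
  exact h5

theorem rTensor_counit : TensorProduct.lid k H ((ε k H).rTensor H R) = 1 := by
  obtain ⟨n, c, d, h⟩ := exists_sum_tmul R
  set q := TensorProduct.lid k H ((ε k H).rTensor H R) with hq
  have h1 : R = ((1 : H) ⊗ₜ[k] q) * R := by
    have h2 := congrArg (((TensorProduct.lid k H).toLinearMap ∘ₗ (ε k H).rTensor H).rTensor H)
      (hR.sum_comul_tmul h)
    simp only [map_sum, LinearMap.rTensor_tmul, LinearMap.comp_apply, LinearEquiv.coe_coe,
      lid_counit_comul] at h2
    rw [← h] at h2
    rw [hq]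
    conv_lhs => rw [h2]
    rw [h]
    simp [TensorProduct.tmul_sum, Finset.sum_mul_sum, TensorProduct.smul_tmul]
  obtain ⟨R', -, h3, -⟩ := hR.exists_inv
  have h4 : Δop k H 1 = ((1 : H) ⊗ₜ[k] q) * Δop k H 1 := by
    rw [← h3, ← mul_assoc, ← h1]
  have h5 := lid_counit_comulOp_one (k := k) (H := H)
  rw [h4, lid_rTensor_counit_mul, lid_counit_comulOp_one, mul_one] at h5
  exact h5

theorem mul_one_tmul {y : H} (hy : y ∈ LinearMap.range (epsS k H)) :
    R * ((1 : H) ⊗ₜ[k] y) = (y ⊗ₜ[k] (1 : H)) * R := by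
  obtain ⟨x, rfl⟩ := hy
  have := hR.mul_comul (epsS k H x)
  rwa [comul_epsS_right, ← mul_assoc, hR.mul_comul_one, comulOp_epsS, mul_assoc,
    hR.comulOp_one_mul] at this

theorem mul_tmul_one {z : H} (hz : z ∈ LinearMap.range (epsT k H)) :
    R * (z ⊗ₜ[k] (1 : H)) = ((1 : H) ⊗ₜ[k] z) * R := by
  obtain ⟨x, rfl⟩ := hz
  have := hR.mul_comul (epsT k H x)
  rwa [comul_epsT_right, ← mul_assoc, hR.mul_comul_one, comulOp_epsT, mul_assoc,
    hR.comulOp_one_mul] at this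

theorem one_tmul_mul (hreg : IsRegular k H) {y : H} (hy : y ∈ LinearMap.range (epsS k H)) :
    ((1 : H) ⊗ₜ[k] y) * R = (S k H y ⊗ₜ[k] (1 : H)) * R := by
  rw [← hR.comulOp_one_mul, ← mul_assoc, hreg.one_tmul_mul_comulOp_one hy, mul_assoc]

theorem mul_one_tmul_epsT (hreg : IsRegular k H) {z : H} (hz : z ∈ LinearMap.range (epsT k H)) :
    R * ((1 : H) ⊗ₜ[k] z) = R * (S k H z ⊗ₜ[k] (1 : H)) := by
  rw [← hR.mul_comul_one, mul_assoc, hreg.comul_one_mul_one_tmul hz, mul_assoc]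

variable {a b : Fin n → H}

/-- `R¹ ⊗ ε_t(R²) = S(1₍₁₎) ⊗ 1₍₂₎`. -/
theorem lTensor_epsT (hreg : IsRegular k H) (h : Δ k H 1 = ∑ i, a i ⊗ₜ[k] b i)
    (ha : ∀ i, a i ∈ LinearMap.range (epsS k H)) :
    (epsT k H).lTensor H R = ∑ i, S k H (a i) ⊗ₜ[k] b i := by
  have key (t : H ⊗[k] H) : (epsT k H).lTensor H t =
      ∑ i, TensorProduct.rid k H ((ε k H).lTensor H (((1 : H) ⊗ₜ[k] a i) * t)) ⊗ₜ[k] b i := by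
    induction t with
    | zero => simp
    | add s t hs ht =>
      simp only [mul_add, map_add, TensorProduct.add_tmul, Finset.sum_add_distrib, hs, ht]
    | tmul x y => simp [epsT_eq_sum h, TensorProduct.tmul_sum, TensorProduct.smul_tmul']
  rw [key]
  refine Finset.sum_congr rfl fun i _ => ?_
  rw [hR.one_tmul_mul hreg (ha i), rid_lTensor_counit_mul', hR.lTensor_counit, mul_one]

/-- `R¹ ⊗ ε_s(R²) = S(1₍₂₎) ⊗ 1₍₁₎`. -/
theorem lTensor_epsS (hreg : IsRegular k H) (h : Δ k H 1 = ∑ i, a i ⊗ₜ[k] b i)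
    (hb : ∀ i, b i ∈ LinearMap.range (epsT k H)) :
    (epsS k H).lTensor H R = ∑ i, S k H (b i) ⊗ₜ[k] a i := by
  have key (t : H ⊗[k] H) : (epsS k H).lTensor H t =
      ∑ i, TensorProduct.rid k H ((ε k H).lTensor H (t * ((1 : H) ⊗ₜ[k] b i))) ⊗ₜ[k] a i := by
    induction t with
    | zero => simp
    | add s t hs ht =>
      simp only [add_mul, map_add, TensorProduct.add_tmul, Finset.sum_add_distrib, hs, ht]
    | tmul x y => simp [epsS_eq_sum h, TensorProduct.tmul_sum, TensorProduct.smul_tmul']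
  rw [key]
  refine Finset.sum_congr rfl fun i _ => ?_
  rw [hR.mul_one_tmul_epsT hreg (hb i), rid_lTensor_counit_mul, hR.lTensor_counit, one_mul]

/-- `ε_t(R¹) ⊗ R² = 1₍₂₎ ⊗ 1₍₁₎`. -/
theorem rTensor_epsT (h : Δ k H 1 = ∑ i, a i ⊗ₜ[k] b i)
    (ha : ∀ i, a i ∈ LinearMap.range (epsS k H)) :
    (epsT k H).rTensor H R = ∑ i, b i ⊗ₜ[k] a i := by
  have key (t : H ⊗[k] H) : (epsT k H).rTensor H t =
      ∑ i, b i ⊗ₜ[k] TensorProduct.lid k H ((ε k H).rTensor H ((a i ⊗ₜ[k] (1 : H)) * t)) := by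
    induction t with
    | zero => simp
    | add s t hs ht =>
      simp only [mul_add, map_add, TensorProduct.tmul_add, Finset.sum_add_distrib, hs, ht]
    | tmul x y => simp [epsT_eq_sum h, TensorProduct.sum_tmul, TensorProduct.smul_tmul]
  rw [key]
  refine Finset.sum_congr rfl fun i _ => ?_
  rw [← hR.mul_one_tmul (ha i), lid_rTensor_counit_mul', hR.rTensor_counit, one_mul]

/-- `R¹r¹ ⊗ S(r²)R² = S(1₍₂₎) ⊗ 1₍₁₎`. -/
theorem sum_tmul_antipode_mul {m : ℕ} {a b : Fin m → H} (hreg : IsRegular k H)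
    (h : Δ k H 1 = ∑ i, a i ⊗ₜ[k] b i)
    (hb : ∀ i, b i ∈ LinearMap.range (epsT k H)) (hcd : R = ∑ i, c i ⊗ₜ[k] d i) :
    ∑ i, ∑ j, (c i * c j) ⊗ₜ[k] (S k H (d j) * d i) = ∑ i, S k H (b i) ⊗ₜ[k] a i := by
  rw [← hR.lTensor_epsS hreg h hb]
  have h1 := congrArg ((LinearMap.mul' k H ∘ₗ (S k H).rTensor H).lTensor H)
    (hR.sum_tmul_comul hcd)
  simp only [map_sum, LinearMap.lTensor_tmul, LinearMap.comp_apply,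
    WeakHopfAlgebra.antipode_mul] at h1
  conv_rhs => rw [hcd]
  simpa using h1.symm

/-- `R¹r¹ ⊗ r²S(R²) = S(1₍₁₎) ⊗ 1₍₂₎`. -/
theorem sum_tmul_mul_antipode {m : ℕ} {a b : Fin m → H} (hreg : IsRegular k H)
    (h : Δ k H 1 = ∑ i, a i ⊗ₜ[k] b i)
    (ha : ∀ i, a i ∈ LinearMap.range (epsS k H)) (hcd : R = ∑ i, c i ⊗ₜ[k] d i) :
    ∑ i, ∑ j, (c i * c j) ⊗ₜ[k] (d j * S k H (d i)) = ∑ i, S k H (a i) ⊗ₜ[k] b i := by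
  rw [← hR.lTensor_epsT hreg h ha]
  have h1 := congrArg ((LinearMap.mul' k H ∘ₗ (S k H).lTensor H).lTensor H)
    (hR.sum_tmul_comul hcd)
  simp only [map_sum, LinearMap.lTensor_tmul, LinearMap.comp_apply,
    WeakHopfAlgebra.mul_antipode] at h1
  conv_rhs => rw [hcd]
  simpa using h1.symm

end IsRMatrix

end RMatrix

/-! ### Actions on `H ⊗ M` -/

section Operators

variable {k : Type u} {H : Type v} [Field k] [Ring H] [Algebra k H]

@[simp]
theorem act₂_tmul (M : Type w) (N : Type w') [AddCommGroup M] [Module k M]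
    [Module H M] [IsScalarTower k H M] [AddCommGroup N] [Module k N] [Module H N]
    [IsScalarTower k H N] (g h : H) (m : M) (n : N) :
    act₂ k H M N (g ⊗ₜ h) (m ⊗ₜ n) = (g • m) ⊗ₜ (h • n) := rfl

theorem act₂_mul_apply (M : Type w) (N : Type w') [AddCommGroup M] [Module k M]
    [Module H M] [IsScalarTower k H M] [AddCommGroup N] [Module k N] [Module H N]
    [IsScalarTower k H N] (s t : H ⊗[k] H) (x : M ⊗[k] N) :
    act₂ k H M N (s * t) x = act₂ k H M N s (act₂ k H M N t x) := by
  rw [map_mul, Module.End.mul_apply]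

variable [WeakHopfAlgebra k H]

theorem mem_tensorT_iff (M : Type w) (N : Type w') [AddCommGroup M] [Module k M]
    [Module H M] [IsScalarTower k H M] [AddCommGroup N] [Module k N] [Module H N]
    [IsScalarTower k H N] (x : M ⊗[k] N) :
    x ∈ tensorT k H M N ↔ act₂ k H M N (Δ k H 1) x = x := by
  refine ⟨?_, fun h => ⟨x, h⟩⟩
  rintro ⟨y, rfl⟩
  rw [← act₂_mul_apply, comul_mul_one]

/-- The action `x ⊗ m ↦ x S(T²) ⊗ T¹ m` of `T` in `H ⊗ H` on `H ⊗ M`. By definition, `coactG R` is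
the coaction followed by the action of `R`. -/
noncomputable def braid (M : HMod.{u, v, w} k H) : H ⊗[k] H →ₗ[k] Module.End k (H ⊗[k] M) :=
  twist (Algebra.lsmul k k M).toLinearMap ∘ₗ (S k H).lTensor H

/-- The action `x ⊗ m ↦ a x S(c) ⊗ b m` of `a ⊗ b ⊗ c` on `H ⊗ M`. -/
noncomputable def conj (M : HMod.{u, v, w} k H) :
    H ⊗[k] (H ⊗[k] H) →ₗ[k] Module.End k (H ⊗[k] M) :=
  TensorProduct.lift ((LinearMap.mul k (Module.End k (H ⊗[k] M))).compl₁₂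
    (LinearMap.rTensorHom M ∘ₗ LinearMap.mul k H) (braid M))

variable (M : HMod.{u, v, w} k H)

@[simp]
theorem braid_tmul (b c x : H) (m : M) :
    braid M (b ⊗ₜ c) (x ⊗ₜ m) = (x * S k H c) ⊗ₜ (b • m) := rfl

theorem conj_tmul_apply (a : H) (t : H ⊗[k] H) (v : H ⊗[k] M) :
    conj M (a ⊗ₜ t) v = (LinearMap.mulLeft k a).rTensor M (braid M t v) := rfl

@[simp]
theorem conj_tmul_tmul (a b c x : H) (m : M) :
    conj M (a ⊗ₜ (b ⊗ₜ c)) (x ⊗ₜ m) = (a * (x * S k H c)) ⊗ₜ (b • m) := rfl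

theorem braid_mul_apply (s t : H ⊗[k] H) (v : H ⊗[k] M) :
    braid M (s * t) v = braid M s (braid M t v) := by
  induction s with
  | zero => simp
  | add s s' hs hs' => simp only [add_mul, map_add, LinearMap.add_apply, hs, hs']
  | tmul a b =>
    induction t with
    | zero => simp
    | add t t' ht ht' => simp only [mul_add, map_add, LinearMap.add_apply, ht, ht']
    | tmul c d =>
      induction v with
      | zero => simp
      | add v v' hv hv' => simp only [map_add, hv, hv']
      | tmul x m => simp [antipode_mul, mul_assoc, mul_smul]

theorem conj_one_tmul (t : H ⊗[k] H) (v : H ⊗[k] M) : conj M (1 ⊗ₜ t) v = braid M t v := by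
  rw [conj_tmul_apply, LinearMap.mulLeft_one, LinearMap.rTensor_id, LinearMap.id_apply]

theorem mulLeft_rTensor_braid (a : H) (t : H ⊗[k] H) (v : H ⊗[k] M) :
    (LinearMap.mulLeft k a).rTensor M (braid M t v) =
      braid M t ((LinearMap.mulLeft k a).rTensor M v) := by
  induction t with
  | zero => simp
  | add s t hs ht => simp only [map_add, LinearMap.add_apply, hs, ht]
  | tmul b c =>
    induction v with
    | zero => simp
    | add v v' hv hv' => simp only [map_add, hv, hv']
    | tmul x m => simp [mul_assoc]

theorem conj_mul_apply (s t : H ⊗[k] (H ⊗[k] H)) (v : H ⊗[k] M) :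
    conj M (s * t) v = conj M s (conj M t v) := by
  induction s with
  | zero => simp
  | add s s' hs hs' => simp only [add_mul, map_add, LinearMap.add_apply, hs, hs']
  | tmul a b =>
    induction t with
    | zero => simp
    | add t t' ht ht' => simp only [mul_add, map_add, LinearMap.add_apply, ht, ht']
    | tmul c d =>
      simp only [Algebra.TensorProduct.tmul_mul_tmul, conj_tmul_apply, LinearMap.mulLeft_mul,
        LinearMap.rTensor_comp, LinearMap.comp_apply, braid_mul_apply, mulLeft_rTensor_braid]

theorem conj_assoc_tmul (t : H ⊗[k] H) (c : H) (v : H ⊗[k] M) :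
    conj M (TensorProduct.assoc k H H H (t ⊗ₜ c)) v =
      (LinearMap.mulRight k (S k H c)).rTensor M (act₂ k H H M t v) := by
  induction t with
  | zero => simp
  | add s t hs ht =>
    simp only [TensorProduct.add_tmul, map_add, LinearMap.add_apply, hs, ht]
  | tmul a b =>
    induction v with
    | zero => simp
    | add v v' hv hv' => simp only [map_add, hv, hv']
    | tmul x m => simp [mul_assoc]

end Operators

/-! ### The compatibility condition of Yetter-Drinfeld modules -/

section YetterDrinfeld

variable {k : Type u} {H : Type v} [Field k] [Ring H] [Algebra k H]

theorem ydMap_mul_one_tmul {M : HMod.{u, v, w} k H} (ρ : M →ₗ[k] H ⊗[k] M) (m : M)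
    (t : H ⊗[k] H) (y : H) : ydMap ρ m (t * (1 ⊗ₜ y)) =
      (LinearMap.mulRight k y).rTensor M (ydMap ρ m t) := by
  induction t with
  | zero => simp
  | add s t hs ht => simp only [add_mul, map_add, hs, ht]
  | tmul a b =>
    rw [Algebra.TensorProduct.tmul_mul_tmul, mul_one, ydMap_tmul, ydMap_tmul,
      LinearMap.mulRight_mul, LinearMap.rTensor_comp, LinearMap.comp_apply]

theorem ydMap_mul_tmul_one {M : HMod.{u, v, w} k H} (ρ : M →ₗ[k] H ⊗[k] M) (m : M)
    (t : H ⊗[k] H) (h : H) : ydMap ρ m (t * (h ⊗ₜ 1)) = ydMap ρ (h • m) t := by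
  induction t with
  | zero => simp
  | add s t hs ht => simp only [add_mul, map_add, hs, ht]
  | tmul a b =>
    rw [Algebra.TensorProduct.tmul_mul_tmul, mul_one, ydMap_tmul, ydMap_tmul, mul_smul]

variable [WeakHopfAlgebra k H]

theorem sum_comul_tmul_coassoc {n : ℕ} {p q : Fin n → H} {x : H}
    (h : Δ k H x = ∑ i, p i ⊗ₜ[k] q i) :
    TensorProduct.assoc k H H H (∑ i, Δ k H (p i) ⊗ₜ[k] q i) = ∑ i, p i ⊗ₜ[k] Δ k H (q i) := by
  have := Coalgebra.coassoc_apply (R := k) x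
  change TensorProduct.assoc k H H H ((Δ k H).rTensor H (Δ k H x)) =
    (Δ k H).lTensor H (Δ k H x) at this
  rw [h] at this
  simpa using this

theorem rTensor_mulRight_antipode_ydMap {M : HMod.{u, v, w} k H} (ρ : M →ₗ[k] H ⊗[k] M) (m : M)
    (t : H ⊗[k] H) (c : H) : (LinearMap.mulRight k (S k H c)).rTensor M (ydMap ρ m t) =
      ydMap ρ m ((LinearMap.mul' k H ∘ₗ (S k H).lTensor H).lTensor H
        (TensorProduct.assoc k H H H (t ⊗ₜ c))) := by
  induction t with
  | zero => simp
  | add s t hs ht => simp only [TensorProduct.add_tmul, map_add, hs, ht]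
  | tmul a b =>
    rw [ydMap_tmul, TensorProduct.assoc_tmul, LinearMap.lTensor_tmul, ydMap_tmul,
      ← LinearMap.comp_apply, ← LinearMap.rTensor_comp]
    simp [LinearMap.mulRight_mul]

namespace IsYetterDrinfeld

variable {M : HMod.{u, v, w} k H} {ρ : M →ₗ[k] H ⊗[k] M} (hρ : IsYetterDrinfeld M ρ)
include hρ

theorem act₂_comul_one (m : M) : act₂ k H H M (Δ k H 1) (ρ m) = ρ m :=
  (mem_tensorT_iff H M _).1 (hρ.coact_mem m)

theorem ydMap_comul_one (m : M) : ydMap ρ m (Δ k H 1) = ρ m := by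
  rw [← hρ.compat, hρ.act₂_comul_one]

/-- `m₍₋₁₎ ⊗ y m₍₀₎ = m₍₋₁₎ y ⊗ m₍₀₎` for `y` in `H_s`. -/
theorem act₂_one_tmul {y : H} (hy : y ∈ LinearMap.range (epsS k H)) (m : M) :
    act₂ k H H M (1 ⊗ₜ y) (ρ m) = (LinearMap.mulRight k y).rTensor M (ρ m) := by
  obtain ⟨x, rfl⟩ := hy
  have h := hρ.compat (epsS k H x) m
  conv_rhs at h => rw [comul_epsS_right, ydMap_mul_one_tmul, hρ.ydMap_comul_one]
  rw [← h, comul_epsS_left, act₂_mul_apply, hρ.act₂_comul_one]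

/-- `y m₍₋₁₎ ⊗ m₍₀₎ = m₍₋₁₎ ⊗ S(y) m₍₀₎` for `y` in `H_s`. -/
theorem act₂_tmul_one (hreg : IsRegular k H) {y : H} (hy : y ∈ LinearMap.range (epsS k H))
    (m : M) : act₂ k H H M (y ⊗ₜ 1) (ρ m) = act₂ k H H M (1 ⊗ₜ S k H y) (ρ m) := by
  rw [← hρ.act₂_comul_one, ← act₂_mul_apply, hreg.tmul_one_mul_comul_one hy, act₂_mul_apply]

/-- `ρ(hm) = h₍₁₎ m₍₋₁₎ S(h₍₃₎) ⊗ h₍₂₎ m₍₀₎`. -/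
theorem coact_smul (h : H) (m : M) :
    ρ (h • m) = conj M ((Δ k H).lTensor H (Δ k H h)) (ρ m) := by
  obtain ⟨n, p, q, hh⟩ := exists_sum_tmul (Δ k H h)
  have h1 : (Δ k H).lTensor H (Δ k H h) =
      TensorProduct.assoc k H H H (∑ i, Δ k H (p i) ⊗ₜ[k] q i) := by
    rw [sum_comul_tmul_coassoc hh, hh]
    simp
  rw [h1, map_sum, map_sum, LinearMap.sum_apply]
  simp only [conj_assoc_tmul, hρ.compat, rTensor_mulRight_antipode_ydMap]
  rw [← map_sum, ← map_sum, ← map_sum, sum_comul_tmul_coassoc hh]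
  have h2 := lTensor_epsT_comul (k := k) h
  rw [hh] at h2
  simp only [map_sum, LinearMap.lTensor_tmul, LinearMap.comp_apply,
    WeakHopfAlgebra.mul_antipode] at h2 ⊢
  rw [← map_sum, h2, ydMap_mul_tmul_one, hρ.ydMap_comul_one]

end IsYetterDrinfeld

/-- A coaction satisfying `ρ(hm) = h₍₁₎ m₍₋₁₎ S(h₍₃₎) ⊗ h₍₂₎ m₍₀₎` and
`m₍₋₁₎ ⊗ y m₍₀₎ = m₍₋₁₎ y ⊗ m₍₀₎` for `y` in `H_s` satisfies the compatibility condition of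
Yetter-Drinfeld modules. -/
theorem act₂_comul_eq_ydMap {M : HMod.{u, v, w} k H} {ρ : M →ₗ[k] H ⊗[k] M}
    (hone : ∀ y ∈ LinearMap.range (epsS k H), ∀ m,
      act₂ k H H M (1 ⊗ₜ y) (ρ m) = (LinearMap.mulRight k y).rTensor M (ρ m))
    (hsmul : ∀ h m, ρ (h • m) = conj M ((Δ k H).lTensor H (Δ k H h)) (ρ m)) (h : H) (m : M) :
    act₂ k H H M (Δ k H h) (ρ m) = ydMap ρ m (Δ k H h) := by
  obtain ⟨n, p, q, hh⟩ := exists_sum_tmul (Δ k H h)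
  obtain ⟨N, a, b, h1, ha, hb⟩ := exists_comul_one_eq_sum (k := k) (H := H)
  -- The action `x ⊗ m ↦ a x c ⊗ b m` of `a ⊗ b ⊗ c`.
  let Φ : H ⊗[k] (H ⊗[k] H) →ₗ[k] H ⊗[k] M := TensorProduct.lift
    (((LinearMap.mul k (Module.End k (H ⊗[k] M))).compl₁₂ (LinearMap.rTensorHom M ∘ₗ
      LinearMap.mul k H) (twist (Algebra.lsmul k k M).toLinearMap)).compr₂
      (LinearMap.applyₗ (ρ m)))
  have hΦ (x c : H) (t : H ⊗[k] H) : (LinearMap.mulRight k c).rTensor M (conj M (x ⊗ₜ t) (ρ m)) =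
      Φ (x ⊗ₜ (LinearMap.mul' k H ∘ₗ (S k H).rTensor H).lTensor H
        (TensorProduct.assoc k H H H (t ⊗ₜ c))) := by
    induction t with
    | zero => simp
    | add s t hs ht =>
      simp only [TensorProduct.add_tmul, TensorProduct.tmul_add, map_add, LinearMap.add_apply,
        hs, ht]
    | tmul r s =>
      change (LinearMap.mulRight k c).rTensor M ((LinearMap.mulLeft k x).rTensor M
        (twist _ (r ⊗ₜ S k H s) (ρ m))) = (LinearMap.mulLeft k x).rTensor M
          (twist _ (r ⊗ₜ (S k H s * c)) (ρ m))
      induction ρ m with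
      | zero => simp
      | add v v' hv hv' => simp only [map_add, hv, hv']
      | tmul y m => simp [twist_tmul, mul_assoc]
  -- Both sides are `Φ (h₍₁₎ ⊗ h₍₂₎ ⊗ ε_s(h₍₃₎))`.
  have h2 : ydMap ρ m (Δ k H h) = Φ (((epsS k H).lTensor H ∘ₗ Δ k H).lTensor H (Δ k H h)) := by
    have h3 (x c : H) (t : H ⊗[k] H) :
        (LinearMap.mulRight k c).rTensor M (conj M ((Δ k H).lTensor H t) (ρ m)) =
        Φ (((LinearMap.mul' k H ∘ₗ (S k H).rTensor H).lTensor H ∘ₗ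
          (TensorProduct.assoc k H H H).toLinearMap ∘ₗ (Δ k H).rTensor H).lTensor H
          (TensorProduct.assoc k H H H (t ⊗ₜ c))) := by
      induction t with
      | zero => simp
      | add s t hs ht =>
        simp only [TensorProduct.add_tmul, map_add, LinearMap.add_apply, hs, ht]
      | tmul x t => rw [LinearMap.lTensor_tmul, hΦ]; rfl
    have h4 (y : H) : (LinearMap.mul' k H ∘ₗ (S k H).rTensor H).lTensor H
        (TensorProduct.assoc k H H H ((Δ k H).rTensor H (Δ k H y))) =
        (epsS k H).lTensor H (Δ k H y) := by
      have h5 := Coalgebra.coassoc_apply (R := k) y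
      change TensorProduct.assoc k H H H ((Δ k H).rTensor H (Δ k H y)) =
        (Δ k H).lTensor H (Δ k H y) at h5
      rw [h5, ← LinearMap.comp_apply, ← LinearMap.lTensor_comp]
      congr 2
      ext y
      exact WeakHopfAlgebra.antipode_mul y
    rw [hh, map_sum]
    simp only [ydMap_tmul, hsmul, h3 1]
    rw [← map_sum, ← map_sum, ← map_sum, sum_comul_tmul_coassoc hh]
    simp only [map_sum, LinearMap.lTensor_tmul, LinearMap.comp_apply, LinearEquiv.coe_coe, h4]
  rw [h2, hh]
  simp only [map_sum, LinearMap.lTensor_tmul, LinearMap.comp_apply, LinearMap.sum_apply,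
    lTensor_epsS_comul (q _)]
  refine Finset.sum_congr rfl fun i _ => ?_
  have h6 (y z c d : H) : Φ (y ⊗ₜ ((z ⊗ₜ 1) * (c ⊗ₜ d))) = act₂ k H H M (y ⊗ₜ z)
      ((LinearMap.mulRight k d).rTensor M (act₂ k H H M (1 ⊗ₜ c) (ρ m))) := by
    rw [Algebra.TensorProduct.tmul_mul_tmul]
    change (LinearMap.mulLeft k y).rTensor M (twist _ ((z * c) ⊗ₜ (1 * d)) (ρ m)) = _
    induction ρ m with
    | zero => simp
    | add v v' hv hv' => simp only [map_add, hv, hv']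
    | tmul y m => simp [twist_tmul]
  have h7 : ρ m = ∑ j, (LinearMap.mulRight k (S k H (b j))).rTensor M
      (act₂ k H H M (1 ⊗ₜ a j) (ρ m)) := by
    simp only [hone _ (ha _)]
    induction ρ m with
    | zero => simp
    | add v v' hv hv' => simp only [map_add, Finset.sum_add_distrib, ← hv, ← hv']
    | tmul y m =>
      simp [mul_assoc, ← TensorProduct.sum_tmul, ← Finset.mul_sum, sum_mul_antipode_one h1]
  have hb' j : epsS k H (b j) = S k H (b j) := by
    obtain ⟨x, hx⟩ := hb j
    rw [← hx, antipode_epsT]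
  conv_lhs => rw [h7]
  rw [h1]
  simp only [map_sum, LinearMap.lTensor_tmul, Finset.mul_sum, TensorProduct.tmul_sum, h6, hb']

end YetterDrinfeld

/-! ### The centralizer of `H_s` as a Yetter-Drinfeld module -/

section Centralizer

variable {k : Type u} {H : Type v} [Field k] [Ring H] [Algebra k H] [WeakHopfAlgebra k H]

theorem mem_B_iff {x : H} :
    x ∈ B k H ↔ ∀ y ∈ LinearMap.range (epsS k H), y * x = x * y := by
  change x ∈ Subalgebra.centralizer k (LinearMap.range (epsS k H) : Set H) ↔ _
  rw [Subalgebra.mem_centralizer_iff]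
  rfl

/-- A tensor lies in `B ⊗ M` as soon as its first leg commutes with `H_s`. -/
theorem mem_range_rTensor_ιB {M : Type*} [AddCommGroup M] [Module k M] {v : H ⊗[k] M}
    (hv : ∀ y ∈ LinearMap.range (epsS k H),
      (LinearMap.mulLeft k y).rTensor M v = (LinearMap.mulRight k y).rTensor M v) :
    v ∈ LinearMap.range ((ιB k H).rTensor M) := by
  classical
  let 𝒞 := Module.Basis.ofVectorSpace k M
  let e := TensorProduct.equivFinsuppOfBasisRight (M := H) 𝒞
  have he (f : H →ₗ[k] H) (t : H ⊗[k] M) i : e (f.rTensor M t) i = f (e t i) := by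
    induction t with
    | zero => simp
    | add s t hs ht => simp only [map_add, Finsupp.add_apply, hs, ht]
    | tmul x m => simp [e]
  have hmem i : e v i ∈ B k H := by
    rw [mem_B_iff]
    intro y hy
    simpa [he] using congrArg (fun t => e t i) (hv y hy)
  have hsum : v = ∑ i ∈ (e v).support, e v i ⊗ₜ[k] 𝒞 i := by
    conv_lhs => rw [← e.symm_apply_apply v]
    rw [TensorProduct.equivFinsuppOfBasisRight_symm_apply]
    rfl
  rw [hsum]
  exact Submodule.sum_mem _ fun i _ => ⟨(⟨e v i, hmem i⟩ : B k H) ⊗ₜ 𝒞 i, rfl⟩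

theorem mem_range_lTensor_ιB {v : H ⊗[k] H}
    (hv : ∀ y ∈ LinearMap.range (epsS k H), (1 ⊗ₜ y) * v = v * (1 ⊗ₜ y)) :
    v ∈ LinearMap.range ((ιB k H).lTensor H) := by
  have h1 (y : H) (t : H ⊗[k] H) :
      (LinearMap.mulLeft k y).rTensor H (TensorProduct.comm k H H t) =
        TensorProduct.comm k H H ((1 ⊗ₜ y) * t) := by
    induction t with
    | zero => simp
    | add s t hs ht => simp only [map_add, mul_add, hs, ht]
    | tmul x m => simp
  have h2 (y : H) (t : H ⊗[k] H) :
      (LinearMap.mulRight k y).rTensor H (TensorProduct.comm k H H t) =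
        TensorProduct.comm k H H (t * (1 ⊗ₜ y)) := by
    induction t with
    | zero => simp
    | add s t hs ht => simp only [map_add, add_mul, hs, ht]
    | tmul x m => simp
  obtain ⟨u, hu⟩ := mem_range_rTensor_ιB (v := TensorProduct.comm k H H v) fun y hy => by
    rw [h1, h2, hv y hy]
  refine ⟨TensorProduct.comm k _ _ u, ?_⟩
  have h3 (u : B k H ⊗[k] H) : TensorProduct.comm k H H ((ιB k H).lTensor H
      (TensorProduct.comm k _ _ u)) = (ιB k H).rTensor H u := by
    induction u with
    | zero => simp
    | add s t hs ht => simp only [map_add, hs, ht]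
    | tmul x m => simp
  apply (TensorProduct.comm k H H).injective
  rw [← hu, h3]

/-- `Δ(x)` lies in `H ⊗ B` for `x` in `B`. -/
theorem comul_mem_range_lTensor {x : H} (hx : x ∈ B k H) :
    Δ k H x ∈ LinearMap.range ((ιB k H).lTensor H) := by
  apply mem_range_lTensor_ιB
  rintro _ ⟨y, rfl⟩
  rw [← comul_one_mul, ← mul_assoc, ← comul_epsS_left, ← comul_mul, mem_B_iff.1 hx _ ⟨y, rfl⟩,
    comul_mul, comul_epsS_right, ← mul_assoc, comul_mul_one, comul_one_mul]

/-- The action `x ↦ a x S(b)` of `a ⊗ b` on `H`. -/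
noncomputable def adT (k : Type u) (H : Type v) [Field k] [Ring H] [Algebra k H]
    [WeakHopfAlgebra k H] : H ⊗[k] H →ₗ[k] Module.End k H :=
  TensorProduct.lift ((LinearMap.mul k (Module.End k H)).compl₁₂ (LinearMap.mul k H)
    ((LinearMap.mul k H).flip ∘ₗ S k H))

theorem ad_apply (h x : H) : ad k H h x = adT k H (Δ k H h) x := rfl

@[simp]
theorem adT_tmul (a b x : H) : adT k H (a ⊗ₜ b) x = a * (x * S k H b) := rfl

theorem adT_mul_apply (s t : H ⊗[k] H) (x : H) :
    adT k H (s * t) x = adT k H s (adT k H t x) := by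
  induction s with
  | zero => simp
  | add s s' hs hs' => simp only [add_mul, map_add, LinearMap.add_apply, hs, hs']
  | tmul a b =>
    induction t with
    | zero => simp
    | add t t' ht ht' => simp only [mul_add, map_add, LinearMap.add_apply, ht, ht']
    | tmul c d => simp [antipode_mul, mul_assoc]

theorem adT_comul_one {x : H} (hx : x ∈ B k H) : adT k H (Δ k H 1) x = x := by
  obtain ⟨n, a, b, h, ha, -⟩ := exists_comul_one_eq_sum (k := k) (H := H)
  rw [h, map_sum, LinearMap.sum_apply]
  simp only [adT_tmul, ← mul_assoc, mem_B_iff.1 hx _ (ha _)]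
  simp only [mul_assoc, ← Finset.mul_sum, sum_mul_antipode_one h, mul_one]

/-- `y · b = b S(y)` for `y` in `H_s` and `b` in `B`. -/
theorem ad_of_mem_epsS {y x : H} (hy : y ∈ LinearMap.range (epsS k H)) (hx : x ∈ B k H) :
    ad k H y x = x * S k H y := by
  obtain ⟨w, rfl⟩ := hy
  rw [ad_apply, comul_epsS_left, adT_mul_apply, adT_comul_one hx]
  simp

/-- `z · b = z b` for `z` in `H_t` and `b` in `B`. -/
theorem ad_of_mem_epsT {z x : H} (hz : z ∈ LinearMap.range (epsT k H)) (hx : x ∈ B k H) :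
    ad k H z x = z * x := by
  obtain ⟨w, rfl⟩ := hz
  rw [ad_apply, comul_epsT_left, adT_mul_apply, adT_comul_one hx]
  simp [antipode_one]

/-- The adjoint action takes values in `B`, since
`y h₍₁₎ ⊗ h₍₂₎ = h₍₁₎ ⊗ S(y) h₍₂₎` for `y` in `H_s`. -/
theorem IsRegular.ad_mem (hreg : IsRegular k H) (h x : H) : ad k H h x ∈ B k H := by
  rw [mem_B_iff]
  intro y hy
  have h1 : y * ad k H h x = adT k H ((y ⊗ₜ 1) * Δ k H h) x := by
    rw [adT_mul_apply, adT_tmul, antipode_one, mul_one, ad_apply]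
  rw [h1, ← comul_one_mul, ← mul_assoc, hreg.tmul_one_mul_comul_one hy, mul_assoc, comul_one_mul,
    adT_mul_apply, adT_tmul, hreg.antipode_antipode_of_mem_epsS hy, one_mul, ad_apply]

theorem IsRegular.adActsOnB (hreg : IsRegular k H) : AdActsOnB k H where
  mem h b _ := hreg.ad_mem h b
  one _ hb := adT_comul_one hb
  mul g h b _ := by simp only [ad_apply, comul_mul, adT_mul_apply]

variable [Module.Finite k H] (hA : AdActsOnB k H)

/-- The inclusion of `B` in `H`, with the object `objB hA` of `C` as its source, so that the
`H`-module structure of `B` is available there. -/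
noncomputable def inclB : objB hA →ₗ[k] H := ιB k H

theorem inclB_injective : Function.Injective (inclB hA) := Submodule.injective_subtype _

theorem inclB_mem (b : objB hA) : inclB hA b ∈ B k H := b.2

@[simp]
theorem inclB_smul (h : H) (b : objB hA) : inclB hA (h • b) = ad k H h (inclB hA b) := rfl

theorem lTensor_inclB_injective (V : Type*) [AddCommGroup V] [Module k V] :
    Function.Injective ((inclB hA).lTensor V) :=
  Module.Flat.lTensor_preserves_injective_linearMap _ (inclB_injective hA)

theorem rTensor_inclB_injective (V : Type*) [AddCommGroup V] [Module k V] :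
    Function.Injective ((inclB hA).rTensor V) :=
  Module.Flat.rTensor_preserves_injective_linearMap _ (inclB_injective hA)

/-- The comultiplication of `H`, restricted to a map `B → H ⊗ B`. -/
noncomputable def coactB : objB hA →ₗ[k] H ⊗[k] objB hA :=
  liftThrough ((inclB hA).lTensor H) (lTensor_inclB_injective hA H)
    (Δ k H ∘ₗ inclB hA) fun b => comul_mem_range_lTensor (inclB_mem hA b)

theorem lTensor_coactB (b : objB hA) :
    (inclB hA).lTensor H (coactB hA b) = Δ k H (inclB hA b) :=
  apply_liftThrough ((inclB hA).lTensor H) (lTensor_inclB_injective hA H)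
    (Δ k H ∘ₗ inclB hA) (fun b => comul_mem_range_lTensor (inclB_mem hA b)) b

/-- `(B, ad, Δ)` is a Yetter-Drinfeld module. -/
theorem IsRegular.isYetterDrinfeld_objB (hreg : IsRegular k H) :
    IsYetterDrinfeld (objB hA) (coactB hA) := by
  have hmem (b : objB hA) : act₂ k H H (objB hA) (Δ k H 1) (coactB hA b) = coactB hA b := by
    obtain ⟨n, a, b', h, -, hb⟩ := exists_comul_one_eq_sum (k := k) (H := H)
    have h1 (v : H ⊗[k] objB hA) (i) :
        (inclB hA).lTensor H (act₂ k H H (objB hA) (a i ⊗ₜ b' i) v) =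
        (a i ⊗ₜ b' i) * (inclB hA).lTensor H v := by
      induction v with
      | zero => simp
      | add v v' hv hv' => simp only [map_add, mul_add, hv, hv']
      | tmul x c =>
        rw [act₂_tmul, LinearMap.lTensor_tmul, LinearMap.lTensor_tmul, inclB_smul,
          ad_of_mem_epsT (hb i) (inclB_mem hA c), Algebra.TensorProduct.tmul_mul_tmul]
        rfl
    apply lTensor_inclB_injective hA H
    rw [h, map_sum, LinearMap.sum_apply, map_sum]
    simp only [h1]
    rw [← Finset.sum_mul, ← h, lTensor_coactB, comul_one_mul]
  have hone (y : H) (hy : y ∈ LinearMap.range (epsS k H)) (b : objB hA) :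
      act₂ k H H (objB hA) (1 ⊗ₜ y) (coactB hA b) =
        (LinearMap.mulRight k y).rTensor (objB hA) (coactB hA b) := by
    have h1 (v : H ⊗[k] objB hA) : (inclB hA).lTensor H (act₂ k H H (objB hA) (1 ⊗ₜ y) v) =
        (inclB hA).lTensor H v * (1 ⊗ₜ S k H y) := by
      induction v with
      | zero => simp
      | add v v' hv hv' => simp only [map_add, add_mul, hv, hv']
      | tmul x c =>
        rw [act₂_tmul, LinearMap.lTensor_tmul, LinearMap.lTensor_tmul, inclB_smul,
          ad_of_mem_epsS hy (inclB_mem hA c), Algebra.TensorProduct.tmul_mul_tmul,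
          one_smul, mul_one]
    have h2 (v : H ⊗[k] objB hA) :
        (inclB hA).lTensor H ((LinearMap.mulRight k y).rTensor (objB hA) v) =
        (inclB hA).lTensor H v * (y ⊗ₜ 1) := by
      induction v with
      | zero => simp
      | add v v' hv hv' => simp only [map_add, add_mul, hv, hv']
      | tmul x c => simp
    apply lTensor_inclB_injective hA H
    rw [h1, h2, lTensor_coactB, ← comul_mul_one, mul_assoc, mul_assoc,
      hreg.comul_one_mul_tmul_one hy]
  have hsmul (h : H) (b : objB hA) :
      coactB hA (h • b) = conj (objB hA) ((Δ k H).lTensor H (Δ k H h)) (coactB hA b) := by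
    obtain ⟨n, p, q, hh⟩ := exists_sum_tmul (Δ k H h)
    apply lTensor_inclB_injective hA H
    rw [lTensor_coactB, inclB_smul]
    obtain ⟨m, x, c, hv⟩ := exists_sum_tmul (coactB hA b)
    -- `L x c` is `p ⊗ (r ⊗ r') ⊗ s ↦ p x S(s) ⊗ r c S(r')`.
    let L (x c : H) : H ⊗[k] ((H ⊗[k] H) ⊗[k] H) →ₗ[k] H ⊗[k] H :=
      TensorProduct.map ((adT k H).flip x) ((adT k H).flip c) ∘ₗ
        (TensorProduct.assoc k H H (H ⊗[k] H)).symm.toLinearMap ∘ₗ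
          (TensorProduct.comm k (H ⊗[k] H) H).toLinearMap.lTensor H
    have h1 (s t : H ⊗[k] H) (x c : H) : s * (x ⊗ₜ c) * flipAntipode k H t =
        L x c ((TensorProduct.assoc k H H H).symm.toLinearMap.lTensor H
          (TensorProduct.assoc k H H (H ⊗[k] H) (s ⊗ₜ t))) := by
      induction s with
      | zero => simp
      | add s s' hs hs' => simp only [add_mul, TensorProduct.add_tmul, map_add, hs, hs']
      | tmul p p' =>
        induction t with
        | zero => simp
        | add t t' ht ht' => simp only [mul_add, TensorProduct.tmul_add, map_add, ht, ht']
        | tmul q q' => simp [L, mul_assoc]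
    have h2 (y : H) (t : H ⊗[k] H) (x : H) (c : objB hA) :
        (inclB hA).lTensor H (conj (objB hA) (y ⊗ₜ t) (x ⊗ₜ c)) =
          L x (inclB hA c) (y ⊗ₜ (Δ k H).rTensor H t) := by
      induction t with
      | zero => simp
      | add t t' ht ht' =>
        simp only [TensorProduct.tmul_add, map_add, LinearMap.add_apply, ht, ht']
      | tmul r s => rfl
    have h3 : ∑ i, (TensorProduct.assoc k H H H).symm.toLinearMap.lTensor H
          (TensorProduct.assoc k H H (H ⊗[k] H) (Δ k H (p i) ⊗ₜ Δ k H (q i))) =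
        ∑ i, p i ⊗ₜ (Δ k H).rTensor H (Δ k H (q i)) := by
      have h4 (t : H ⊗[k] H) (y : H) :
          TensorProduct.assoc k H H (H ⊗[k] H) (t ⊗ₜ Δ k H y) =
          ((Δ k H).lTensor H).lTensor H (TensorProduct.assoc k H H H (t ⊗ₜ y)) := by
        induction t with
        | zero => simp
        | add t t' ht ht' => simp only [TensorProduct.add_tmul, map_add, ht, ht']
        | tmul r s => simp
      simp only [h4]
      rw [← map_sum, ← map_sum, ← map_sum, sum_comul_tmul_coassoc hh]
      simp only [map_sum, LinearMap.lTensor_tmul]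
      refine Finset.sum_congr rfl fun i _ => ?_
      congr 1
      exact Coalgebra.coassoc_symm_apply (q i)
    have h5 : Δ k H (inclB hA b) = ∑ j, x j ⊗ₜ inclB hA (c j) := by
      simp [← lTensor_coactB, hv]
    have h6 : Δ k H (ad k H h (inclB hA b)) =
        ∑ i, Δ k H (p i) * Δ k H (inclB hA b) * flipAntipode k H (Δ k H (q i)) := by
      rw [ad_apply, hh, map_sum, LinearMap.sum_apply, map_sum]
      simp only [adT_tmul, comul_mul, comul_antipode, mul_assoc]
    rw [h6, h5, hh, hv]
    simp only [map_sum, LinearMap.sum_apply, LinearMap.lTensor_tmul, h2, Finset.mul_sum,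
      Finset.sum_mul, h1]
    rw [Finset.sum_comm]
    simp only [← map_sum, h3]
  refine ⟨fun b => ?_, fun b => ?_, fun b => (mem_tensorT_iff _ _ _).2 (hmem b),
    act₂_comul_eq_ydMap hone hsmul⟩
  · apply Module.Flat.lTensor_preserves_injective_linearMap (M := H) _
      (lTensor_inclB_injective hA H)
    have h1 (v : H ⊗[k] objB hA) : ((inclB hA).lTensor H).lTensor H
        (TensorProduct.assoc k H H (objB hA) ((Δ k H).rTensor (objB hA) v)) =
        TensorProduct.assoc k H H H ((Δ k H).rTensor H ((inclB hA).lTensor H v)) := by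
      induction v with
      | zero => simp
      | add v v' hv hv' => simp only [map_add, hv, hv']
      | tmul x c =>
        simp only [LinearMap.rTensor_tmul, LinearMap.lTensor_tmul]
        induction Δ k H x with
        | zero => simp
        | add v v' hv hv' => simp only [map_add, TensorProduct.add_tmul, hv, hv']
        | tmul y z => rfl
    have h2 : (inclB hA).lTensor H ∘ₗ coactB hA = Δ k H ∘ₗ inclB hA :=
      LinearMap.ext (lTensor_coactB hA)
    refine (h1 _).trans ?_
    rw [lTensor_coactB, ← LinearMap.comp_apply (((inclB hA).lTensor H).lTensor H),
      ← LinearMap.lTensor_comp]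
    rw [h2, LinearMap.lTensor_comp, LinearMap.comp_apply, lTensor_coactB]
    exact Coalgebra.coassoc_apply _
  · apply inclB_injective hA
    rw [← lid_counit_comul (k := k) (inclB hA b), ← lTensor_coactB]
    induction coactB hA b with
    | zero => simp
    | add v v' hv hv' => simp only [map_add, hv, hv']
    | tmul x c => simp

end Centralizer

/-! ### The transmuted coaction -/

section TransmutedCoaction

variable {k : Type u} {H : Type v} [Field k] [Ring H] [Algebra k H] [WeakHopfAlgebra k H]

/-- Applying `R` interchanges the last two legs of an iterated comultiplication. -/
theorem conj_lTensor_comul {R : H ⊗[k] H} (hR : IsRMatrix R) (M : HMod.{u, v, w} k H)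
    (t : H ⊗[k] H) (v : H ⊗[k] M) : braid M R (conj M ((Δ k H).lTensor H t) v) =
      conj M ((Δop k H).lTensor H t) (braid M R v) := by
  induction t with
  | zero => simp
  | add s t hs ht => simp only [map_add, LinearMap.add_apply, hs, ht]
  | tmul a c =>
    rw [LinearMap.lTensor_tmul, LinearMap.lTensor_tmul, conj_tmul_apply, conj_tmul_apply,
      ← mulLeft_rTensor_braid, ← braid_mul_apply, ← braid_mul_apply, hR.mul_comul]

/-- The action `x ⊗ y ⊗ m ↦ x S(d) ⊗ a y S(c) ⊗ b m` of `d ⊗ a ⊗ b ⊗ c` on `H ⊗ H ⊗ M`. -/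
noncomputable def conj₂ (M : HMod.{u, v, w} k H) :
    H ⊗[k] (H ⊗[k] (H ⊗[k] H)) →ₗ[k] Module.End k (H ⊗[k] (H ⊗[k] M)) :=
  TensorProduct.lift ((TensorProduct.mapBilinear (RingHom.id k) H (H ⊗[k] M) H (H ⊗[k] M)).compl₁₂
    ((LinearMap.mul k H).flip ∘ₗ S k H) (conj M))

variable (M : HMod.{u, v, w} k H)

@[simp]
theorem conj₂_tmul (d x : H) (t : H ⊗[k] (H ⊗[k] H)) (v : H ⊗[k] M) :
    conj₂ M (d ⊗ₜ t) (x ⊗ₜ v) = (x * S k H d) ⊗ₜ conj M t v := rfl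

-- The ring structure of the fourfold tensor power of `H` is deeply nested.
set_option maxSynthPendingDepth 10 in
theorem conj₂_mul_apply (s t : H ⊗[k] (H ⊗[k] (H ⊗[k] H))) (v : H ⊗[k] (H ⊗[k] M)) :
    conj₂ M (s * t) v = conj₂ M s (conj₂ M t v) := by
  induction s with
  | zero => simp
  | add s s' hs hs' => simp only [add_mul, map_add, LinearMap.add_apply, hs, hs']
  | tmul a b =>
    induction t with
    | zero => simp
    | add t t' ht ht' => simp only [mul_add, map_add, LinearMap.add_apply, ht, ht']
    | tmul c d =>
      induction v with
      | zero => simp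
      | add v v' hv hv' => simp only [map_add, hv, hv']
      | tmul x m => simp [antipode_mul, mul_assoc, conj_mul_apply]

set_option maxSynthPendingDepth 10 in
/-- `r²R²₍₂₎ ⊗ r¹₍₁₎ ⊗ R¹ ⊗ r¹₍₂₎R²₍₁₎ = (R² ⊗ R¹₍₁₎ ⊗ R¹₍₃₎ ⊗ R¹₍₂₎)(1 ⊗ 1 ⊗ r¹ ⊗ r²)`. -/
theorem IsRMatrix.sum_coassoc {R : H ⊗[k] H} (hR : IsRMatrix R) {n : ℕ} {c d : Fin n → H}
    (h : R = ∑ i, c i ⊗ₜ[k] d i) :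
    ∑ i, ∑ j, (d j ⊗ₜ[k] (TensorProduct.mk k H H 1).lTensor H (Δ k H (c j))) *
      (TensorProduct.mk k H (H ⊗[k] H) 1).lTensor H (TensorProduct.comm k (H ⊗[k] H) H
        ((TensorProduct.assoc k H H H).symm (c i ⊗ₜ Δ k H (d i)))) =
    ∑ i, (d i ⊗ₜ[k] (Δop k H).lTensor H (Δ k H (c i))) *
      ((1 : H) ⊗ₜ[k] ((1 : H) ⊗ₜ[k] R)) := by
  have h1 := congrArg ((TensorProduct.mk k H (H ⊗[k] H) 1).lTensor H ∘ₗ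
    (TensorProduct.comm k (H ⊗[k] H) H).toLinearMap ∘ₗ
      (TensorProduct.assoc k H H H).symm.toLinearMap) (hR.sum_tmul_comul h)
  have h2 : ∑ i, ∑ j, d i ⊗ₜ[k] ((1 : H) ⊗ₜ[k] ((c i * c j) ⊗ₜ[k] d j)) =
      ∑ i, (d i ⊗ₜ[k] ((1 : H) ⊗ₜ[k] (c i ⊗ₜ[k] (1 : H)))) *
        ((1 : H) ⊗ₜ[k] ((1 : H) ⊗ₜ[k] R)) := by
    simp [h, TensorProduct.tmul_sum, Finset.mul_sum]
  simp only [map_sum, LinearMap.comp_apply, LinearEquiv.coe_coe] at h1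
  have h3 := congrArg (((TensorProduct.comm k H H).toLinearMap.lTensor H ∘ₗ
    (TensorProduct.assoc k H H H).toLinearMap ∘ₗ (Δ k H).rTensor H).lTensor H ∘ₗ
      (TensorProduct.comm k (H ⊗[k] H) H).toLinearMap) (hR.sum_comul_tmul h)
  simp only [map_sum, LinearMap.comp_apply, LinearEquiv.coe_coe, TensorProduct.comm_tmul,
    LinearMap.lTensor_tmul, LinearMap.rTensor_tmul] at h3
  have h4 (f : H ⊗[k] H) (y : H) : (TensorProduct.comm k H H).toLinearMap.lTensor H
      (TensorProduct.assoc k H H H (f ⊗ₜ y)) =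
      (TensorProduct.mk k H H 1).lTensor H f * ((1 : H) ⊗ₜ[k] (y ⊗ₜ[k] (1 : H))) := by
    induction f with
    | zero => simp
    | add f f' hf hf' => simp only [TensorProduct.add_tmul, map_add, add_mul, hf, hf']
    | tmul r s => simp
  have h5 (y : H) : (TensorProduct.comm k H H).toLinearMap.lTensor H
      (TensorProduct.assoc k H H H ((Δ k H).rTensor H (Δ k H y))) =
      (Δop k H).lTensor H (Δ k H y) := by
    refine (congrArg _ (Coalgebra.coassoc_apply (R := k) y)).trans ?_
    rw [Δop, LinearMap.lTensor_comp]
    rfl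
  simp only [h4, h5] at h3
  rw [Finset.sum_comm]
  simp only [← Finset.mul_sum, h1, ← Finset.sum_mul, h3]
  have h6 : ∑ i, ∑ j, (TensorProduct.mk k H (H ⊗[k] H) 1).lTensor H
      (TensorProduct.comm k (H ⊗[k] H) H
        ((TensorProduct.assoc k H H H).symm ((c i * c j) ⊗ₜ (d j ⊗ₜ d i)))) =
      ∑ i, (d i ⊗ₜ[k] ((1 : H) ⊗ₜ[k] (c i ⊗ₜ[k] (1 : H)))) *
        ((1 : H) ⊗ₜ[k] ((1 : H) ⊗ₜ[k] R)) := by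
    rw [← h2]
    simp
  rw [h6, ← Finset.sum_mul, ← mul_assoc, Finset.sum_mul_sum]
  simp only [Algebra.TensorProduct.tmul_mul_tmul]

set_option maxSynthPendingDepth 10 in
/-- Applying the comultiplication of `B` to the first leg of the transmuted coaction. -/
theorem assoc_rTensor_comulR_braid {R : H ⊗[k] H} {n : ℕ} {c d : Fin n → H}
    (h : R = ∑ i, c i ⊗ₜ[k] d i) (a b : H) (v : H ⊗[k] M) :
    TensorProduct.assoc k H H M ((comulR R).rTensor M (braid M (a ⊗ₜ b) v)) =
      conj₂ M (∑ j, (d j ⊗ₜ[k] (TensorProduct.mk k H H 1).lTensor H (Δ k H (c j))) *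
        (TensorProduct.mk k H (H ⊗[k] H) 1).lTensor H (TensorProduct.comm k (H ⊗[k] H) H
          ((TensorProduct.assoc k H H H).symm (a ⊗ₜ Δ k H b))))
        (TensorProduct.assoc k H H M ((Δ k H).rTensor M v)) := by
  have key (e f t : H ⊗[k] H) (z : H) (m : M) : TensorProduct.assoc k H H M
      (TensorProduct.map (LinearMap.mulRight k (S k H z)) (adT k H f) (t * flipAntipode k H e) ⊗ₜ
        (a • m)) = conj₂ M ((z ⊗ₜ[k] (TensorProduct.mk k H H 1).lTensor H f) *
        (TensorProduct.mk k H (H ⊗[k] H) 1).lTensor H (TensorProduct.comm k (H ⊗[k] H) H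
          ((TensorProduct.assoc k H H H).symm (a ⊗ₜ e))))
        (TensorProduct.assoc k H H M (t ⊗ₜ m)) := by
    induction f with
    | zero => simp
    | add f f' hf hf' =>
      simp only [map_add, add_mul, TensorProduct.map_add_right, TensorProduct.tmul_add,
        TensorProduct.add_tmul, LinearMap.add_apply, hf, hf']
    | tmul r s =>
      induction e with
      | zero => simp
      | add f f' hf hf' =>
        simp only [map_add, mul_add, TensorProduct.tmul_add, TensorProduct.add_tmul,
          LinearMap.add_apply, hf, hf']
      | tmul e e' =>
        induction t with
        | zero => simp
        | add t t' ht ht' => simp only [add_mul, TensorProduct.add_tmul, map_add, ht, ht']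
        | tmul x y => simp [antipode_mul, mul_assoc]
  induction v with
  | zero => simp
  | add v v' hv hv' => simp only [map_add, hv, hv']
  | tmul x m =>
    have h1 : comulR R (x * S k H b) = ∑ j, TensorProduct.map
        (LinearMap.mulRight k (S k H (d j))) (adT k H (Δ k H (c j)))
          (Δ k H x * flipAntipode k H (Δ k H b)) := by
      rw [← comul_antipode, ← comul_mul, comulR, LinearMap.comp_apply, h]
      simp only [map_sum, LinearMap.lTensor_tmul, LinearMap.sum_apply]
      rfl
    rw [braid_tmul, LinearMap.rTensor_tmul, h1, TensorProduct.sum_tmul, map_sum, map_sum,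
      LinearMap.sum_apply]
    simp only [key, LinearMap.rTensor_tmul]

namespace IsYetterDrinfeld

variable {M} {ρ : M →ₗ[k] H ⊗[k] M} (hρ : IsYetterDrinfeld M ρ) {R : H ⊗[k] H}
  (hR : IsRMatrix R)
include hρ hR

/-- The transmuted coaction takes values in `B ⊗ M`: for `y` in `H_s`, left multiplication by `y`
on `ρ(m)` is the action of `S(y) ⊗ 1` by `braid`, and `R(S(y) ⊗ 1) = (1 ⊗ S(y))R`. -/
theorem braid_mem_range (hreg : IsRegular k H) (m : M) :
    braid M R (ρ m) ∈ LinearMap.range ((ιB k H).rTensor M) := by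
  apply mem_range_rTensor_ιB
  intro y hy
  have h1 : (LinearMap.mulLeft k y).rTensor M (ρ m) = braid M (S k H y ⊗ₜ 1) (ρ m) := by
    have h2 := hρ.act₂_tmul_one hreg hy m
    have h3 (v : H ⊗[k] M) :
        act₂ k H H M (y ⊗ₜ 1) v = (LinearMap.mulLeft k y).rTensor M v := by
      induction v with
      | zero => simp
      | add v v' hv hv' => simp only [map_add, hv, hv']
      | tmul x m => simp
    have h4 (z : H) (v : H ⊗[k] M) : act₂ k H H M (1 ⊗ₜ z) v = braid M (z ⊗ₜ 1) v := by
      induction v with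
      | zero => simp
      | add v v' hv hv' => simp only [map_add, hv, hv']
      | tmul x m => simp [antipode_one]
    rw [← h3, h2, h4]
  have h5 (v : H ⊗[k] M) :
      braid M (1 ⊗ₜ S k H y) v = (LinearMap.mulRight k y).rTensor M v := by
    induction v with
    | zero => simp
    | add v v' hv hv' => simp only [map_add, hv, hv']
    | tmul x m => simp [hreg.antipode_antipode_of_mem_epsS hy]
  rw [mulLeft_rTensor_braid, h1, ← braid_mul_apply, hR.mul_tmul_one (antipode_mem_range_epsT hy),
    braid_mul_apply, h5]

omit hρ in
theorem braid_comulOp_one (v : H ⊗[k] M) :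
    braid M (Δop k H 1) (braid M R v) = braid M R v := by
  rw [← braid_mul_apply, hR.comulOp_one_mul]

theorem braid_coact_smul (h : H) (m : M) : braid M R (ρ (h • m)) =
    conj M ((Δop k H).lTensor H (Δ k H h)) (braid M R (ρ m)) := by
  rw [hρ.coact_smul, conj_lTensor_comul hR]

set_option maxSynthPendingDepth 10 in
/-- Coassociativity of the transmuted coaction with respect to the comultiplication of `B`. -/
theorem braid_coassoc (m : M) :
    TensorProduct.assoc k H H M ((comulR R).rTensor M (braid M R (ρ m))) =
      (braid M R ∘ₗ ρ).lTensor H (braid M R (ρ m)) := by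
  obtain ⟨n, c, d, h⟩ := exists_sum_tmul R
  have h1 (a b : H) (v : H ⊗[k] M) : (braid M R ∘ₗ ρ).lTensor H (braid M (a ⊗ₜ b) v) =
      conj₂ M ((b ⊗ₜ[k] (Δop k H).lTensor H (Δ k H a)) * ((1 : H) ⊗ₜ[k] ((1 : H) ⊗ₜ[k] R)))
        (ρ.lTensor H v) := by
    rw [conj₂_mul_apply]
    induction v with
    | zero => simp
    | add v v' hv hv' => simp only [map_add, hv, hv']
    | tmul x m =>
      simp [conj_one_tmul, antipode_one, hρ.braid_coact_smul hR]
  have h2 : braid M R (ρ m) = ∑ i, braid M (c i ⊗ₜ d i) (ρ m) := by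
    conv_lhs => rw [h]
    simp
  rw [h2, map_sum, map_sum, map_sum]
  simp only [h1, assoc_rTensor_comulR_braid M h, hρ.coassoc]
  rw [← LinearMap.sum_apply, ← LinearMap.sum_apply, ← map_sum, ← map_sum, hR.sum_coassoc h]

theorem braid_counit (hreg : IsRegular k H) (m : M) : TensorProduct.lift
    (Algebra.lsmul k k M).toLinearMap ((epsT k H).rTensor M (braid M R (ρ m))) = m := by
  obtain ⟨n, c, d, hcd⟩ := exists_sum_tmul R
  obtain ⟨N, a, b, h, ha, hb⟩ := exists_comul_one_eq_sum (k := k) (H := H)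
  let E : H ⊗[k] M →ₗ[k] M :=
    TensorProduct.lift (Algebra.lsmul k k M).toLinearMap ∘ₗ (epsT k H).rTensor M
  have hE (x : H) (m : M) : E (x ⊗ₜ m) = epsT k H x • m := rfl
  change E (braid M R (ρ m)) = m
  -- `E(x S(R²) ⊗ R¹ m)` depends only on `R¹ ⊗ ε_s(R²) = S(1₍₂₎) ⊗ 1₍₁₎`.
  have h1 (v : H ⊗[k] M) : E (braid M R v) =
      ∑ i, E (braid M (S k H (b i) ⊗ₜ a i) v) := by
    have h2 (t : H ⊗[k] H) : E (braid M t v) = E (braid M ((epsS k H).lTensor H t) v) := by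
      induction t with
      | zero => simp
      | add s t hs ht => simp only [map_add, LinearMap.add_apply, hs, ht]
      | tmul c d =>
        induction v with
        | zero => simp
        | add v v' hv hv' => simp only [map_add, hv, hv']
        | tmul x m =>
          rw [LinearMap.lTensor_tmul, braid_tmul, braid_tmul, hE, hE, ← epsT_mul_epsT,
            epsT_antipode]
    rw [h2, hR.lTensor_epsS hreg h hb]
    simp
  have h3 i : braid M (S k H (b i) ⊗ₜ a i) (ρ m) =
      (LinearMap.mulRight k (S k H (b i) * S k H (a i))).rTensor M (ρ m) := by
    have h4 (z y : H) (v : H ⊗[k] M) : braid M (z ⊗ₜ y) v =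
        (LinearMap.mulRight k (S k H y)).rTensor M (act₂ k H H M (1 ⊗ₜ z) v) := by
      induction v with
      | zero => simp
      | add v v' hv hv' => simp only [map_add, hv, hv']
      | tmul x m => simp
    rw [h4, hρ.act₂_one_tmul (antipode_mem_range_epsS (hb i)), LinearMap.mulRight_mul,
      LinearMap.rTensor_comp]
    rfl
  have h5 (x : H) : ∑ i, epsT k H (x * (S k H (b i) * S k H (a i))) = epsT k H x := by
    have h6 : ∑ i, S k H (b i) * S k H (a i) = ∑ i, a i * b i := by
      have := congrArg (LinearMap.mul' k H) (flipAntipode_comul_one (k := k) (H := H))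
      rw [h] at this
      simpa using this
    rw [← map_sum, ← Finset.mul_sum, h6, ← epsT_mul_epsT, map_sum, hreg.sum_epsT_mul h ha hb,
      mul_one]
  have h8 (v : H ⊗[k] M) :
      ∑ i, E ((LinearMap.mulRight k (S k H (b i) * S k H (a i))).rTensor M v) = E v := by
    induction v with
    | zero => simp
    | add v v' hv hv' => simp only [map_add, Finset.sum_add_distrib, hv, hv']
    | tmul x m =>
      simp only [LinearMap.rTensor_tmul, LinearMap.mulRight_apply, hE]
      rw [← Finset.sum_smul, h5]
  -- `E` is `ε ⊗ id` after the action of `Δ(1)`, which fixes `ρ(m)`.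
  have h9 (v : H ⊗[k] M) : E v = TensorProduct.lid k M ((ε k H).rTensor M
      (act₂ k H H M (Δ k H 1) v)) := by
    induction v with
    | zero => simp
    | add v v' hv hv' => simp only [map_add, hv, hv']
    | tmul x m =>
      rw [hE, epsT_eq_sum h, h]
      simp [Finset.sum_smul]
  rw [h1]
  simp only [h3]
  rw [h8, h9, hρ.act₂_comul_one, hρ.counit]

end IsYetterDrinfeld

end TransmutedCoaction

/-! ### The coalgebra `B` and the functor `G` -/

section BraidedCoalgebra

variable {k : Type u} {H : Type v} [Field k] [Ring H] [Algebra k H] [WeakHopfAlgebra k H]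
  [Module.Finite k H] (hA : AdActsOnB k H) (M : HMod.{u, v, w} k H)

/-- On `B ⊗ M`, the element `h` acts by `x ⊗ m ↦ h₍₁₎ x S(h₍₂₎) ⊗ h₍₃₎ m`. -/
theorem rTensor_inclB_act₂_comul (h : H) (v : objB hA ⊗[k] M) :
    (inclB hA).rTensor M (act₂ k H (objB hA) M (Δ k H h) v) =
      conj M ((Δop k H).lTensor H (Δ k H h)) ((inclB hA).rTensor M v) := by
  have h1 (t : H ⊗[k] H) : (inclB hA).rTensor M (act₂ k H (objB hA) M t v) =
      conj M ((TensorProduct.comm k H H).toLinearMap.lTensor H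
        (TensorProduct.assoc k H H H ((Δ k H).rTensor H t))) ((inclB hA).rTensor M v) := by
    induction t with
    | zero => simp
    | add s t hs ht => simp only [map_add, LinearMap.add_apply, hs, ht]
    | tmul p q =>
      induction v with
      | zero => simp
      | add v v' hv hv' => simp only [map_add, hv, hv']
      | tmul x m =>
        simp only [act₂_tmul, LinearMap.rTensor_tmul, inclB_smul, ad_apply]
        induction Δ k H p with
        | zero => simp
        | add s t hs ht =>
          simp only [map_add, LinearMap.add_apply, TensorProduct.add_tmul, hs, ht]
        | tmul a b => simp
  rw [h1]
  have h2 : TensorProduct.assoc k H H H ((Δ k H).rTensor H (Δ k H h)) =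
      (Δ k H).lTensor H (Δ k H h) := Coalgebra.coassoc_apply h
  rw [h2, Δop, LinearMap.lTensor_comp, LinearMap.comp_apply]

/-- On `B ⊗ M`, the action of `Δ(1)` is `x ⊗ m ↦ x S(1₍₁₎) ⊗ 1₍₂₎ m`. -/
theorem rTensor_inclB_act₂_comul_one (v : objB hA ⊗[k] M) :
    (inclB hA).rTensor M (act₂ k H (objB hA) M (Δ k H 1) v) =
      braid M (Δop k H 1) ((inclB hA).rTensor M v) := by
  obtain ⟨n, a, b, h, ha, -⟩ := exists_comul_one_eq_sum (k := k) (H := H)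
  rw [comulOp_eq_sum h, h]
  simp only [map_sum, LinearMap.sum_apply]
  refine Finset.sum_congr rfl fun i _ => ?_
  induction v with
  | zero => simp
  | add v v' hv hv' => simp only [map_add, hv, hv']
  | tmul x m => simp [ad_of_mem_epsS (ha i) (inclB_mem hA x)]

theorem map_inclB_rTensor_injective : Function.Injective
    (TensorProduct.map (inclB hA) ((inclB hA).rTensor M)) := by
  rw [← LinearMap.lTensor_comp_rTensor]
  exact (Module.Flat.lTensor_preserves_injective_linearMap _ (rTensor_inclB_injective hA _)).comp
    (rTensor_inclB_injective hA _)

theorem map_inclB_assoc_rTensor {R : H ⊗[k] H} {δ : objB hA →ₗ[k] objB hA ⊗[k] objB hA}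
    (hδ : ∀ b, TensorProduct.map (inclB hA) (inclB hA) (δ b) = comulR R (inclB hA b))
    (v : objB hA ⊗[k] M) : TensorProduct.map (inclB hA) ((inclB hA).rTensor M)
      (TensorProduct.assoc k (objB hA) (objB hA) M (δ.rTensor M v)) =
        TensorProduct.assoc k H H M ((comulR R).rTensor M ((inclB hA).rTensor M v)) := by
  induction v with
  | zero => simp
  | add v v' hv hv' => simp only [map_add, hv, hv']
  | tmul x m =>
    simp only [LinearMap.rTensor_tmul, ← hδ]
    induction δ x with
    | zero => simp
    | add s t hs ht => simp only [map_add, TensorProduct.add_tmul, hs, ht]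
    | tmul a b => simp

/-- `σ : M → B ⊗ M` is the coaction `m ↦ m₍₋₁₎ S(R²) ⊗ R¹ m₍₀₎` transmuted from the
Yetter-Drinfeld coaction `ρ`. -/
structure IsTransmuted (R : H ⊗[k] H) (ρ : M →ₗ[k] H ⊗[k] M) (σ : M →ₗ[k] objB hA ⊗[k] M) :
    Prop where
  isYetterDrinfeld : IsYetterDrinfeld M ρ
  rTensor_eq : ∀ m, (inclB hA).rTensor M (σ m) = braid M R (ρ m)

namespace IsTransmuted

variable {hA M} {R : H ⊗[k] H} {ρ : M →ₗ[k] H ⊗[k] M} {σ : M →ₗ[k] objB hA ⊗[k] M}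
  (hσ : IsTransmuted hA M R ρ σ) (hR : IsRMatrix R)
include hσ hR

theorem mem_tensorT (m : M) : σ m ∈ tensorT k H (objB hA) M := by
  rw [mem_tensorT_iff]
  apply rTensor_inclB_injective hA
  rw [rTensor_inclB_act₂_comul_one, hσ.rTensor_eq, IsYetterDrinfeld.braid_comulOp_one hR]

theorem coact_smul (h : H) (m : M) : σ (h • m) = act₂ k H (objB hA) M (Δ k H h) (σ m) := by
  apply rTensor_inclB_injective hA
  rw [rTensor_inclB_act₂_comul, hσ.rTensor_eq, hσ.rTensor_eq,
    hσ.isYetterDrinfeld.braid_coact_smul hR]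

theorem coassoc {δ : objB hA →ₗ[k] objB hA ⊗[k] objB hA}
    (hδ : ∀ b, TensorProduct.map (inclB hA) (inclB hA) (δ b) = comulR R (inclB hA b)) (m : M) :
    TensorProduct.assoc k (objB hA) (objB hA) M (δ.rTensor M (σ m)) =
      σ.lTensor (objB hA) (σ m) := by
  apply map_inclB_rTensor_injective hA
  rw [map_inclB_assoc_rTensor hA M hδ, hσ.rTensor_eq, hσ.isYetterDrinfeld.braid_coassoc hR,
    ← hσ.rTensor_eq]
  induction σ m with
  | zero => simp
  | add v v' hv hv' => simp only [map_add, hv, hv']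
  | tmul x m => simp [hσ.rTensor_eq]

theorem counit (hreg : IsRegular k H) (m : M) : TensorProduct.lift
    (Algebra.lsmul k k M).toLinearMap ((epsT k H ∘ₗ inclB hA).rTensor M (σ m)) = m := by
  rw [LinearMap.rTensor_comp, LinearMap.comp_apply, hσ.rTensor_eq,
    hσ.isYetterDrinfeld.braid_counit hR hreg]

end IsTransmuted

variable {R : H ⊗[k] H}

theorem lTensor_inclB_braid (T : H ⊗[k] H) (v : H ⊗[k] objB hA) :
    (inclB hA).lTensor H (braid (objB hA) T v) =
      twist (ad k H) ((S k H).lTensor H T) ((inclB hA).lTensor H v) := by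
  induction T with
  | zero => simp
  | add s t hs ht => simp only [map_add, LinearMap.add_apply, hs, ht]
  | tmul a b =>
    induction v with
    | zero => simp
    | add v v' hv hv' => simp only [map_add, hv, hv']
    | tmul x c => simp [twist_tmul]

theorem lTensor_inclB_braid_coactB (b : objB hA) :
    (inclB hA).lTensor H (braid (objB hA) R (coactB hA b)) = comulR R (inclB hA b) := by
  rw [lTensor_inclB_braid, lTensor_coactB]
  rfl

theorem comulR_mem_range (hreg : IsRegular k H) (hR : IsRMatrix R) (b : B k H) :
    comulR R (b : H) ∈ LinearMap.range (TensorProduct.map (ιB k H) (ιB k H)) := by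
  obtain ⟨y, hy⟩ := (hreg.isYetterDrinfeld_objB hreg.adActsOnB).braid_mem_range hR hreg b
  refine ⟨y, ?_⟩
  rw [← LinearMap.lTensor_comp_rTensor]
  refine Eq.trans ?_ (lTensor_inclB_braid_coactB hreg.adActsOnB (R := R) b)
  rw [← hy]
  rfl

theorem map_inclB_comulB (hR' : ∀ b : B k H,
      comulR R b ∈ LinearMap.range (TensorProduct.map (ιB k H) (ιB k H))) (b : objB hA) :
    TensorProduct.map (inclB hA) (inclB hA) (comulB R hA hR' b) = comulR R (inclB hA b) :=
  apply_liftThrough (V := B k H ⊗[k] B k H) (W := H ⊗[k] H) (M := B k H)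
    (TensorProduct.map (ιB k H) (ιB k H)) map_ιB_injective (comulR R ∘ₗ ιB k H) hR' b

/-- The comultiplication of `B` is transmuted from the Yetter-Drinfeld module `(B, ad, Δ)`. -/
theorem isTransmuted_comulB (hreg : IsRegular k H) (hR' : ∀ b : B k H,
      comulR R b ∈ LinearMap.range (TensorProduct.map (ιB k H) (ιB k H))) :
    IsTransmuted hA (objB hA) R (coactB hA) (comulB R hA hR') where
  isYetterDrinfeld := hreg.isYetterDrinfeld_objB hA
  rTensor_eq b := by
    apply lTensor_inclB_injective hA
    rw [lTensor_inclB_braid_coactB, ← map_inclB_comulB hA hR', ← LinearMap.comp_apply,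
      LinearMap.lTensor_comp_rTensor]

omit [Module.Finite k H] in
/-- `ε_t(h · x) = ε_t(hx)` for `x` in `B`: since `ε_t(uS(v)) = ε_t(uS(ε_s(v)))`, the left side is
`ε_t(h 1₍₁₎ x 1₍₂₎)`. -/
theorem IsRegular.epsT_ad (hreg : IsRegular k H) (h : H) {x : H} (hx : x ∈ B k H) :
    epsT k H (ad k H h x) = epsT k H (h * x) := by
  obtain ⟨n, a, b, h1, ha, hb⟩ := exists_comul_one_eq_sum (k := k) (H := H)
  have h2 (t : H ⊗[k] H) :
      epsT k H (adT k H t x) = epsT k H (adT k H ((epsS k H).lTensor H t) x) := by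
    induction t with
    | zero => simp
    | add s t hs ht => simp only [map_add, LinearMap.add_apply, hs, ht]
    | tmul p q =>
      rw [LinearMap.lTensor_tmul, adT_tmul, adT_tmul, ← mul_assoc, ← mul_assoc, ← epsT_mul_epsT,
        epsT_antipode]
  have hb' i : S k H (epsS k H (b i)) = b i := by
    obtain ⟨w, hw⟩ := hb i
    rw [← hw, ← antipode_epsT, hreg.antipode_antipode_epsT]
  rw [ad_apply, h2, lTensor_epsS_comul, adT_mul_apply, h1]
  simp only [map_sum, LinearMap.lTensor_tmul, LinearMap.sum_apply, adT_tmul, hb', antipode_one,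
    mul_one, ← mul_assoc, mem_B_iff.1 hx _ (ha _)]
  simp only [mul_assoc (h * x)]
  have h3 i : epsT k H (h * x * (a i * b i)) = epsT k H (h * x * epsT k H (a i * b i)) :=
    (epsT_mul_epsT _ _).symm
  simp only [h3]
  rw [← map_sum, ← Finset.mul_sum, hreg.sum_epsT_mul h1 ha hb, mul_one]

omit [Module.Finite k H] in
/-- `S(R²) ε_t(R¹z) = S(z)` for `z` in `H_t`. -/
theorem IsRMatrix.sum_antipode_mul_epsT {n : ℕ} {c d : Fin n → H} (hR : IsRMatrix R)
    (h : R = ∑ i, c i ⊗ₜ[k] d i) {z : H} (hz : z ∈ LinearMap.range (epsT k H)) :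
    ∑ i, S k H (d i) * epsT k H (c i * z) = S k H z := by
  obtain ⟨N, a, b, h1, ha, hb⟩ := exists_comul_one_eq_sum (k := k) (H := H)
  let Λ : H ⊗[k] H →ₗ[k] H := LinearMap.mul' k H ∘ₗ TensorProduct.map (S k H) LinearMap.id ∘ₗ
    (TensorProduct.comm k H H).toLinearMap ∘ₗ (epsT k H).rTensor H
  have h2 (t : H ⊗[k] H) : Λ ((1 ⊗ₜ z) * t) = Λ t * S k H z := by
    induction t with
    | zero => simp
    | add s t hs ht => simp only [mul_add, add_mul, map_add, hs, ht]
    | tmul x y =>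
      obtain ⟨w, hw⟩ := antipode_mem_range_epsS hz
      simp [Λ, antipode_mul, ← hw, mul_assoc, epsT_mul_epsS]
  have h3 : Λ R = 1 := by
    simp only [Λ, LinearMap.comp_apply, hR.rTensor_epsT h1 ha]
    simp [sum_antipode_mul_one h1]
  have h4 := congrArg Λ (hR.mul_tmul_one hz)
  rw [h2, h3, one_mul] at h4
  rw [← h4, h]
  simp [Λ, Finset.sum_mul]

/-- Right counitality of `B`. -/
theorem counit_right_comulR (hreg : IsRegular k H) (hR : IsRMatrix R) (b : objB hA) :
    LinearMap.mul' k H ((epsT k H).lTensor H (comulR R (inclB hA b))) = inclB hA b := by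
  obtain ⟨n, c, d, h⟩ := exists_sum_tmul R
  obtain ⟨N, a, b', h1, ha, hb⟩ := exists_comul_one_eq_sum (k := k) (H := H)
  obtain ⟨m, x, y, hv⟩ := exists_sum_tmul (coactB hA b)
  have h2 : Δ k H (inclB hA b) = ∑ i, x i ⊗ₜ inclB hA (y i) := by simp [← lTensor_coactB, hv]
  have h3 : ∑ i, x i ⊗ₜ epsT k H (inclB hA (y i)) = ∑ i, (a i * inclB hA b) ⊗ₜ[k] b' i := by
    have := lTensor_epsT_comul (k := k) (inclB hA b)
    rw [h2, h1] at this
    simpa [Finset.sum_mul] using this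
  have h4 : LinearMap.mul' k H ((epsT k H).lTensor H (comulR R (inclB hA b))) =
      ∑ i, x i * ∑ j, S k H (d j) * epsT k H (c j * epsT k H (inclB hA (y i))) := by
    rw [comulR, LinearMap.comp_apply, h2, h]
    simp only [map_sum, LinearMap.lTensor_tmul, LinearMap.sum_apply, twist_tmul,
      hreg.epsT_ad _ (inclB_mem hA _), LinearMap.mul'_apply, mul_assoc, Finset.mul_sum,
      epsT_mul_epsT]
  have h5 := congrArg (LinearMap.mul' k H ∘ₗ (S k H).lTensor H) h3
  simp only [map_sum, LinearMap.comp_apply, LinearMap.lTensor_tmul, LinearMap.mul'_apply] at h5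
  rw [h4]
  simp only [hR.sum_antipode_mul_epsT h ⟨_, rfl⟩]
  rw [h5]
  simp only [mem_B_iff.1 (inclB_mem hA b) _ (ha _), mul_assoc, ← Finset.mul_sum,
    sum_mul_antipode_one h1, mul_one]

theorem IsRMatrix.bIsCoalgebra (hreg : IsRegular k H) (hR : IsRMatrix R) : BIsCoalgebra R where
  adActs := hreg.adActsOnB
  comul_mem := comulR_mem_range hreg hR
  isCoalgebra :=
    have hσ := isTransmuted_comulB hreg.adActsOnB hreg (comulR_mem_range hreg hR)
    { comul_mem := hσ.mem_tensorT hR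
      comul_smul := hσ.coact_smul hR
      counit_mem := fun d => ⟨_, rfl⟩
      counit_smul := fun h d => by
        refine (hreg.epsT_ad h (inclB_mem _ d)).trans ?_
        exact (epsT_mul_epsT _ _).symm
      coassoc := hσ.coassoc hR (map_inclB_comulB _ _)
      counit_left := hσ.counit hR hreg
      counit_right := fun d => by
        apply inclB_injective
        refine Eq.trans ?_ (counit_right_comulR hreg.adActsOnB hreg hR d)
        rw [← map_inclB_comulB _ (comulR_mem_range hreg hR)]
        have key (t : objB hreg.adActsOnB ⊗[k] objB hreg.adActsOnB) :
            inclB hreg.adActsOnB (TensorProduct.lift ((Algebra.lsmul k k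
              (objB hreg.adActsOnB)).toLinearMap ∘ₗ S k H).flip
                ((counitB hreg.adActsOnB).lTensor _ t)) =
            LinearMap.mul' k H ((epsT k H).lTensor H
              (TensorProduct.map (inclB _) (inclB _) t)) := by
          induction t with
          | zero => simp
          | add s t hs ht => simp only [map_add, hs, ht]
          | tmul x c =>
            change ad k H (S k H (epsT k H (inclB _ c))) (inclB _ x) =
              inclB _ x * epsT k H (inclB _ c)
            rw [ad_of_mem_epsS (antipode_mem_range_epsS ⟨_, rfl⟩) (inclB_mem _ x),
              hreg.antipode_antipode_epsT]
        exact key _ }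

theorem IsRMatrix.coactGWellDefined (hreg : IsRegular k H) (hR : IsRMatrix R)
    (hB : BIsCoalgebra R) (M : YetterDrinfeld.{u, v, w} k H) : CoactGWellDefined hB M :=
  have hmem := M.isYetterDrinfeld.braid_mem_range hR hreg
  { mem := hmem
    isComodule :=
      have hσ : IsTransmuted hB.adActs M.obj R M.coact (coactGB hB M hmem) :=
        { isYetterDrinfeld := M.isYetterDrinfeld
          rTensor_eq := rTensor_coactGB hB M hmem }
      { coact_mem := hσ.mem_tensorT hR
        coact_smul := hσ.coact_smul hR
        coassoc := hσ.coassoc hR (map_inclB_comulB _ _)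
        counit := hσ.counit hR hreg } }

end BraidedCoalgebra

/-! ### Untwisting a coaction -/

section Untwisting

variable {k : Type u} {H : Type v} [Field k] [Ring H] [Algebra k H]

/-- The map `x ⊗ m ↦ x T² ⊗ T¹ m` on `H ⊗ M` for `T` in `H ⊗ H`. By definition, `coactF` is the
coaction followed by the map for `R`. -/
noncomputable def unbraid (M : HMod.{u, v, w} k H) : H ⊗[k] H →ₗ[k] Module.End k (H ⊗[k] M) :=
  twist (Algebra.lsmul k k M).toLinearMap

variable (M : HMod.{u, v, w} k H)

@[simp]
theorem unbraid_tmul (b c x : H) (m : M) :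
    unbraid M (b ⊗ₜ c) (x ⊗ₜ m) = (x * c) ⊗ₜ (b • m) := rfl

theorem act₂_unbraid (y z : H) (T : H ⊗[k] H) (v : H ⊗[k] M) :
    act₂ k H H M (y ⊗ₜ z) (unbraid M T v) =
      (LinearMap.mulLeft k y).rTensor M (unbraid M ((z ⊗ₜ 1) * T) v) := by
  induction T with
  | zero => simp
  | add s t hs ht => simp only [map_add, mul_add, LinearMap.add_apply, hs, ht]
  | tmul r s =>
    induction v with
    | zero => simp
    | add v v' hv hv' => simp only [map_add, hv, hv']
    | tmul x m => simp [mul_smul]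

theorem mulLeft_rTensor_unbraid (a : H) (t : H ⊗[k] H) (v : H ⊗[k] M) :
    (LinearMap.mulLeft k a).rTensor M (unbraid M t v) =
      unbraid M t ((LinearMap.mulLeft k a).rTensor M v) := by
  induction t with
  | zero => simp
  | add s t hs ht => simp only [map_add, LinearMap.add_apply, hs, ht]
  | tmul b c =>
    induction v with
    | zero => simp
    | add v v' hv hv' => simp only [map_add, hv, hv']
    | tmul x m => simp [mul_assoc]

theorem unbraid_mulRight_rTensor (a : H) (t : H ⊗[k] H) (v : H ⊗[k] M) :
    unbraid M t ((LinearMap.mulRight k a).rTensor M v) = unbraid M ((1 ⊗ₜ a) * t) v := by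
  induction t with
  | zero => simp
  | add s t hs ht => simp only [mul_add, map_add, LinearMap.add_apply, hs, ht]
  | tmul b c =>
    induction v with
    | zero => simp
    | add v v' hv hv' => simp only [map_add, hv, hv']
    | tmul x m => simp [mul_assoc]

variable [WeakHopfAlgebra k H] {R : H ⊗[k] H}

/-- `unbraid R` after `braid R` is `unbraid` of `R¹r¹ ⊗ S(r²)R² = S(1₍₂₎) ⊗ 1₍₁₎`. -/
theorem IsRMatrix.unbraid_braid (hR : IsRMatrix R) (hreg : IsRegular k H) {N : ℕ}
    {a b : Fin N → H} (h : Δ k H 1 = ∑ i, a i ⊗ₜ[k] b i)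
    (hb : ∀ i, b i ∈ LinearMap.range (epsT k H)) (v : H ⊗[k] M) :
    unbraid M R (braid M R v) = ∑ i, unbraid M (S k H (b i) ⊗ₜ a i) v := by
  obtain ⟨n, c, d, hcd⟩ := exists_sum_tmul R
  rw [← LinearMap.sum_apply, ← map_sum, ← hR.sum_tmul_antipode_mul hreg h hb hcd]
  have h1 : unbraid M R (braid M R v) =
      ∑ i, ∑ j, unbraid M (c i ⊗ₜ d i) (braid M (c j ⊗ₜ d j) v) := by
    rw [hcd]
    simp only [map_sum, LinearMap.sum_apply]
    exact Finset.sum_comm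
  rw [h1]
  clear h1
  simp only [map_sum, LinearMap.sum_apply]
  refine Finset.sum_congr rfl fun i _ => Finset.sum_congr rfl fun j _ => ?_
  induction v with
  | zero => simp
  | add v v' hv hv' => simp only [map_add, hv, hv']
  | tmul x m => simp [mul_assoc, mul_smul]

/-- `braid R` after `unbraid R` is `unbraid` of `R¹r¹ ⊗ r²S(R²) = S(1₍₁₎) ⊗ 1₍₂₎`. As this tensor
is symmetric, this is `braid` of `Δop(1)`. -/
theorem IsRMatrix.braid_unbraid (hR : IsRMatrix R) (hreg : IsRegular k H) (v : H ⊗[k] M) :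
    braid M R (unbraid M R v) = braid M (Δop k H 1) v := by
  obtain ⟨n, c, d, hcd⟩ := exists_sum_tmul R
  obtain ⟨N, a, b, h, ha, hb⟩ := exists_comul_one_eq_sum (k := k) (H := H)
  have h0 : braid M (Δop k H 1) v = unbraid M (∑ i, b i ⊗ₜ S k H (a i)) v := by
    rw [comulOp_eq_sum h]
    simp only [map_sum, LinearMap.sum_apply]
    rfl
  rw [h0, ← hreg.sum_antipode_tmul_comm h hb, ← hR.sum_tmul_mul_antipode hreg h ha hcd]
  have h1 : braid M R (unbraid M R v) =
      ∑ i, ∑ j, braid M (c i ⊗ₜ d i) (unbraid M (c j ⊗ₜ d j) v) := by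
    rw [hcd]
    simp only [map_sum, LinearMap.sum_apply]
    exact Finset.sum_comm
  rw [h1]
  clear h0 h1
  simp only [map_sum, LinearMap.sum_apply]
  refine Finset.sum_congr rfl fun i _ => Finset.sum_congr rfl fun j _ => ?_
  induction v with
  | zero => simp
  | add v v' hv hv' => simp only [map_add, hv, hv']
  | tmul x m => simp [mul_assoc, mul_smul]

variable {M} in
theorem IsYetterDrinfeld.unbraid_braid {ρ : M →ₗ[k] H ⊗[k] M} (hρ : IsYetterDrinfeld M ρ)
    (hR : IsRMatrix R) (hreg : IsRegular k H) (m : M) :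
    unbraid M R (braid M R (ρ m)) = ρ m := by
  obtain ⟨N, a, b, h, ha, hb⟩ := exists_comul_one_eq_sum (k := k) (H := H)
  rw [hR.unbraid_braid M hreg h hb]
  have h1 (z y : H) (v : H ⊗[k] M) : unbraid M (z ⊗ₜ y) v =
      (LinearMap.mulRight k y).rTensor M (act₂ k H H M (1 ⊗ₜ z) v) := by
    induction v with
    | zero => simp
    | add v v' hv hv' => simp only [map_add, hv, hv']
    | tmul x m => simp
  simp only [h1, hρ.act₂_one_tmul (antipode_mem_range_epsS (hb _))]
  induction ρ m with
  | zero => simp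
  | add v v' hv hv' => simp only [map_add, Finset.sum_add_distrib, hv, hv']
  | tmul x m =>
    simp [mul_assoc, ← TensorProduct.sum_tmul, ← Finset.mul_sum, hreg.sum_antipode_mul_flip h ha]

/-- `R¹h₍₂₎ ⊗ S(h₍₁₎)R²h₍₃₎ = hR¹ ⊗ R²`. -/
theorem IsRMatrix.lift_lTensor_comul (hR : IsRMatrix R) (h : H) :
    TensorProduct.lift ((LinearMap.mul k (H ⊗[k] H)).compl₁₂
      (TensorProduct.mk k H H 1 ∘ₗ S k H) (LinearMap.mulLeft k R))
        ((Δ k H).lTensor H (Δ k H h)) = (h ⊗ₜ 1) * R := by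
  set X := TensorProduct.lift ((LinearMap.mul k (H ⊗[k] H)).compl₁₂
      (TensorProduct.mk k H H 1 ∘ₗ S k H) (LinearMap.mulLeft k R)) with hX
  -- `Y(a ⊗ b ⊗ c) = c ⊗ S(a) b`
  let Y : H ⊗[k] (H ⊗[k] H) →ₗ[k] H ⊗[k] H :=
    (TensorProduct.comm k H H).toLinearMap ∘ₗ (LinearMap.mul' k H ∘ₗ (S k H).rTensor H).rTensor H ∘ₗ
      (TensorProduct.assoc k H H H).symm.toLinearMap
  have h0 (y : H) (t : H ⊗[k] H) :
      Y (y ⊗ₜ t) = (1 ⊗ₜ S k H y) * TensorProduct.comm k H H t := by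
    induction t with
    | zero => simp
    | add s t hs ht => simp only [TensorProduct.tmul_add, map_add, mul_add, hs, ht]
    | tmul a b => simp [Y]
  have h1 (t : H ⊗[k] H) : X ((Δ k H).lTensor H t) = Y ((Δ k H).lTensor H t) * R := by
    induction t with
    | zero => simp
    | add s t hs ht => simp only [map_add, add_mul, hs, ht]
    | tmul y z =>
      rw [LinearMap.lTensor_tmul, h0]
      change (1 ⊗ₜ S k H y) * (R * Δ k H z) = (1 ⊗ₜ S k H y) * Δop k H z * R
      rw [hR.mul_comul, mul_assoc]
  have h2 (t : H ⊗[k] H) : Y (TensorProduct.assoc k H H H ((Δ k H).rTensor H t)) =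
      TensorProduct.comm k H H ((epsS k H).rTensor H t) := by
    induction t with
    | zero => simp
    | add s t hs ht => simp only [map_add, hs, ht]
    | tmul y z =>
      simp only [Y, LinearMap.comp_apply, LinearEquiv.coe_coe, LinearEquiv.symm_apply_apply,
        LinearMap.rTensor_tmul, WeakHopfAlgebra.antipode_mul]
  have h3 : (Δ k H).lTensor H (Δ k H h) =
      TensorProduct.assoc k H H H ((Δ k H).rTensor H (Δ k H h)) :=
    (Coalgebra.coassoc_apply (R := k) h).symm
  rw [h1, h3, h2, rTensor_epsS_comul, comm_mul]
  change (h ⊗ₜ 1) * Δop k H 1 * R = _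
  rw [mul_assoc, hR.comulOp_one_mul]

variable {M} in
/-- Untwisting a coaction in `C` gives a map satisfying the compatibility condition of
Yetter-Drinfeld modules. -/
theorem act₂_comul_unbraid_eq_ydMap (hR : IsRMatrix R) {τ : M →ₗ[k] H ⊗[k] M}
    (hτ : ∀ h m, τ (h • m) = conj M ((Δop k H).lTensor H (Δ k H h)) (τ m)) (h : H) (m : M) :
    act₂ k H H M (Δ k H h) (unbraid M R (τ m)) = ydMap (unbraid M R ∘ₗ τ) m (Δ k H h) := by
  obtain ⟨n, p, q, hh⟩ := exists_sum_tmul (Δ k H h)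
  set X := TensorProduct.lift ((LinearMap.mul k (H ⊗[k] H)).compl₁₂
      (TensorProduct.mk k H H 1 ∘ₗ S k H) (LinearMap.mulLeft k R)) with hX
  -- `W(a ⊗ b ⊗ c) = a x S(b₍₁₎) R² c ⊗ R¹ b₍₂₎ n`, where `τ(m) = x ⊗ n`
  let W : H ⊗[k] (H ⊗[k] H) →ₗ[k] H ⊗[k] M := TensorProduct.lift
    (((LinearMap.mul k (Module.End k (H ⊗[k] M))).compl₁₂ (LinearMap.rTensorHom M ∘ₗ
      LinearMap.mul k H) (unbraid M ∘ₗ X ∘ₗ (TensorProduct.assoc k H H H).toLinearMap ∘ₗ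
        (Δ k H).rTensor H)).compr₂ (LinearMap.applyₗ (τ m)))
  have hW (a : H) (t : H ⊗[k] H) : W (a ⊗ₜ t) = (LinearMap.mulLeft k a).rTensor M
      (unbraid M (X (TensorProduct.assoc k H H H ((Δ k H).rTensor H t))) (τ m)) := rfl
  have h1 (e : H) (s : H ⊗[k] H) (y : H) (v : H ⊗[k] M) :
      (LinearMap.mulRight k e).rTensor M
        (unbraid M R (conj M (y ⊗ₜ TensorProduct.comm k H H s) v)) =
      (LinearMap.mulLeft k y).rTensor M
        (unbraid M (X (TensorProduct.assoc k H H H (s ⊗ₜ e))) v) := by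
    induction s with
    | zero => simp
    | add s t hs ht =>
      simp only [map_add, TensorProduct.tmul_add, TensorProduct.add_tmul, LinearMap.add_apply,
        hs, ht]
    | tmul f g =>
      have h2 (T : H ⊗[k] H) : (LinearMap.mulRight k e).rTensor M (unbraid M T
          (conj M (y ⊗ₜ (g ⊗ₜ f)) v)) = (LinearMap.mulLeft k y).rTensor M
            (unbraid M ((1 ⊗ₜ S k H f) * (T * (g ⊗ₜ e))) v) := by
        induction T with
        | zero => simp
        | add s t hs ht => simp only [map_add, mul_add, add_mul, LinearMap.add_apply, hs, ht]
        | tmul r s =>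
          induction v with
          | zero => simp
          | add v v' hv hv' => simp only [map_add, hv, hv']
          | tmul x m => simp [mul_assoc, mul_smul]
      exact h2 R
  have h3 (t : H ⊗[k] H) (e : H) : (LinearMap.mulRight k e).rTensor M
      (unbraid M R (conj M ((Δop k H).lTensor H t) (τ m))) =
        W (TensorProduct.assoc k H H H (t ⊗ₜ e)) := by
    induction t with
    | zero => simp
    | add s t hs ht =>
      simp only [map_add, TensorProduct.add_tmul, LinearMap.add_apply, hs, ht]
    | tmul a c =>
      rw [LinearMap.lTensor_tmul, TensorProduct.assoc_tmul, hW, LinearMap.rTensor_tmul]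
      exact h1 _ _ _ _
  have h4 : (ydMap (unbraid M R ∘ₗ τ) m) (Δ k H h) = ∑ i, W (p i ⊗ₜ Δ k H (q i)) := by
    rw [← map_sum, ← sum_comul_tmul_coassoc hh, hh]
    simp only [map_sum, ydMap_tmul, LinearMap.comp_apply, hτ, h3]
  have h5 (y : H) : X (TensorProduct.assoc k H H H ((Δ k H).rTensor H (Δ k H y))) =
      (y ⊗ₜ 1) * R := by
    rw [← hR.lift_lTensor_comul]
    exact congrArg X (Coalgebra.coassoc_apply (R := k) y)
  rw [h4, hh]
  simp only [map_sum, LinearMap.sum_apply, hW, h5]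
  exact Finset.sum_congr rfl fun i _ => act₂_unbraid M _ _ _ _

end Untwisting

/-! ### The functor `F` -/

section FunctorF

variable {k : Type u} {H : Type v} [Field k] [Ring H] [Algebra k H] [WeakHopfAlgebra k H]
  [Module.Finite k H]

theorem mulLeft_rTensor_inclB (hA : AdActsOnB k H) (M : HMod.{u, v, w} k H) {y : H}
    (hy : y ∈ LinearMap.range (epsS k H)) (v : objB hA ⊗[k] M) :
    (LinearMap.mulLeft k y).rTensor M ((inclB hA).rTensor M v) =
      (LinearMap.mulRight k y).rTensor M ((inclB hA).rTensor M v) := by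
  induction v with
  | zero => simp
  | add v v' hv hv' => simp only [map_add, hv, hv']
  | tmul x m => simp [mem_B_iff.1 (inclB_mem hA x) y hy]

variable {R : H ⊗[k] H} {M : HMod.{u, v, w} k H}

theorem IsRMatrix.unbraid_mem_tensorT (hR : IsRMatrix R) {hA : AdActsOnB k H}
    (v : objB hA ⊗[k] M) : unbraid M R ((inclB hA).rTensor M v) ∈ tensorT k H H M := by
  obtain ⟨N, a, b, h, ha, hb⟩ := exists_comul_one_eq_sum (k := k) (H := H)
  rw [mem_tensorT_iff, h, map_sum, LinearMap.sum_apply]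
  simp only [act₂_unbraid, mulLeft_rTensor_unbraid, mulLeft_rTensor_inclB _ _ (ha _),
    unbraid_mulRight_rTensor, ← mul_assoc, Algebra.TensorProduct.tmul_mul_tmul, one_mul, mul_one]
  rw [← LinearMap.sum_apply, ← map_sum, ← Finset.sum_mul, ← comulOp_eq_sum h, hR.comulOp_one_mul]

/-- If `σ` is a coaction of `B` in `C`, then `ρ(m) = m⁽⁻¹⁾ R² ⊗ R¹ m⁽⁰⁾` is coassociative. By
`H`-linearity of `σ`, the right side is a linear map `U` applied to `(id ⊗ σ)σ(m) = (δ ⊗ id)σ(m)`.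
The hexagon identity for `Δ ⊗ id` expresses `U` on `δ(x) ⊗ n` by `unbraid R` of `δ(x)`, which is
`Δ(x)`, and the hexagon identity for `id ⊗ Δ` identifies the result with the left side. -/
theorem IsRMatrix.unbraid_coassoc (hR : IsRMatrix R) (hreg : IsRegular k H) {hA : AdActsOnB k H}
    {δ : objB hA →ₗ[k] objB hA ⊗[k] objB hA} {σ : M →ₗ[k] objB hA ⊗[k] M}
    (hδ : ∀ b, (inclB hA).rTensor (objB hA) (δ b) = braid (objB hA) R (coactB hA b))
    (hsmul : ∀ h m, σ (h • m) = act₂ k H (objB hA) M (Δ k H h) (σ m))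
    (hcoassoc : ∀ m, TensorProduct.assoc k (objB hA) (objB hA) M (δ.rTensor M (σ m)) =
      σ.lTensor (objB hA) (σ m)) (m : M) :
    TensorProduct.assoc k H H M ((Δ k H).rTensor M (unbraid M R ((inclB hA).rTensor M (σ m)))) =
      (unbraid M R ∘ₗ (inclB hA).rTensor M ∘ₗ σ).lTensor H
        (unbraid M R ((inclB hA).rTensor M (σ m))) := by
  obtain ⟨n, c, d, hcd⟩ := exists_sum_tmul R
  -- `y ⊗ z ↦ y R² ⊗ z r² ⊗ r¹ R¹ n`
  let Q (q : M) : H ⊗[k] H →ₗ[k] H ⊗[k] (H ⊗[k] M) :=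
    ∑ i, ∑ j, TensorProduct.map (LinearMap.mulRight k (d j))
      ((TensorProduct.mk k H M).flip ((c i * c j) • q) ∘ₗ LinearMap.mulRight k (d i))
  -- `x ⊗ c ⊗ n ↦ x R² ⊗ (R¹₍₁₎ · c) r² ⊗ r¹ R¹₍₂₎ n`
  let U : objB hA ⊗[k] (objB hA ⊗[k] M) →ₗ[k] H ⊗[k] (H ⊗[k] M) :=
    ∑ i, TensorProduct.map (LinearMap.mulRight k (d i) ∘ₗ inclB hA)
      (unbraid M R ∘ₗ (inclB hA).rTensor M ∘ₗ act₂ k H (objB hA) M (Δ k H (c i)))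
  have hU (v : objB hA ⊗[k] M) :
      (unbraid M R ∘ₗ (inclB hA).rTensor M ∘ₗ σ).lTensor H
        (unbraid M R ((inclB hA).rTensor M v)) = U (σ.lTensor (objB hA) v) := by
    induction v with
    | zero => simp
    | add v v' hv hv' => simp only [map_add, hv, hv']
    | tmul x q =>
      have h1 (h : H) : σ (h • q) = act₂ k H (objB hA) M (Δ k H h) (σ q) :=
        hsmul h q
      have h2 : unbraid M R (inclB hA x ⊗ₜ q) =
          ∑ i, (inclB hA x * d i) ⊗ₜ (c i • q) := by
        conv_lhs => rw [hcd]
        simp only [map_sum, LinearMap.sum_apply, unbraid_tmul]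
      rw [LinearMap.rTensor_tmul, h2, map_sum, LinearMap.lTensor_tmul, LinearMap.sum_apply]
      simp only [LinearMap.lTensor_tmul, LinearMap.comp_apply, h1, TensorProduct.map_tmul,
        LinearMap.mulRight_apply]
  have hUQ (x y : objB hA) (q : M) : U (x ⊗ₜ (y ⊗ₜ q)) =
      Q q ((inclB hA).lTensor H
        (unbraid (objB hA) R (inclB hA x ⊗ₜ y))) := by
    let Λ : (H ⊗[k] H) ⊗[k] H →ₗ[k] H ⊗[k] (H ⊗[k] M) := TensorProduct.lift
      ((TensorProduct.mk k H (H ⊗[k] M) ∘ₗ LinearMap.mulLeft k (inclB hA x)).flip ∘ₗ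
        unbraid M R ∘ₗ (inclB hA).rTensor M ∘ₗ
          (act₂ k H (objB hA) M).toLinearMap.flip (y ⊗ₜ q))
    have hΛ (t : H ⊗[k] H) (e : H) : Λ (t ⊗ₜ e) = (inclB hA x * e) ⊗ₜ
        unbraid M R ((inclB hA).rTensor M (act₂ k H (objB hA) M t (y ⊗ₜ q))) := rfl
    have h1 := congrArg Λ (hR.sum_comul_tmul hcd)
    simp only [map_sum, hΛ] at h1
    have h2 : U (x ⊗ₜ (y ⊗ₜ q)) = ∑ i, (inclB hA x * d i) ⊗ₜ unbraid M R
        ((inclB hA).rTensor M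
          (act₂ k H (objB hA) M (Δ k H (c i)) (y ⊗ₜ q))) := by
      simp only [U, LinearMap.sum_apply]
      rfl
    rw [h2, h1]
    have h3 (w : H ⊗[k] M) : unbraid M R w = ∑ r, unbraid M (c r ⊗ₜ d r) w := by
      conv_lhs => rw [hcd]
      simp only [map_sum, LinearMap.sum_apply]
    have h4 (w : H ⊗[k] objB hA) : unbraid (objB hA) R w =
        ∑ r, unbraid (objB hA) (c r ⊗ₜ d r) w := by
      conv_lhs => rw [hcd]
      simp only [map_sum, LinearMap.sum_apply]
    simp only [h3, h4, map_sum, LinearMap.sum_apply, Q, act₂_tmul, LinearMap.rTensor_tmul,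
      unbraid_tmul, TensorProduct.tmul_sum, LinearMap.lTensor_tmul, TensorProduct.map_tmul,
      LinearMap.mulRight_apply, LinearMap.comp_apply, LinearMap.flip_apply,
      TensorProduct.mk_apply, mul_assoc, mul_smul]
    refine Finset.sum_congr rfl fun i _ => ?_
    rw [Finset.sum_comm]
  have hUδ (x : objB hA) (q : M) :
      U (TensorProduct.assoc k _ _ _ (δ x ⊗ₜ q)) =
        Q q (Δ k H (inclB hA x)) := by
    have h1 (t : objB hA ⊗[k] objB hA) : U (TensorProduct.assoc k _ _ _ (t ⊗ₜ q)) =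
        Q q ((inclB hA).lTensor H (unbraid (objB hA) R
          ((inclB hA).rTensor (objB hA) t))) := by
      induction t with
      | zero => simp
      | add s t hs ht => simp only [TensorProduct.add_tmul, map_add, hs, ht]
      | tmul y z => rw [TensorProduct.assoc_tmul, hUQ, LinearMap.rTensor_tmul]
    rw [h1, hδ, (hreg.isYetterDrinfeld_objB hA).unbraid_braid hR hreg, lTensor_coactB]
  have hQ (x : H) (q : M) : Q q (Δ k H x) =
      TensorProduct.assoc k H H M ((Δ k H).rTensor M (unbraid M R (x ⊗ₜ q))) := by
    let Λ : H ⊗[k] (H ⊗[k] H) →ₗ[k] H ⊗[k] (H ⊗[k] M) :=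
      (TensorProduct.assoc k H H M).toLinearMap ∘ₗ TensorProduct.lift
        ((TensorProduct.mk k (H ⊗[k] H) M).flip ∘ₗ (Algebra.lsmul k k M).toLinearMap.flip q) ∘ₗ
          (LinearMap.mulLeft k (Δ k H x)).lTensor H
    have hΛ (e : H) (t : H ⊗[k] H) : Λ (e ⊗ₜ t) =
        TensorProduct.assoc k H H M ((Δ k H x * t) ⊗ₜ (e • q)) := rfl
    have h1 := congrArg Λ (hR.sum_tmul_comul hcd)
    simp only [map_sum, hΛ, ← comul_mul] at h1
    have h2 : unbraid M R (x ⊗ₜ q) = ∑ i, (x * d i) ⊗ₜ (c i • q) := by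
      conv_lhs => rw [hcd]
      simp only [map_sum, LinearMap.sum_apply, unbraid_tmul]
    rw [h2]
    simp only [map_sum, LinearMap.rTensor_tmul]
    rw [h1]
    simp only [Q, LinearMap.sum_apply]
    refine Finset.sum_congr rfl fun i _ => Finset.sum_congr rfl fun j _ => ?_
    induction Δ k H x with
    | zero => simp
    | add s t hs ht => simp only [map_add, add_mul, TensorProduct.add_tmul, hs, ht]
    | tmul y z => simp
  have key (v : objB hA ⊗[k] M) :
      TensorProduct.assoc k H H M ((Δ k H).rTensor M
        (unbraid M R ((inclB hA).rTensor M v))) =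
      U (TensorProduct.assoc k _ _ _ (δ.rTensor M v)) := by
    induction v with
    | zero => simp
    | add v v' hv hv' => simp only [map_add, hv, hv']
    | tmul x q => exact ((hUδ x q).trans (hQ _ q)).symm
  rw [key, hU]
  exact congrArg U (hcoassoc m)

variable {hB : BIsCoalgebra R} {σ : M →ₗ[k] objB hB.adActs ⊗[k] M}

namespace IsComodule

variable (hσ : IsComodule (coalgB hB) M σ)
include hσ

theorem rTensor_inclB_smul (h : H) (m : M) : (inclB hB.adActs).rTensor M (σ (h • m)) =
    conj M ((Δop k H).lTensor H (Δ k H h)) ((inclB hB.adActs).rTensor M (σ m)) :=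
  (congrArg _ (hσ.coact_smul h m)).trans (rTensor_inclB_act₂_comul hB.adActs M h (σ m))

theorem braid_comulOp_one (m : M) : braid M (Δop k H 1) ((inclB hB.adActs).rTensor M (σ m)) =
    (inclB hB.adActs).rTensor M (σ m) := by
  rw [← rTensor_inclB_act₂_comul_one]
  exact congrArg _ ((mem_tensorT_iff (objB hB.adActs) M (σ m)).1 (hσ.coact_mem m))

theorem braid_unbraid (hR : IsRMatrix R) (hreg : IsRegular k H) (m : M) :
    braid M R (unbraid M R ((inclB hB.adActs).rTensor M (σ m))) =
      (inclB hB.adActs).rTensor M (σ m) := by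
  rw [hR.braid_unbraid M hreg, hσ.braid_comulOp_one]

theorem unbraid_counit (hR : IsRMatrix R) (hreg : IsRegular k H) (m : M) :
    TensorProduct.lid k M ((ε k H).rTensor M
      (unbraid M R ((inclB hB.adActs).rTensor M (σ m)))) = m := by
  obtain ⟨N, a, b, h, ha, hb⟩ := exists_comul_one_eq_sum (k := k) (H := H)
  let E : H ⊗[k] M →ₗ[k] M := (TensorProduct.lid k M).toLinearMap ∘ₗ (ε k H).rTensor M
  have hE (x : H) (m : M) : E (x ⊗ₜ m) = ε k H x • m := rfl
  change E (unbraid M R ((inclB hB.adActs).rTensor M (σ m))) = m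
  -- `E(b R² ⊗ R¹ m)` depends only on `R¹ ⊗ ε_t(R²) = S(1₍₁₎) ⊗ 1₍₂₎ = 1₍₂₎ ⊗ S(1₍₁₎)`.
  have h1 (t : H ⊗[k] H) (v : H ⊗[k] M) :
      E (unbraid M t v) = E (unbraid M ((epsT k H).lTensor H t) v) := by
    induction t with
    | zero => simp
    | add s t hs ht => simp only [map_add, LinearMap.add_apply, hs, ht]
    | tmul c d =>
      induction v with
      | zero => simp
      | add v v' hv hv' => simp only [map_add, hv, hv']
      | tmul x m =>
        rw [LinearMap.lTensor_tmul, unbraid_tmul, unbraid_tmul, hE, hE, counit_mul_epsT]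
  have h2 (v : objB hB.adActs ⊗[k] M) : E (unbraid M R ((inclB hB.adActs).rTensor M v)) =
      TensorProduct.lift (Algebra.lsmul k k M).toLinearMap
        ((epsT k H).rTensor M ((inclB hB.adActs).rTensor M v)) := by
    rw [h1, hR.lTensor_epsT hreg h ha, hreg.sum_antipode_tmul_comm h hb]
    induction v with
    | zero => simp
    | add v v' hv hv' => simp only [map_add, hv, hv']
    | tmul x m =>
      have h3 i : ε k H (inclB hB.adActs x * S k H (a i)) = ε k H (a i * inclB hB.adActs x) := by
        obtain ⟨w, hw⟩ := ha i
        rw [mem_B_iff.1 (inclB_mem _ x) _ (ha i), ← hw, antipode_epsS, counit_mul_epsT]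
      simp only [map_sum, LinearMap.sum_apply, LinearMap.rTensor_tmul, unbraid_tmul, hE, h3]
      rw [TensorProduct.lift.tmul, epsT_eq_sum h]
      simp
  rw [h2, ← LinearMap.comp_apply (LinearMap.rTensor M (epsT k H)), ← LinearMap.rTensor_comp]
  exact hσ.counit m

theorem isYetterDrinfeld (hR : IsRMatrix R) (hreg : IsRegular k H) :
    IsYetterDrinfeld M (unbraid M R ∘ₗ (inclB hB.adActs).rTensor M ∘ₗ σ) where
  coassoc := hR.unbraid_coassoc hreg
    (isTransmuted_comulB hB.adActs hreg hB.comul_mem).rTensor_eq hσ.coact_smul hσ.coassoc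
  counit := hσ.unbraid_counit hR hreg
  coact_mem := fun m => hR.unbraid_mem_tensorT (σ m)
  compat := act₂_comul_unbraid_eq_ydMap hR hσ.rTensor_inclB_smul

end IsComodule

theorem IsRMatrix.isYetterDrinfeld_coactF (hR : IsRMatrix R) (hreg : IsRegular k H)
    (N : Comodule.{u, v, v, w} (coalgB hB)) : IsYetterDrinfeld N.obj (coactF hB N) :=
  IsComodule.isYetterDrinfeld (σ := N.coact) N.isComodule hR hreg

end FunctorF

/-! ### The equivalence -/

section Isomorphisms

variable {k : Type u} {H : Type v} [Field k] [Ring H] [Algebra k H] [WeakHopfAlgebra k H]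

/-- Two comodules with the same underlying module and the same coaction are isomorphic. -/
def Comodule.isoOfEq {D : CoalgebraIn.{u, v, w} k H} {M : HMod.{u, v, w'} k H}
    {ρ σ : M →ₗ[k] D.obj ⊗[k] M} (hρ : IsComodule D M ρ) (hσ : IsComodule D M σ)
    (h : ∀ m, σ m = ρ m) :
    (⟨M, ρ, hρ⟩ : Comodule.{u, v, w, w'} D) ≅ ⟨M, σ, hσ⟩ where
  hom := ⟨LinearMap.id, fun m => (h m).trans (LinearMap.lTensor_id_apply _ _ (ρ m)).symm⟩
  inv := ⟨LinearMap.id, fun m => (h m).symm.trans (LinearMap.lTensor_id_apply _ _ (σ m)).symm⟩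
  hom_inv_id := Comodule.Hom.ext rfl
  inv_hom_id := Comodule.Hom.ext rfl

/-- Two Yetter-Drinfeld modules with the same underlying module and the same coaction are
isomorphic. -/
def YetterDrinfeld.isoOfEq {M : HMod.{u, v, w} k H} {ρ σ : M →ₗ[k] H ⊗[k] M}
    (hρ : IsYetterDrinfeld M ρ) (hσ : IsYetterDrinfeld M σ) (h : ∀ m, σ m = ρ m) :
    (⟨M, ρ, hρ⟩ : YetterDrinfeld.{u, v, w} k H) ≅ ⟨M, σ, hσ⟩ where
  hom := ⟨LinearMap.id, fun m => (h m).trans (LinearMap.lTensor_id_apply _ _ (ρ m)).symm⟩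
  inv := ⟨LinearMap.id, fun m => (h m).symm.trans (LinearMap.lTensor_id_apply _ _ (σ m)).symm⟩
  hom_inv_id := YetterDrinfeld.Hom.ext rfl
  inv_hom_id := YetterDrinfeld.Hom.ext rfl

variable [Module.Finite k H] {R : H ⊗[k] H} {hB : BIsCoalgebra R}

theorem IsRMatrix.coactGB_coactF (hR : IsRMatrix R) (hreg : IsRegular k H)
    (N : Comodule.{u, v, v, w} (coalgB hB)) (hN : IsYetterDrinfeld N.obj (coactF hB N))
    (hG : CoactGWellDefined hB ⟨N.obj, coactF hB N, hN⟩) (m : N.obj) :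
    coactGB hB ⟨N.obj, coactF hB N, hN⟩ hG.mem m = N.coact m := by
  apply rTensor_ιB_injective (k := k) (H := H) N.obj
  exact (rTensor_coactGB hB ⟨N.obj, coactF hB N, hN⟩ hG.mem m).trans
    (IsComodule.braid_unbraid (σ := N.coact) N.isComodule hR hreg m)

theorem IsRMatrix.coactF_coactGB (hR : IsRMatrix R) (hreg : IsRegular k H)
    (M : YetterDrinfeld.{u, v, w} k H) (hG : CoactGWellDefined hB M) (m : M.obj) :
    coactF hB ⟨M.obj, coactGB hB M hG.mem, hG.isComodule⟩ m = M.coact m :=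
  (congrArg (unbraid M.obj R) (rTensor_coactGB hB M hG.mem m)).trans
    (M.isYetterDrinfeld.unbraid_braid hR hreg m)

/-- The equivalence between `B`-comodules in `C` and Yetter-Drinfeld modules. Its unit and counit
are identities on the underlying modules. -/
noncomputable def IsRMatrix.comoduleEquivalence (hR : IsRMatrix R) (hreg : IsRegular k H)
    (hF : ∀ M : Comodule.{u, v, v, w} (coalgB hB), IsYetterDrinfeld M.obj (coactF hB M))
    (hG : ∀ M : YetterDrinfeld.{u, v, w} k H, CoactGWellDefined hB M) :
    Comodule.{u, v, v, w} (coalgB hB) ≌ YetterDrinfeld.{u, v, w} k H where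
  functor := functorF hB hF
  inverse := functorG hB hG
  unitIso := NatIso.ofComponents
    (fun N => Comodule.isoOfEq N.isComodule (hG ⟨N.obj, coactF hB N, hF N⟩).isComodule
      (hR.coactGB_coactF hreg N (hF N) (hG _)))
    fun _ => Comodule.Hom.ext rfl
  counitIso := NatIso.ofComponents
    (fun M => YetterDrinfeld.isoOfEq
      (hF ⟨M.obj, coactGB hB M (hG M).mem, (hG M).isComodule⟩) M.isYetterDrinfeld
      fun m => (hR.coactF_coactGB hreg M (hG M) m).symm)
    fun _ => YetterDrinfeld.Hom.ext rfl
  functor_unitIso_comp _ := YetterDrinfeld.Hom.ext rfl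

end Isomorphisms

end WHA

theorem mainTheorem8 {k : Type u} {H : Type v} [Field k] [Ring H] [Algebra k H]
    [WHA.WeakHopfAlgebra k H] [Module.Finite k H] (hreg : WHA.IsRegular k H)
    (R : H ⊗[k] H) (hR : WHA.IsRMatrix R) :
    ∃ (hB : WHA.BIsCoalgebra R)
      (hF : ∀ M : WHA.Comodule.{u, v, v, w} (WHA.coalgB hB),
        WHA.IsYetterDrinfeld M.obj (WHA.coactF hB M))
      (hG : ∀ M : WHA.YetterDrinfeld.{u, v, w} k H, WHA.CoactGWellDefined hB M)
      (e : WHA.Comodule.{u, v, v, w} (WHA.coalgB hB) ≌ WHA.YetterDrinfeld.{u, v, w} k H),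
      e.functor = WHA.functorF hB hF ∧ e.inverse = WHA.functorG hB hG :=
  ⟨hR.bIsCoalgebra hreg, hR.isYetterDrinfeld_coactF hreg, hR.coactGWellDefined hreg _,
    hR.comoduleEquivalence hreg (hR.isYetterDrinfeld_coactF hreg) (hR.coactGWellDefined hreg _),
    rfl, rfl⟩
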